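/- Let $\lambda,\mu>0$, $\rho=\lambda/\mu$ and $s\in(0,1)$. For integers $N$ and $S$ consider the homogeneous polling system with $N$ queues and $S$ servers. Customers arrive at each queue according to independent Poisson processes of rate $\lambda$, service times are independent exponential variables of rate $\mu$, at most one server is present at a queue, and moves of servers are instantaneous. At the end of a service the server moves to a queue chosen uniformly at random among the non-empty queues at which no server is present (the queue it has just left included, if it is still non-empty); if there is none it becomes idle, and an idle server goes at once to a queue where a customer arrives. Let $Q_n(t)$ be the number of customers in queue $n$ (the one in service included) and $I_n(t)\in\{0,1\}$ the indicator that a server is present at queue $n$. Then $X(t)=(Q_n(t),I_n(t))_{1\le n\le N}$ is a Markov jump process on the set of states $(q,i)\in(\mathbb N\times\{0,1\})^N$ with $q_n>0$ whenever $i_n=1$ and $\sum_n i_n=\min(|\{n: q_n>0\}|,S)$. The system is called stable if $X$ has a stationary distribution to which the law of $X(t)$ converges, as $t\to\infty$, from every initial state. (1) Suppose $\rho<s$, and let $(S_N)$ be a sequence of non-negative integers with $S_N/N\to s$. For each $N$ let $X^{N}$ be the process above with $N$ queues and $S_N$ servers, whose initial queue lengths $Q_1(0),\dots,Q_N(0)$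 are independent and geometric with parameter $\rho$, i.e. $\mathbb P(Q_n(0)=k)=(1-\rho)\rho^k$ for $k\ge 0$. Let $L_1,\dots,L_N$ be independent $M/M/1$ queue length processes with arrival rate $\lambda$ and service rate $\mu$, at equilibrium, and let $Y^{N}(t)=(L_n(t),\mathbf 1_{\{L_n(t)>0\}})_{1\le n\le N}$. Then, for every $T\ge 0$, the total variation distance between the laws of the paths $(X^{N}(t),0\le t\le T)$ and $(Y^{N}(t),0\le t\le T)$ tends to $0$ as $N\to\infty$. (2) In this limit $\rho<s$ is the stability condition of the system: $\rho<s$ if and only if, for every sequence $(S_N)$ with $S_N/N\to s$, the system with $N$ queues and $S_N$ servers is stable for all sufficiently large $N$. Moreover, if $\rho>s$ then, for every such sequence and all sufficiently large $N$, the system with $N$ queues and $S_N$ servers has no stationary distribution. -/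

import Mathlib

open Filter Topology MeasureTheory ProbabilityTheory
open scoped NNReal ENNReal

namespace Polling

/-! ### Markov jump processes with bounded rates -/

/-- The law at time `t` of the Markov jump process started at `x` in which events occur at the
points of a Poisson process of intensity `Λ` and, at each event, the state `y` is replaced by a
random state of law `K y` (possibly `y` itself). Thus a Poisson number, of parameter `Λ t`, of
steps of the kernel `K` is made, and `y ↦ z` (`z ≠ y`) has transition rate `Λ * K y z`. -/
noncomputable def transitionLaw {E : Type*} (Λ : ℝ≥0) (K : E → PMF E) (t : ℝ≥0) (x : E) : PMF E :=
  (poissonMeasure (Λ * t)).toPMF.bind fun k => (fun p : PMF E => p.bind K)^[k] (PMF.pure x)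

/-- `X` is a (time homogeneous, right-continuous) Markov jump process with event intensity `Λ`
and event kernel `K`; its initial law is arbitrary. The state space carries its discrete
topology. -/
structure IsMarkovJumpProcess {E Ω : Type*} [MeasurableSpace E] [MeasurableSpace Ω]
    (Λ : ℝ≥0) (K : E → PMF E) (P : Measure Ω) (X : ℝ≥0 → Ω → E) : Prop where
  measurable : ∀ t, Measurable (X t)
  right_continuous : ∀ᵐ ω ∂P, ∀ t, ∀ᶠ u in 𝓝[≥] t, X u ω = X t ω
  markov : ∀ (k : ℕ) (t : ℕ → ℝ≥0) (e : ℕ → E), Monotone t →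
    P {ω | ∀ i ≤ k, X (t i) ω = e i} =
      P {ω | X (t 0) ω = e 0} *
        ∏ i ∈ Finset.range k, transitionLaw Λ K (t (i + 1) - t i) (e i) (e (i + 1))

/-! ### The polling system -/

/-- A configuration of `N` queues: for each queue, its number of customers (the one in service
included) and whether a server is present. -/
abbrev Config (N : ℕ) : Type := Fin N → ℕ × Bool

/-- The number of queues at which a server is present. -/
def busy {N : ℕ} (x : Config N) : ℕ := (Finset.univ.filter fun n => (x n).2 = true).card

/-- The number of non-empty queues. -/
def nonemptyQueues {N : ℕ} (x : Config N) : ℕ := (Finset.univ.filter fun n => 0 < (x n).1).card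

/-- The possible states of the system with `S` servers: servers are only at non-empty queues, and,
since moves are instantaneous, a server is idle only if every non-empty queue has a server. -/
def Admissible {N : ℕ} (S : ℕ) (x : Config N) : Prop :=
  (∀ n, (x n).2 = true → 0 < (x n).1) ∧ busy x = min (nonemptyQueues x) S

/-- A customer arrives at queue `n`; if there is an idle server it comes to queue `n`
(unless a server is already there). -/
def arrive {N : ℕ} (S : ℕ) (x : Config N) (n : Fin N) : Config N :=
  Function.update x n ((x n).1 + 1, (x n).2 || decide (busy x < S))

/-- The service in progress at queue `n` ends: a customer and the server leave queue `n`. -/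
def release {N : ℕ} (x : Config N) (n : Fin N) : Config N :=
  Function.update x n ((x n).1 - 1, false)

/-- The non-empty queues at which no server is present. -/
def waiting {N : ℕ} (x : Config N) : Finset (Fin N) :=
  Finset.univ.filter fun m => 0 < (x m).1 ∧ (x m).2 = false

/-- A free server goes to queue `m`. -/
def assign {N : ℕ} (x : Config N) (m : Fin N) : Config N :=
  Function.update x m ((x m).1, true)

/-- The law of `f m` for `m` uniform in the finite set `s`; the constant `d` if `s` is empty. -/
noncomputable def uniformPick {α β : Type*} (s : Finset α) (f : α → β) (d : β) : PMF β :=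
  open Classical in
  if h : s.Nonempty then (PMF.uniformOfFinset s h).map f else PMF.pure d

/-- The service clock of queue `n` rings. If a server is present there, the service ends and the
server moves to a queue chosen uniformly at random among the non-empty queues without server
(the queue just left included, if it is still non-empty), or becomes idle if there is none.
If no server is present at queue `n`, nothing happens. -/
noncomputable def serviceEnd {N : ℕ} (x : Config N) (n : Fin N) : PMF (Config N) :=
  if (x n).2 = true then
    uniformPick (waiting (release x n)) (assign (release x n)) (release x n)
  else PMF.pure x

/-- Probability that an event is an arrival when arrivals have rate `lam` and services rate `mu`:
`true` (arrival) has probability `lam / (lam + mu)`, `false` has probability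
`mu / (lam + mu)`. -/
noncomputable def isArrival (lam mu : ℝ≥0) : PMF Bool :=
  PMF.bernoulli (lam / (lam + mu)) (div_le_one_of_le₀ (le_add_of_nonneg_right mu.2) (lam + mu).2)

/-- One event of the polling system: each queue has an arrival clock of rate `lam` and a service
clock of rate `mu`, so that the clock that rings first belongs to a uniform queue `n` and is
its arrival clock with probability `lam / (lam + mu)`. -/
noncomputable def pollingStep (lam mu : ℝ≥0) {N : ℕ} (S : ℕ) (x : Config N) : PMF (Config N) :=
  (isArrival lam mu).bind fun a =>
    if a = true then uniformPick Finset.univ (arrive S x) x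
    else (uniformPick Finset.univ (serviceEnd x) (PMF.pure x)).bind id

/-- Total intensity of the `2N` clocks. -/
noncomputable def pollingIntensity (lam mu : ℝ≥0) (N : ℕ) : ℝ≥0 := N * (lam + mu)

/-- `X = (Q, I)` is the polling process with `N` queues and `S` servers, arrival rate `lam` per
queue and service rate `mu`, started from an arbitrary random state of the system. -/
structure IsPollingProcess {Ω : Type*} [MeasurableSpace Ω] (lam mu : ℝ≥0) (N S : ℕ)
    (P : Measure Ω) (X : ℝ≥0 → Ω → Config N) : Prop where
  jump : IsMarkovJumpProcess (pollingIntensity lam mu N) (pollingStep lam mu S) P X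
  initial : ∀ᵐ ω ∂P, Admissible S (X 0 ω)

/-- The `ℕ`-valued random variables `Q n` are independent and geometric with parameter `rho`,
i.e. `ℙ(Q n = k) = (1 - rho) * rho ^ k`. -/
def IsIIDGeometric {ι Ω : Type*} [MeasurableSpace Ω] (rho : ℝ) (P : Measure Ω)
    (Q : ι → Ω → ℕ) : Prop :=
  iIndepFun Q P ∧ ∀ n k, P {ω | Q n ω = k} = ENNReal.ofReal ((1 - rho) * rho ^ k)

/-- `pi` is a stationary distribution of the polling process with `S` servers. -/
def IsStationary (lam mu : ℝ≥0) {N : ℕ} (S : ℕ) (pi : PMF (Config N)) : Prop :=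
  (∀ x ∈ pi.support, Admissible S x) ∧
    ∀ t, pi.bind (transitionLaw (pollingIntensity lam mu N) (pollingStep lam mu S) t) = pi

/-- The polling system with `N` queues and `S` servers is stable (ergodic): it has a stationary
distribution, to which its law converges from every initial state. -/
def IsStable (lam mu : ℝ≥0) (N S : ℕ) : Prop :=
  ∃ pi : PMF (Config N), IsStationary lam mu S pi ∧
    ∀ x, Admissible S x → ∀ y,
      Tendsto (fun t => transitionLaw (pollingIntensity lam mu N) (pollingStep lam mu S) t x y)
        atTop (𝓝 (pi y))

/-! ### Independent M/M/1 queues -/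

/-- One event of an M/M/1 queue: an arrival clock of rate `lam` and a service clock of rate `mu`
run; the ringing of the latter removes a customer if there is one (`0 - 1 = 0`). -/
noncomputable def mm1Step (lam mu : ℝ≥0) (q : ℕ) : PMF ℕ :=
  (isArrival lam mu).map fun a => if a = true then q + 1 else q - 1

/-- The `L n` are independent M/M/1 queue length processes with arrival rate `lam` and service
rate `mu`, at equilibrium: the initial lengths are geometric with parameter `lam / mu`. -/
structure IsIndepMM1 {ι Ω : Type*} [MeasurableSpace Ω] (lam mu : ℝ≥0)
    (P : Measure Ω) (L : ι → ℝ≥0 → Ω → ℕ) : Prop where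
  jump : ∀ n, IsMarkovJumpProcess (lam + mu) (mm1Step lam mu) P (L n)
  indep : iIndepFun (fun n ω (t : ℝ≥0) => L n t ω) P
  initial : IsIIDGeometric ((lam : ℝ) / mu) P fun n => L n 0

/-- The configuration process of `N` queues, each with its own server: a server is present exactly
at the non-empty queues. -/
def mm1Config {Ω : Type*} {N : ℕ} (L : Fin N → ℝ≥0 → Ω → ℕ) (t : ℝ≥0) (ω : Ω) : Config N :=
  fun n => (L n t ω, decide (0 < L n t ω))

/-! ### Path laws -/

/-- The law of the path `(X t, 0 ≤ t ≤ T)` for the σ-algebra generated by the coordinates. -/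
noncomputable def pathLaw {E Ω : Type*} [MeasurableSpace E] [MeasurableSpace Ω] (P : Measure Ω)
    (T : ℝ≥0) (X : ℝ≥0 → Ω → E) : Measure (Set.Iic T → E) :=
  P.map fun ω t => X t ω

/-- Total variation distance of two probability measures. -/
noncomputable def tvDist {α : Type*} [MeasurableSpace α] (P Q : Measure α) : ℝ :=
  ⨆ A : {A : Set α // MeasurableSet A}, |P.real A.1 - Q.real A.1|

end Polling

/-!
Write `ρ = lam / mu`. All laws are handled as discrete kernels: `transitionLaw` is a Poisson mixture
of the iterates of the kernel of one event, and `mean` is the expectation in `ℝ≥0∞`.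

**Overload** (`not_exists_isStationary`). If `mu * S < lam * N`, the total number of customers has
an upward drift in every state, so that `z ^ total` with `z < 1` close to `1` is contracted by the
kernel. As it is bounded and positive, no law can be stationary. When `s ≤ ρ`, the numbers of
servers `⌈s * N⌉ - 1` have density `s` and overload all systems; this gives the converse in the
stability criterion.

**Underload** (`isStable_of_lt`). If `lam * N < mu * S` and `S ≤ N`, each queue is treated
separately. With `k = N - S + 1`, a waiting queue finds all `S` servers busy and is picked at rate
at least `mu * S / k`, while a served queue with another customer loses its server at rate at most
`mu * (1 - 1 / k)`. Hence a long queue is served at least a proportion `S / N > ρ` of the time, and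
the weight `z ^ q`, multiplied by some `u > 1` when no server is present, has negative drift for
suitable `z, u > 1`. The sum of these weights is a Lyapunov function with finite sublevel sets
(`exists_drift`). The empty state is accessible and aperiodic, so that Harris' theorem
(`exists_invariant_and_tendsto`) gives an invariant law and convergence of the event chain; the
convergence passes to Poisson times.

**Comparison with M/M/1 queues** (`tvDist_pathLaw_le_exp`). As long as some server is idle, every
non-empty queue is served and the polling system has the transitions of `N` independent M/M/1
queues. Kill the latter at the first event in a state without idle server. Observed along any
finite sequence of times, the killed process lies below both processes, so that the distance of the
laws is at most its loss of mass. Since the product geometric law is invariant for the queues, each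
event costs at most the equilibrium probability of having no idle server
(`tsum_le_tsum_killedLaw_add`), which is exponentially small by Hoeffding's inequality, while the
expected number of events up to time `T` is linear in `N`. Finally the total variation distance on
the path space can be computed on cylinders (`tvDist_le_of_cylinders`).

That independent M/M/1 queues form one jump process driven by `2 N` clocks is the identity
`exp (A₁ + ⋯ + A_N) = exp A₁ ⋯ exp A_N` for the commuting one-queue operators
(`prod_transitionLaw`); with values in `ℝ≥0∞` the exponential series need no convergence.
-/

namespace Polling

/-! ### Expectations and iterates of discrete kernels -/

/-- The expectation of the `ℝ≥0∞`-valued function `f` under `p`. -/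
noncomputable def mean {α : Type*} (p : PMF α) (f : α → ℝ≥0∞) : ℝ≥0∞ := ∑' a, p a * f a

section Mean

variable {α β : Type*}

lemma mean_pure (a : α) (f : α → ℝ≥0∞) : mean (PMF.pure a) f = f a := by
  classical
  rw [mean, tsum_eq_single a]
  · simp
  · intro b hb
    simp [PMF.pure_apply, hb]

lemma mean_bind (p : PMF α) (k : α → PMF β) (f : β → ℝ≥0∞) :
    mean (p.bind k) f = mean p fun a => mean (k a) f := by
  simp only [mean, PMF.bind_apply, ← ENNReal.tsum_mul_right, ← ENNReal.tsum_mul_left]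
  rw [ENNReal.tsum_comm]
  simp only [mul_assoc]

lemma mean_map (p : PMF α) (g : α → β) (f : β → ℝ≥0∞) :
    mean (p.map g) f = mean p fun a => f (g a) := by
  rw [← PMF.bind_pure_comp, mean_bind]
  simp [mean_pure]

lemma mean_mono_support (p : PMF α) {f g : α → ℝ≥0∞} (h : ∀ a ∈ p.support, f a ≤ g a) :
    mean p f ≤ mean p g := by
  refine ENNReal.tsum_le_tsum fun a => ?_
  by_cases ha : p a = 0
  · simp [ha]
  · exact mul_le_mul_right (h a ((PMF.mem_support_iff _ _).2 ha)) _

lemma mean_mono (p : PMF α) {f g : α → ℝ≥0∞} (h : ∀ a, f a ≤ g a) : mean p f ≤ mean p g :=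
  mean_mono_support p fun a _ => h a

lemma mean_add (p : PMF α) (f g : α → ℝ≥0∞) :
    mean p (fun a => f a + g a) = mean p f + mean p g := by
  simp only [mean, mul_add, ENNReal.tsum_add]

lemma mean_mul_left (p : PMF α) (c : ℝ≥0∞) (f : α → ℝ≥0∞) :
    mean p (fun a => c * f a) = c * mean p f := by
  simp only [mean, ← ENNReal.tsum_mul_left]
  exact tsum_congr fun a => by ring

lemma mean_const (p : PMF α) (c : ℝ≥0∞) : mean p (fun _ => c) = c := by
  simp only [mean, ENNReal.tsum_mul_right, p.tsum_coe, one_mul]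

lemma mean_sum {ι : Type*} (p : PMF α) (s : Finset ι) (f : ι → α → ℝ≥0∞) :
    mean p (fun a => ∑ i ∈ s, f i a) = ∑ i ∈ s, mean p (f i) := by
  simp only [mean, Finset.mul_sum]
  exact Summable.tsum_finsetSum fun _ _ => ENNReal.summable

lemma mean_single [DecidableEq α] (p : PMF α) (y : α) : mean p (Pi.single y 1) = p y := by
  rw [mean, tsum_eq_single y]
  · simp
  · intro b hb
    simp [hb]

lemma le_mean (p : PMF α) (f : α → ℝ≥0∞) (a : α) : p a * f a ≤ mean p f :=
  ENNReal.le_tsum a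

end Mean

/-- The law after `k` steps of the kernel `K` started at `x`. -/
noncomputable def iter {E : Type*} (K : E → PMF E) (k : ℕ) (x : E) : PMF E :=
  (fun p : PMF E => p.bind K)^[k] (PMF.pure x)

section Iter

variable {E : Type*} (K : E → PMF E)

@[simp] lemma iter_zero (x : E) : iter K 0 x = PMF.pure x := rfl

lemma iter_succ (k : ℕ) (x : E) : iter K (k + 1) x = (iter K k x).bind K := by
  rw [iter, Function.iterate_succ_apply']
  rfl

lemma iter_add (k l : ℕ) (x : E) : iter K (k + l) x = (iter K k x).bind (iter K l) := by
  induction l with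
  | zero =>
    have : iter K 0 = PMF.pure := rfl
    rw [add_zero, this, PMF.bind_pure]
  | succ l ih =>
    rw [← add_assoc, iter_succ, ih, PMF.bind_bind]
    congr 1
    funext y
    rw [iter_succ]

lemma iter_one (x : E) : iter K 1 x = K x := by
  rw [iter_succ, iter_zero, PMF.pure_bind]

lemma iter_succ' (k : ℕ) (x : E) : iter K (k + 1) x = (K x).bind (iter K k) := by
  rw [add_comm, iter_add, iter_one]

lemma iter_iter (m k : ℕ) (x : E) : iter (iter K m) k x = iter K (m * k) x := by
  induction k generalizing x with
  | zero => rfl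
  | succ k ih =>
    rw [iter_succ, ih, mul_add, mul_one, iter_add]

/-- A set that is closed under the steps of `K` is closed under any number of steps. -/
lemma support_iter {A : E → Prop} (hA : ∀ x, A x → ∀ y ∈ (K x).support, A y) (k : ℕ) (x : E)
    (hx : A x) : ∀ y ∈ (iter K k x).support, A y := by
  induction k with
  | zero =>
    intro y hy
    rw [iter_zero, PMF.mem_support_pure_iff] at hy
    exact hy ▸ hx
  | succ k ih =>
    intro y hy
    rw [iter_succ, PMF.mem_support_bind_iff] at hy
    obtain ⟨z, hz, hy⟩ := hy
    exact hA z (ih z hz) y hy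

end Iter

/-- The Poisson weights `exp (-r) * r ^ k / k!`. -/
noncomputable def poissonWeight (r : ℝ≥0) (k : ℕ) : ℝ≥0∞ := (poissonMeasure r).toPMF k

lemma poissonWeight_eq (r : ℝ≥0) (k : ℕ) :
    poissonWeight r k = ENNReal.ofReal (Real.exp (-r) * r ^ k / k.factorial) := by
  rw [poissonWeight, Measure.toPMF_apply, poissonMeasure_singleton]

lemma tsum_poissonWeight (r : ℝ≥0) : ∑' k, poissonWeight r k = 1 := PMF.tsum_coe _

lemma poissonWeight_pos {r : ℝ≥0} (hr : 0 < r) (k : ℕ) : 0 < poissonWeight r k := by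
  rw [poissonWeight_eq, ENNReal.ofReal_pos]
  have : (0 : ℝ) < r := hr
  positivity

/-- The weight in the form used for exponential series of operators. -/
lemma poissonWeight_eq_mul (r : ℝ≥0) (k : ℕ) :
    poissonWeight r k =
      ENNReal.ofReal (Real.exp (-r)) * ((r : ℝ≥0∞) ^ k * ((k.factorial : ℝ≥0∞))⁻¹) := by
  rw [poissonWeight_eq, mul_div_assoc, ENNReal.ofReal_mul (Real.exp_pos _).le, div_eq_mul_inv,
    ENNReal.ofReal_mul (by positivity), ENNReal.ofReal_pow r.coe_nonneg,
    ENNReal.ofReal_inv_of_pos (by positivity), ENNReal.ofReal_natCast, ENNReal.ofReal_coe_nnreal]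

/-- The mean of the Poisson distribution. -/
lemma tsum_poissonWeight_mul_nat (r : ℝ≥0) : ∑' k, poissonWeight r k * (k : ℝ≥0∞) = r := by
  rw [tsum_eq_zero_add' ENNReal.summable]
  have h : ∀ k : ℕ, poissonWeight r (k + 1) * ((k + 1 : ℕ) : ℝ≥0∞) = r * poissonWeight r k := by
    intro k
    rw [poissonWeight_eq, poissonWeight_eq, ← ENNReal.ofReal_natCast (k + 1),
      ← ENNReal.ofReal_mul (by positivity), ← ENNReal.ofReal_coe_nnreal (p := r),
      ← ENNReal.ofReal_mul r.coe_nonneg]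
    congr 1
    rw [Nat.factorial_succ]
    push_cast
    field_simp
    ring
  simp only [h, ENNReal.tsum_mul_left, tsum_poissonWeight, Nat.cast_zero, mul_zero, zero_add,
    mul_one]

lemma mean_transitionLaw {E : Type*} (Λ : ℝ≥0) (K : E → PMF E) (t : ℝ≥0) (x : E)
    (f : E → ℝ≥0∞) :
    mean (transitionLaw Λ K t x) f = ∑' k, poissonWeight (Λ * t) k * mean (iter K k x) f := by
  rw [transitionLaw, mean_bind]
  rfl

lemma transitionLaw_apply {E : Type*} (Λ : ℝ≥0) (K : E → PMF E) (t : ℝ≥0) (x y : E) :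
    transitionLaw Λ K t x y = ∑' k, poissonWeight (Λ * t) k * iter K k x y := by
  rw [transitionLaw, PMF.bind_apply]
  rfl

/-! ### Expectations under one step of the polling system -/

lemma mean_uniformPick {α β : Type*} (s : Finset α) (f : α → β) (d : β) (g : β → ℝ≥0∞) :
    mean (uniformPick s f d) g =
      if s.Nonempty then (∑ a ∈ s, g (f a)) / (s.card : ℝ≥0∞) else g d := by
  classical
  rw [uniformPick]
  split_ifs with h
  · rw [mean_map, mean, tsum_eq_sum (s := s)]
    · rw [ENNReal.div_eq_inv_mul, Finset.mul_sum]
      refine Finset.sum_congr rfl fun a ha => ?_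
      rw [PMF.uniformOfFinset_apply_of_mem h ha]
    · intro a ha
      rw [PMF.uniformOfFinset_apply_of_notMem h ha, zero_mul]
  · exact mean_pure _ _

lemma mem_support_uniformPick {α β : Type*} (s : Finset α) (f : α → β) (d : β) (y : β) :
    y ∈ (uniformPick s f d).support ↔ (∃ a ∈ s, f a = y) ∨ (¬ s.Nonempty ∧ y = d) := by
  classical
  rw [uniformPick]
  split_ifs with h
  · simp [h]
  · rw [PMF.mem_support_pure_iff]
    simp only [h, not_false_iff, true_and]
    constructor
    · exact Or.inr
    · rintro (⟨a, ha, -⟩ | h')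
      · exact absurd ⟨a, ha⟩ h
      · exact h'

variable {lam mu : ℝ≥0}

/-- The probability that an event is an arrival. -/
noncomputable def arrivalProb (lam mu : ℝ≥0) : ℝ≥0 := lam / (lam + mu)

/-- The probability that an event is the ringing of a service clock. -/
noncomputable def serviceProb (lam mu : ℝ≥0) : ℝ≥0 := mu / (lam + mu)

lemma arrivalProb_add_serviceProb (hmu : 0 < mu) :
    arrivalProb lam mu + serviceProb lam mu = 1 := by
  rw [arrivalProb, serviceProb, ← add_div, div_self]
  positivity

lemma isArrival_true (lam mu : ℝ≥0) : isArrival lam mu true = arrivalProb lam mu := rfl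

lemma isArrival_false (hmu : 0 < mu) : isArrival lam mu false = serviceProb lam mu := by
  change ((1 - lam / (lam + mu) : ℝ≥0) : ℝ≥0∞) = _
  rw [← arrivalProb_add_serviceProb (lam := lam) hmu, arrivalProb, add_tsub_cancel_left]

lemma mean_isArrival (hmu : 0 < mu) (g : Bool → ℝ≥0∞) :
    mean (isArrival lam mu) g = arrivalProb lam mu * g true + serviceProb lam mu * g false := by
  rw [mean, tsum_bool, isArrival_true, isArrival_false hmu, add_comm]

lemma mean_serviceEnd {N : ℕ} (x : Config N) (n : Fin N) (g : Config N → ℝ≥0∞) :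
    mean (serviceEnd x n) g =
      if (x n).2 = true then
        if (waiting (release x n)).Nonempty then
          (∑ m ∈ waiting (release x n), g (assign (release x n) m)) /
            ((waiting (release x n)).card : ℝ≥0∞)
        else g (release x n)
      else g x := by
  rw [serviceEnd]
  split_ifs with h h'
  · rw [mean_uniformPick, if_pos h']
  · rw [mean_uniformPick, if_neg h']
  · exact mean_pure _ _

lemma mean_pollingStep (hmu : 0 < mu) {N : ℕ} (hN : 0 < N) (S : ℕ) (x : Config N)
    (g : Config N → ℝ≥0∞) :
    mean (pollingStep lam mu S x) g =
      arrivalProb lam mu * ((∑ n, g (arrive S x n)) / N) +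
        serviceProb lam mu * ((∑ n, mean (serviceEnd x n) g) / N) := by
  have hne : (Finset.univ : Finset (Fin N)).Nonempty := ⟨⟨0, hN⟩, Finset.mem_univ _⟩
  rw [pollingStep, mean_bind, mean_isArrival hmu, if_pos rfl, if_neg (by simp), mean_bind,
    mean_uniformPick, mean_uniformPick, if_pos hne, if_pos hne]
  simp

lemma mem_support_serviceEnd {N : ℕ} {x : Config N} {n : Fin N} {y : Config N}
    (hy : y ∈ (serviceEnd x n).support) :
    y = x ∨ (x n).2 = true ∧
      ((∃ m ∈ waiting (release x n), assign (release x n) m = y) ∨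
        ¬ (waiting (release x n)).Nonempty ∧ y = release x n) := by
  rw [serviceEnd] at hy
  split_ifs at hy with h
  · exact Or.inr ⟨h, (mem_support_uniformPick _ _ _ _).1 hy⟩
  · exact Or.inl ((PMF.mem_support_pure_iff _ _).1 hy)

lemma mem_support_pollingStep {N S : ℕ} {x y : Config N}
    (hy : y ∈ (pollingStep lam mu S x).support) :
    y = x ∨ (∃ n, arrive S x n = y) ∨ ∃ n, y ∈ (serviceEnd x n).support := by
  rw [pollingStep, PMF.mem_support_bind_iff] at hy
  obtain ⟨a, -, hy⟩ := hy
  split_ifs at hy with h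
  · rcases (mem_support_uniformPick _ _ _ _).1 hy with ⟨n, -, h⟩ | ⟨-, h⟩
    · exact Or.inr (Or.inl ⟨n, h⟩)
    · exact Or.inl h
  · rw [PMF.mem_support_bind_iff] at hy
    obtain ⟨p, hp, hy⟩ := hy
    rcases (mem_support_uniformPick _ _ _ _).1 hp with ⟨n, -, rfl⟩ | ⟨-, rfl⟩
    · exact Or.inr (Or.inr ⟨n, hy⟩)
    · exact Or.inl ((PMF.mem_support_pure_iff _ _).1 hy)

/-! ### Admissible states -/

lemma card_filter_update {N : ℕ} (x : Config N) (n : Fin N) (v : ℕ × Bool) (p : ℕ × Bool → Prop)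
    [DecidablePred p] :
    (Finset.univ.filter fun m => p (Function.update x n v m)).card + (if p (x n) then 1 else 0) =
      (Finset.univ.filter fun m => p (x m)).card + (if p v then 1 else 0) := by
  rw [Finset.card_filter, Finset.card_filter, ← Finset.add_sum_erase _ _ (Finset.mem_univ n),
    ← Finset.add_sum_erase _ (fun m => if p (x m) then 1 else 0) (Finset.mem_univ n)]
  have : ∑ m ∈ Finset.univ.erase n, (if p (Function.update x n v m) then 1 else 0) =
      ∑ m ∈ Finset.univ.erase n, if p (x m) then 1 else 0 :=
    Finset.sum_congr rfl fun m hm => by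
      rw [Function.update_of_ne (Finset.ne_of_mem_erase hm)]
  rw [this, Function.update_self]
  ring

lemma busy_update {N : ℕ} (x : Config N) (n : Fin N) (v : ℕ × Bool) :
    busy (Function.update x n v) + (if (x n).2 = true then 1 else 0) =
      busy x + (if v.2 = true then 1 else 0) :=
  card_filter_update x n v fun w => w.2 = true

lemma nonemptyQueues_update {N : ℕ} (x : Config N) (n : Fin N) (v : ℕ × Bool) :
    nonemptyQueues (Function.update x n v) + (if 0 < (x n).1 then 1 else 0) =
      nonemptyQueues x + (if 0 < v.1 then 1 else 0) :=
  card_filter_update x n v fun w => 0 < w.1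

/-- If servers are only at non-empty queues, a non-empty queue is either served or waiting. -/
lemma card_waiting_add_busy {N : ℕ} {x : Config N} (h : ∀ n, (x n).2 = true → 0 < (x n).1) :
    (waiting x).card + busy x = nonemptyQueues x := by
  rw [waiting, busy, nonemptyQueues, ← Finset.card_union_of_disjoint]
  · congr 1
    ext n
    simp only [Finset.mem_union, Finset.mem_filter, Finset.mem_univ, true_and]
    constructor
    · rintro (h' | h')
      · exact h'.1
      · exact h n h'
    · intro h'
      cases hb : (x n).2
      · exact Or.inl ⟨h', rfl⟩
      · exact Or.inr rfl
  · rw [Finset.disjoint_filter]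
    rintro n - ⟨-, h1⟩ h2
    simp [h1] at h2

lemma Admissible.busy_le {N S : ℕ} {x : Config N} (h : Admissible S x) : busy x ≤ S := by
  rw [h.2]
  exact min_le_right _ _

/-- If a queue is waiting then all servers are busy. -/
lemma Admissible.busy_eq_of_waiting {N S : ℕ} {x : Config N} (h : Admissible S x) {n : Fin N}
    (h0 : 0 < (x n).1) (hn : (x n).2 = false) : busy x = S := by
  have h1 := card_waiting_add_busy h.1
  have h2 : 0 < (waiting x).card := Finset.card_pos.2 ⟨n, by simp [waiting, h0, hn]⟩
  have h3 := h.2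
  omega

lemma Admissible.arrive {N S : ℕ} {x : Config N} (h : Admissible S x) (n : Fin N) :
    Admissible S (arrive S x n) := by
  refine ⟨fun m hm => ?_, ?_⟩
  · by_cases hmn : m = n
    · subst hmn
      simp [Polling.arrive]
    · rw [Polling.arrive, Function.update_of_ne hmn] at hm ⊢
      exact h.1 m hm
  · have h1 := busy_update x n ((x n).1 + 1, (x n).2 || decide (busy x < S))
    have h2 := nonemptyQueues_update x n ((x n).1 + 1, (x n).2 || decide (busy x < S))
    have h3 := h.2
    rw [← Polling.arrive] at h1 h2
    simp only [Nat.succ_pos, if_true] at h2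
    rcases Nat.eq_zero_or_pos (x n).1 with h0 | h0
    · have hf : (x n).2 = false := by
        cases hb : (x n).2
        · rfl
        · exact absurd (h.1 n hb) (by omega)
      simp only [hf, h0, Bool.false_or, decide_eq_true_eq, lt_irrefl, if_false,
        Bool.false_eq_true] at h1 h2
      split_ifs at h1 <;> omega
    · simp only [h0, if_true] at h2
      cases hb : (x n).2
      · have := h.busy_eq_of_waiting h0 hb
        simp only [hb, this, Bool.false_or, lt_irrefl, decide_false, if_false,
          Bool.false_eq_true] at h1
        omega
      · simp only [hb, Bool.true_or, if_true] at h1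
        omega

lemma Admissible.serviceEnd {N S : ℕ} {x : Config N} (h : Admissible S x) (n : Fin N)
    {y : Config N} (hy : y ∈ (serviceEnd x n).support) : Admissible S y := by
  rcases mem_support_serviceEnd hy with rfl | ⟨hn, hy⟩
  · exact h
  have hrel : ∀ m, (release x n m).2 = true → 0 < (release x n m).1 := by
    intro m hm
    by_cases hmn : m = n
    · subst hmn
      simp [release] at hm
    · rw [release, Function.update_of_ne hmn] at hm ⊢
      exact h.1 m hm
  have h0 := h.1 n hn
  have h1 := busy_update x n ((x n).1 - 1, false)
  have h2 := nonemptyQueues_update x n ((x n).1 - 1, false)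
  have h3 := h.2
  have h4 := card_waiting_add_busy hrel
  rw [← release] at h1 h2
  simp only [hn, h0, if_true, Bool.false_eq_true, if_false] at h1 h2
  rcases hy with ⟨m, hm, rfl⟩ | ⟨hw, rfl⟩
  · have hm' : 0 < (release x n m).1 ∧ (release x n m).2 = false := by
      simpa [waiting] using hm
    have hpos : 0 < (waiting (release x n)).card := Finset.card_pos.2 ⟨m, hm⟩
    refine ⟨fun l hl => ?_, ?_⟩
    · by_cases hlm : l = m
      · subst hlm
        simpa [assign] using hm'.1
      · rw [assign, Function.update_of_ne hlm] at hl ⊢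
        exact hrel l hl
    · have h5 := busy_update (release x n) m ((release x n m).1, true)
      have h6 := nonemptyQueues_update (release x n) m ((release x n m).1, true)
      rw [← assign] at h5 h6
      simp only [hm'.1, hm'.2, if_true, Bool.false_eq_true, if_false] at h5 h6
      split_ifs at h2 <;> omega
  · refine ⟨hrel, ?_⟩
    have hw0 : (waiting (release x n)).card = 0 := by
      rw [Finset.card_eq_zero]
      exact Finset.not_nonempty_iff_eq_empty.1 hw
    split_ifs at h2 <;> omega

lemma Admissible.pollingStep {N S : ℕ} {x : Config N} (h : Admissible S x) :
    ∀ y ∈ (pollingStep lam mu S x).support, Admissible S y := by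
  intro y hy
  rcases mem_support_pollingStep hy with rfl | ⟨n, rfl⟩ | ⟨n, hy⟩
  · exact h
  · exact h.arrive n
  · exact h.serviceEnd n hy

/-! ### Overloaded systems have no stationary distribution -/

/-- The total number of customers in the system. -/
def total {N : ℕ} (x : Config N) : ℕ := ∑ n, (x n).1

lemma total_update {N : ℕ} (x : Config N) (n : Fin N) (v : ℕ × Bool) :
    total (Function.update x n v) + (x n).1 = total x + v.1 := by
  rw [total, total, ← Finset.add_sum_erase _ _ (Finset.mem_univ n),
    ← Finset.add_sum_erase _ (fun m => (x m).1) (Finset.mem_univ n)]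
  have : ∑ m ∈ Finset.univ.erase n, (Function.update x n v m).1 =
      ∑ m ∈ Finset.univ.erase n, (x m).1 :=
    Finset.sum_congr rfl fun m hm => by
      rw [Function.update_of_ne (Finset.ne_of_mem_erase hm)]
  rw [this, Function.update_self]
  ring

lemma total_arrive {N : ℕ} (S : ℕ) (x : Config N) (n : Fin N) :
    total (arrive S x n) = total x + 1 := by
  have := total_update x n ((x n).1 + 1, (x n).2 || decide (busy x < S))
  rw [← arrive] at this
  simp only at this
  omega

lemma total_release {N : ℕ} (x : Config N) (n : Fin N) (h : 0 < (x n).1) :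
    total (release x n) + 1 = total x := by
  have := total_update x n ((x n).1 - 1, false)
  rw [← release] at this
  simp only at this
  omega

lemma total_assign {N : ℕ} (x : Config N) (m : Fin N) : total (assign x m) = total x := by
  have := total_update x m ((x m).1, true)
  rw [← assign] at this
  simp only at this
  omega

/-- A service clock that rings at a busy queue removes one customer. -/
lemma total_serviceEnd {N : ℕ} {x : Config N} {n : Fin N} (h : 0 < (x n).1) (hn : (x n).2 = true)
    {y : Config N} (hy : y ∈ (serviceEnd x n).support) : total y + 1 = total x := by
  rw [serviceEnd, if_pos hn, mem_support_uniformPick] at hy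
  rcases hy with ⟨m, -, rfl⟩ | ⟨-, rfl⟩
  · rw [total_assign, total_release x n h]
  · exact total_release x n h

/-- If `mu * S < z * lam * N` with `z < 1`, the function `z ^ total x` decreases at a fixed rate:
the upward drift of `total`, at least `lam * N - mu * S` per unit time, is bounded below. -/
lemma exists_mean_pow_total_le (hlam : 0 < lam) (hmu : 0 < mu) {N S : ℕ} (hN : 0 < N)
    {z : ℝ≥0} (hz0 : 0 < z) (hz1 : z < 1) (hz : mu * S < z * (lam * N)) :
    ∃ r : ℝ≥0, r < 1 ∧ ∀ x : Config N, Admissible S x →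
      mean (pollingStep lam mu S x) (fun y => ((z ^ total y : ℝ≥0) : ℝ≥0∞)) ≤
        (r : ℝ≥0∞) * (z ^ total x : ℝ≥0) := by
  have hN' : (0 : ℝ) < N := by exact_mod_cast hN
  have hz0' : (0 : ℝ) < z := hz0
  have hz1' : (z : ℝ) < 1 := hz1
  have hlam' : (0 : ℝ) < lam := hlam
  have hmu' : (0 : ℝ) < mu := hmu
  have hzr : (mu : ℝ) * S < z * (lam * N) := by exact_mod_cast hz
  -- the value of the factor when all `S` servers are busy
  set r : ℝ := (lam * z + mu * (1 + (S / N) * (1 / z - 1))) / (lam + mu) with hr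
  have hz1'' : (0 : ℝ) ≤ 1 / z - 1 := by
    rw [sub_nonneg, le_div_iff₀ hz0']
    linarith
  have hr0 : 0 ≤ r := by
    rw [hr]
    positivity
  refine ⟨r.toNNReal, ?_, ?_⟩
  · rw [← NNReal.coe_lt_coe, Real.coe_toNNReal r hr0, NNReal.coe_one, hr, div_lt_one (by positivity)]
    have : (mu : ℝ) * ((S / N) * (1 / z - 1)) < lam * (1 - z) := by
      have e : (mu : ℝ) * ((S / N) * (1 / z - 1)) = (mu * S) / (z * N) * (1 - z) := by
        field_simp
      rw [e]
      refine mul_lt_mul_of_pos_right ?_ (by linarith)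
      rw [div_lt_iff₀ (by positivity)]
      linarith
    linarith
  · intro x hx
    rw [mean_pollingStep hmu hN]
    have h1 : ∀ n : Fin N, mean (serviceEnd x n) (fun y => ((z ^ total y : ℝ≥0) : ℝ≥0∞)) =
        ((if (x n).2 = true then z ^ total x / z else z ^ total x : ℝ≥0) : ℝ≥0∞) := by
      intro n
      split_ifs with hn
      · rw [← mean_const (serviceEnd x n) ((z ^ total x / z : ℝ≥0) : ℝ≥0∞)]
        refine le_antisymm (mean_mono_support _ fun y hy => ?_)
          (mean_mono_support _ fun y hy => ?_) <;>
        · rw [← total_serviceEnd (hx.1 n hn) hn hy, pow_succ, mul_div_cancel_right₀ _ hz0.ne']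
      · rw [mean_serviceEnd, if_neg hn]
    have hNN : (N : ℝ≥0) ≠ 0 := by exact_mod_cast hN.ne'
    simp only [h1, total_arrive]
    rw [← ENNReal.coe_natCast, ← ENNReal.ofNNReal_finsetSum, ← ENNReal.ofNNReal_finsetSum,
      ← ENNReal.coe_div hNN, ← ENNReal.coe_div hNN, ← ENNReal.coe_mul, ← ENNReal.coe_mul,
      ← ENNReal.coe_mul, ← ENNReal.coe_add, ENNReal.coe_le_coe, ← NNReal.coe_le_coe]
    have h2 : ∑ n : Fin N, (if (x n).2 = true then z ^ total x / z else z ^ total x) =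
        busy x * (z ^ total x / z) + ((N - busy x : ℕ) : ℝ≥0) * z ^ total x := by
      rw [Finset.sum_ite, Finset.sum_const, Finset.sum_const, nsmul_eq_mul, nsmul_eq_mul]
      have h4 : (Finset.univ.filter fun n : Fin N => ¬ (x n).2 = true).card = N - busy x := by
        have := Finset.card_filter_add_card_filter_not (s := (Finset.univ : Finset (Fin N)))
          (fun n => (x n).2 = true)
        rw [Finset.card_univ, Fintype.card_fin] at this
        rw [busy]
        omega
      rw [h4, busy]
    have hbN : busy x ≤ N := by
      simpa [busy] using Finset.card_filter_le (Finset.univ : Finset (Fin N))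
        (fun n => (x n).2 = true)
    have hbS : (busy x : ℝ) ≤ S := by exact_mod_cast hx.busy_le
    have hd : ((N - busy x : ℕ) : ℝ) = N - busy x := Nat.cast_sub hbN
    rw [h2]
    generalize N - busy x = d at hd
    simp only [Finset.sum_const, Finset.card_univ, Fintype.card_fin, nsmul_eq_mul, arrivalProb,
      serviceProb]
    rw [NNReal.coe_mul r.toNNReal, Real.coe_toNNReal r hr0]
    push_cast
    rw [hd]
    set p : ℝ := (z : ℝ) ^ total x with hp
    have hp0 : 0 ≤ p := by positivity
    have e1 : (lam : ℝ) / (lam + mu) * (N * (z : ℝ) ^ (total x + 1) / N) +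
        mu / (lam + mu) * ((busy x * (p / z) + (N - busy x) * p) / N) =
        (lam * z + mu * (1 + (busy x / N) * (1 / z - 1))) / (lam + mu) * p := by
      rw [pow_succ, ← hp]
      field_simp
      ring
    rw [e1, hr]
    refine mul_le_mul_of_nonneg_right ?_ hp0
    gcongr

/-- When customers arrive faster than the servers can work, there is no stationary
distribution. -/
theorem not_exists_isStationary (hlam : 0 < lam) (hmu : 0 < mu) {N S : ℕ} (hN : 0 < N)
    (h : (mu : ℝ) * S < lam * N) :
    ¬ ∃ pi : PMF (Config N), IsStationary lam mu S pi := by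
  rintro ⟨pi, hadm, hstat⟩
  have hlam' : (0 : ℝ) < lam := hlam
  have hN' : (0 : ℝ) < N := by exact_mod_cast hN
  obtain ⟨z', hz1', hz2'⟩ := exists_between (a₁ := (mu : ℝ) * S / (lam * N)) (a₂ := 1)
    (by rw [div_lt_one (by positivity)]; exact h)
  have hz0' : 0 < z' := lt_of_le_of_lt (by positivity) hz1'
  lift z' to ℝ≥0 using hz0'.le with z
  have hz0 : 0 < z := hz0'
  have hz1 : z < 1 := hz2'
  have hz : mu * S < z * (lam * N) := by
    rw [div_lt_iff₀ (by positivity)] at hz1'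
    exact_mod_cast hz1'
  obtain ⟨r, hr1, hr⟩ := exists_mean_pow_total_le hlam hmu hN hz0 hz1 hz
  set g : Config N → ℝ≥0∞ := fun y => ((z ^ total y : ℝ≥0) : ℝ≥0∞) with hg
  have hiter : ∀ (k : ℕ) (x : Config N), Admissible S x →
      mean (iter (pollingStep lam mu S) k x) g ≤ (r : ℝ≥0∞) ^ k * g x := by
    intro k
    induction k with
    | zero =>
      intro x _
      simp [mean_pure]
    | succ k ih =>
      intro x hx
      rw [iter_succ, mean_bind, pow_succ]
      calc mean (iter (pollingStep lam mu S) k x) (fun y => mean (pollingStep lam mu S y) g)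
          ≤ mean (iter (pollingStep lam mu S) k x) (fun y => r * g y) :=
            mean_mono_support _ fun y hy =>
              hr y (support_iter _ (fun _ h => h.pollingStep) k x hx y hy)
        _ = r * mean (iter (pollingStep lam mu S) k x) g := mean_mul_left _ _ _
        _ ≤ r * ((r : ℝ≥0∞) ^ k * g x) := by gcongr; exact ih x hx
        _ = (r : ℝ≥0∞) ^ k * r * g x := by ring
  set Λ := pollingIntensity lam mu N with hΛ
  have hΛ0 : 0 < Λ * 1 := by
    rw [hΛ, pollingIntensity]
    have : (0 : ℝ≥0) < N := by exact_mod_cast hN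
    positivity
  set θ : ℝ≥0∞ := ∑' k, poissonWeight (Λ * 1) k * (r : ℝ≥0∞) ^ k with hθ
  have hr1' : (r : ℝ≥0∞) < 1 := by exact_mod_cast hr1
  have hle : ∀ k, poissonWeight (Λ * 1) k * (r : ℝ≥0∞) ^ k ≤ poissonWeight (Λ * 1) k := fun k =>
    mul_le_of_le_one_right zero_le (pow_le_one₀ zero_le hr1'.le)
  have hθ1 : θ < 1 := by
    rw [hθ, ← tsum_poissonWeight (Λ * 1)]
    refine ENNReal.tsum_lt_tsum (i := 1) ?_ hle ?_
    · refine ne_top_of_le_ne_top ENNReal.one_ne_top ?_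
      rw [← tsum_poissonWeight (Λ * 1)]
      exact ENNReal.tsum_le_tsum hle
    · rw [pow_one]
      have hfin : poissonWeight (Λ * 1) 1 ≠ ∞ := PMF.apply_ne_top _ _
      calc poissonWeight (Λ * 1) 1 * r < poissonWeight (Λ * 1) 1 * 1 :=
            (ENNReal.mul_lt_mul_iff_right (poissonWeight_pos hΛ0 1).ne' hfin).2 hr1'
        _ = _ := mul_one _
  have key : mean pi g ≤ θ * mean pi g := by
    conv_lhs => rw [← hstat 1, mean_bind]
    rw [← mean_mul_left]
    refine mean_mono_support _ fun x hx => ?_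
    rw [mean_transitionLaw, hθ, ← ENNReal.tsum_mul_right]
    refine ENNReal.tsum_le_tsum fun k => ?_
    rw [mul_assoc]
    gcongr
    exact hiter k x (hadm x hx)
  have hfin : mean pi g ≠ ∞ := by
    refine ne_top_of_le_ne_top ENNReal.one_ne_top ?_
    rw [← mean_const pi 1]
    refine mean_mono _ fun y => ?_
    change ((z ^ total y : ℝ≥0) : ℝ≥0∞) ≤ 1
    exact_mod_cast pow_le_one₀ zero_le hz1.le
  have hpos : mean pi g ≠ 0 := by
    obtain ⟨x, hx⟩ := pi.support_nonempty
    refine (lt_of_lt_of_le ?_ (le_mean pi g x)).ne'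
    refine ENNReal.mul_pos ((PMF.mem_support_iff _ _).1 hx) ?_
    change ((z ^ total x : ℝ≥0) : ℝ≥0∞) ≠ 0
    exact_mod_cast (pow_pos hz0 _).ne'
  refine absurd key (not_le.2 ?_)
  calc θ * mean pi g < 1 * mean pi g := (ENNReal.mul_lt_mul_iff_left hpos hfin).2 hθ1
    _ = mean pi g := one_mul _

/-! ### Geometric ergodicity from a Lyapunov function -/

section Ergodic

variable {E : Type*}

/-- Couple two steps of `P`, started at `x` and `y`, independently. If both lead to `o`, they do
not contribute to the difference of the expectations of `φ`. -/
lemma mean_le_mean_add_of_meeting [DecidableEq E] (P : E → PMF E) (d : E → E → ℝ≥0∞) (o : E)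
    (φ : E → ℝ≥0∞) (c : ℝ≥0∞) (h : ∀ x y, x ≠ y → φ x ≤ φ y + c * d x y) (x y : E) :
    mean (P x) φ ≤ mean (P y) φ +
      c * mean (P x) fun x' => mean (P y) fun y' => if x' = o ∧ y' = o then 0 else d x' y' := by
  calc mean (P x) φ = mean (P x) fun x' => mean (P y) fun _ => φ x' := by
        simp only [mean_const]
    _ ≤ mean (P x) fun x' => mean (P y) fun y' =>
          φ y' + c * (if x' = o ∧ y' = o then 0 else d x' y') := by
        refine mean_mono _ fun x' => mean_mono _ fun y' => ?_
        by_cases hxy : x' = y'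
        · rw [hxy]
          exact le_self_add
        · rw [if_neg fun h' => hxy (h'.1.trans h'.2.symm)]
          exact h x' y' hxy
    _ = _ := by
        simp only [mean_add, mean_mul_left, mean_const]

/-- One step of a kernel with a Lyapunov function `V` and a state `o` that is charged uniformly
from the sublevel set `{V ≤ R}` contracts the weighted oscillation seminorm. -/
lemma exists_contraction (P : E → PMF E) (V : E → ℝ≥0∞) (o : E) {γ C R η : ℝ} (hγ0 : 0 ≤ γ)
    (hγ : γ < 1) (hC : 0 ≤ C) (hη : 0 < η) (hR1 : 1 ≤ R) (hR : 4 * C ≤ (1 - γ) * R)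
    (hdrift : ∀ x, mean (P x) V ≤ ENNReal.ofReal γ * V x + ENNReal.ofReal C)
    (hmin : ∀ x, V x ≤ ENNReal.ofReal R → ENNReal.ofReal η ≤ P x o) :
    ∃ β : ℝ≥0, ∃ α : ℝ≥0, α < 1 ∧
      ∀ (φ : E → ℝ≥0∞) (c : ℝ≥0∞),
        (∀ x y, x ≠ y → φ x ≤ φ y + c * (1 + β * (V x + V y))) →
        ∀ x y, mean (P x) φ ≤ mean (P y) φ + c * α * (1 + β * (V x + V y)) := by
  classical
  -- `β` is small enough for the additive constant `2 * β * C` to be absorbed by the gain `η ^ 2`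
  set β : ℝ := η ^ 2 / (4 * (C + 1)) with hβ
  have hβ0 : 0 < β := by positivity
  have hβC : 2 * β * C ≤ η ^ 2 / 2 := by
    have : β * (4 * (C + 1)) = η ^ 2 := by
      rw [hβ]
      field_simp
    nlinarith
  set ε : ℝ := β * (1 - γ) / (2 * (1 + β)) with hε
  have h1γ : 0 < 1 - γ := by linarith
  have hε0 : 0 < ε := by positivity
  have hεe : ε * (2 * (1 + β)) = β * (1 - γ) := by
    rw [hε]
    field_simp
  have hε1 : ε < 1 := by nlinarith
  set α : ℝ := max (max (1 - η ^ 2 / 2) γ) (1 - ε) with hα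
  have hα1 : α < 1 := by
    rw [hα, max_lt_iff, max_lt_iff]
    refine ⟨⟨?_, hγ⟩, by linarith⟩
    have : 0 < η ^ 2 := by positivity
    linarith
  have hα0 : 0 < α := lt_of_lt_of_le (by linarith) (le_max_right _ _)
  have ha1 : 1 - η ^ 2 / 2 ≤ α := (le_max_left _ _).trans (le_max_left _ _)
  have ha2 : γ ≤ α := (le_max_right _ _).trans (le_max_left _ _)
  have ha3 : 1 - ε ≤ α := le_max_right _ _
  refine ⟨β.toNNReal, α.toNNReal, by simpa using hα1, fun φ c h x y => ?_⟩
  refine (mean_le_mean_add_of_meeting P _ o φ c h x y).trans ?_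
  rw [mul_assoc]
  gcongr
  set H : ℝ≥0∞ := mean (P x) fun x' => mean (P y) fun y' =>
    if x' = o ∧ y' = o then 0 else 1 + (β.toNNReal : ℝ≥0∞) * (V x' + V y') with hH
  have hsum : (mean (P x) fun x' => mean (P y) fun y' =>
      1 + (β.toNNReal : ℝ≥0∞) * (V x' + V y')) =
      1 + β.toNNReal * (mean (P x) V + mean (P y) V) := by
    simp only [mean_add, mean_mul_left, mean_const]
  have hb : H + P x o * P y o ≤ 1 + β.toNNReal * (mean (P x) V + mean (P y) V) := by
    have : P x o * P y o =
        mean (P x) fun x' => mean (P y) fun y' => if x' = o ∧ y' = o then 1 else 0 := by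
      have h1 : ∀ x' y' : E, (if x' = o ∧ y' = o then (1 : ℝ≥0∞) else 0) =
          (Pi.single o 1 : E → ℝ≥0∞) x' * (Pi.single o 1 : E → ℝ≥0∞) y' := by
        intro x' y'
        by_cases hx : x' = o <;> by_cases hy : y' = o <;> simp [hx, hy]
      simp only [h1, mean_mul_left, mean_single]
      rw [mul_comm, ← mean_single (P x) o, ← mean_mul_left]
      simp only [mul_comm]
    rw [this, hH, ← mean_add, ← hsum]
    refine mean_mono _ fun x' => ?_
    rw [← mean_add]
    refine mean_mono _ fun y' => ?_
    split_ifs <;> simp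
  have ha : H ≤ 1 + β.toNNReal * (mean (P x) V + mean (P y) V) := le_self_add.trans hb
  have hdr : mean (P x) V + mean (P y) V ≤
      ENNReal.ofReal γ * (V x + V y) + ENNReal.ofReal (2 * C) := by
    refine (add_le_add (hdrift x) (hdrift y)).trans (le_of_eq ?_)
    rw [two_mul, ENNReal.ofReal_add hC hC]
    ring
  by_cases hv : V x + V y = ∞
  · rw [hv, ENNReal.mul_top (by simpa using hβ0), add_top, ENNReal.mul_top (by simpa using hα0)]
    exact le_top
  obtain ⟨v, hv0, hve⟩ : ∃ v : ℝ, 0 ≤ v ∧ V x + V y = ENNReal.ofReal v :=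
    ⟨(V x + V y).toReal, ENNReal.toReal_nonneg, (ENNReal.ofReal_toReal hv).symm⟩
  have hup : 1 + (β.toNNReal : ℝ≥0∞) * (mean (P x) V + mean (P y) V) ≤
      ENNReal.ofReal (1 + β * (γ * v + 2 * C)) := by
    rw [ENNReal.ofReal_add zero_le_one (by positivity), ENNReal.ofReal_one,
      ENNReal.ofReal_mul hβ0.le, ENNReal.ofReal_add (by positivity) (by positivity),
      ENNReal.ofReal_mul hγ0, ← hve]
    gcongr
    · exact le_refl _
  have hgoal : (α.toNNReal : ℝ≥0∞) * (1 + β.toNNReal * (V x + V y)) =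
      ENNReal.ofReal (α * (1 + β * v)) := by
    rw [ENNReal.ofReal_mul hα0.le, ENNReal.ofReal_add zero_le_one (by positivity),
      ENNReal.ofReal_one, ENNReal.ofReal_mul hβ0.le, ← hve]
    rfl
  rw [hgoal]
  rcases le_total R v with hRv | hRv
  · refine (ha.trans hup).trans (ENNReal.ofReal_le_ofReal ?_)
    have h1 : (1 - ε) * (1 + β * v) ≤ α * (1 + β * v) :=
      mul_le_mul_of_nonneg_right ha3 (by positivity)
    have h2 : ε * (1 + β * v) ≤ ε * ((1 + β) * v) :=
      mul_le_mul_of_nonneg_left (by nlinarith) hε0.le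
    have h3 : (1 - γ) * R ≤ (1 - γ) * v := mul_le_mul_of_nonneg_left hRv h1γ.le
    have h4 : β * (4 * C) ≤ β * ((1 - γ) * v) := mul_le_mul_of_nonneg_left (by linarith) hβ0.le
    have h5 : ε * ((1 + β) * v) = β * (1 - γ) / 2 * v := by
      rw [← hεe]
      ring
    nlinarith
  · have hmx : ∀ w, V w ≤ V x + V y → ENNReal.ofReal η ≤ P w o := fun w hw =>
      hmin w (hw.trans (hve.le.trans (ENNReal.ofReal_le_ofReal hRv)))
    have hηη : ENNReal.ofReal (η ^ 2) ≤ P x o * P y o := by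
      rw [sq, ENNReal.ofReal_mul hη.le]
      exact mul_le_mul' (hmx x le_self_add) (hmx y le_add_self)
    have h1 : H + ENNReal.ofReal (η ^ 2) ≤ ENNReal.ofReal (1 + β * (γ * v + 2 * C)) :=
      (add_le_add le_rfl hηη).trans (hb.trans hup)
    have h2 : H ≤ ENNReal.ofReal (1 + β * (γ * v + 2 * C) - η ^ 2) := by
      rw [ENNReal.ofReal_sub _ (by positivity)]
      exact ENNReal.le_sub_of_add_le_right ENNReal.ofReal_ne_top h1
    refine h2.trans (ENNReal.ofReal_le_ofReal ?_)
    have h3 : γ * (β * v) ≤ α * (β * v) := mul_le_mul_of_nonneg_right ha2 (by positivity)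
    nlinarith

/-- Iterating the drift inequality. -/
lemma mean_iter_le (K : E → PMF E) (V : E → ℝ≥0∞) {γ C : ℝ} (hγ0 : 0 ≤ γ) (hγ : γ < 1)
    (hC : 0 ≤ C) (hdrift : ∀ x, mean (K x) V ≤ ENNReal.ofReal γ * V x + ENNReal.ofReal C)
    (n : ℕ) (x : E) :
    mean (iter K n x) V ≤ ENNReal.ofReal γ ^ n * V x + ENNReal.ofReal (C / (1 - γ)) := by
  have h1γ : 0 < 1 - γ := by linarith
  induction n with
  | zero => simp [mean_pure]
  | succ n ih =>
    rw [iter_succ, mean_bind]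
    calc mean (iter K n x) (fun y => mean (K y) V)
        ≤ mean (iter K n x) (fun y => ENNReal.ofReal γ * V y + ENNReal.ofReal C) :=
          mean_mono _ hdrift
      _ = ENNReal.ofReal γ * mean (iter K n x) V + ENNReal.ofReal C := by
          rw [mean_add, mean_mul_left, mean_const]
      _ ≤ ENNReal.ofReal γ * (ENNReal.ofReal γ ^ n * V x + ENNReal.ofReal (C / (1 - γ))) +
            ENNReal.ofReal C := by gcongr
      _ = ENNReal.ofReal γ ^ (n + 1) * V x +
            ENNReal.ofReal (γ * (C / (1 - γ)) + C) := by
          rw [ENNReal.ofReal_add (by positivity) hC, ENNReal.ofReal_mul hγ0]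
          ring
      _ = _ := by
          congr 2
          field_simp
          ring

/-- Uniform loss of memory of the initial state, for bounded functions, with a weight that grows
like the Lyapunov function. -/
lemma exists_forgetting (K : E → PMF E) (V : E → ℝ≥0∞) (o : E) {γ C : ℝ} (hγ0 : 0 ≤ γ)
    (hγ : γ < 1) (hC : 0 ≤ C)
    (hdrift : ∀ x, mean (K x) V ≤ ENNReal.ofReal γ * V x + ENNReal.ofReal C)
    (hmin : ∀ R : ℝ, ∃ m : ℕ, 0 < m ∧ ∃ η : ℝ, 0 < η ∧
      ∀ x, V x ≤ ENNReal.ofReal R → ENNReal.ofReal η ≤ iter K m x o) :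
    ∃ (β : ℝ≥0) (θ : ℕ → ℝ≥0∞), Tendsto θ atTop (𝓝 0) ∧
      ∀ (n : ℕ) (φ : E → ℝ≥0∞), (∀ x, φ x ≤ 1) → ∀ x y,
        mean (iter K n x) φ ≤ mean (iter K n y) φ + θ n * (1 + β * (V x + V y)) := by
  have h1γ : 0 < 1 - γ := by linarith
  set C' : ℝ := C / (1 - γ) with hC'
  have hC'0 : 0 ≤ C' := by positivity
  set R : ℝ := 1 + 4 * C' / (1 - γ) with hR
  obtain ⟨m, hm, η, hη, hmin⟩ := hmin R
  have hdrift' : ∀ x, mean (iter K m x) V ≤ ENNReal.ofReal γ * V x + ENNReal.ofReal C' := by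
    intro x
    refine (mean_iter_le K V hγ0 hγ hC hdrift m x).trans ?_
    gcongr
    exact pow_le_of_le_one zero_le (by simpa using hγ.le) hm.ne'
  obtain ⟨β, α, hα, hcon⟩ := exists_contraction (iter K m) V o (γ := γ) (C := C') (R := R)
    (η := η) hγ0 hγ hC'0 hη
    (by rw [hR]; linarith [show 0 ≤ 4 * C' / (1 - γ) by positivity])
    (by rw [hR, mul_add, mul_div_cancel₀ _ h1γ.ne']; linarith)
    hdrift' hmin
  have hpow : ∀ (j : ℕ) (φ : E → ℝ≥0∞), (∀ x, φ x ≤ 1) → ∀ x y,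
      mean (iter (iter K m) j x) φ ≤
        mean (iter (iter K m) j y) φ + (α : ℝ≥0∞) ^ j * (1 + β * (V x + V y)) := by
    intro j φ hφ
    induction j with
    | zero =>
      intro x y
      simp only [iter_zero, mean_pure, pow_zero, one_mul]
      exact (hφ x).trans (le_self_add.trans le_add_self)
    | succ j ih =>
      intro x y
      rw [iter_succ', iter_succ', mean_bind, mean_bind, pow_succ]
      exact hcon _ _ (fun x y _ => ih x y) x y
  refine ⟨β, fun n => (α : ℝ≥0∞) ^ (n / m), ?_, fun n φ hφ x y => ?_⟩
  · exact (ENNReal.tendsto_pow_atTop_nhds_zero_of_lt_one (by exact_mod_cast hα)).comp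
      (Nat.tendsto_div_const_atTop hm.ne')
  · have hn : n = m * (n / m) + n % m := (Nat.div_add_mod n m).symm
    have h1 : ∀ z, mean (iter K n z) φ =
        mean (iter (iter K m) (n / m) z) fun z' => mean (iter K (n % m) z') φ := by
      intro z
      conv_lhs => rw [hn]
      rw [iter_add, mean_bind, iter_iter]
    rw [h1, h1]
    refine hpow _ _ (fun z => ?_) x y
    rw [← mean_const (iter K (n % m) z) 1]
    exact mean_mono _ hφ

/-- Finite sums of pointwise limits bound the sum of the limit. -/
lemma tsum_le_of_tendsto {f : ℕ → E → ℝ≥0∞} {g : E → ℝ≥0∞} {b : ℕ → ℝ≥0∞} {c : ℝ≥0∞}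
    (h : ∀ x, Tendsto (fun n => f n x) atTop (𝓝 (g x))) (hb : ∀ n, ∑' x, f n x ≤ b n)
    (hc : Tendsto b atTop (𝓝 c)) : ∑' x, g x ≤ c := by
  rw [ENNReal.tsum_eq_iSup_sum]
  refine iSup_le fun s => ?_
  exact le_of_tendsto_of_tendsto' (tendsto_finsetSum s fun x _ => h x) hc
    fun n => (ENNReal.sum_le_tsum s).trans (hb n)

/-- Markov's inequality on the complement of the finite sublevel set `{V ≤ R}`. -/
lemma one_le_sum_add_mean_div (p : PMF E) (V : E → ℝ≥0∞) {R : ℝ≥0∞} (hR0 : R ≠ 0) (hR : R ≠ ∞)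
    (s : Finset E) (hs : ∀ x, V x ≤ R → x ∈ s) : 1 ≤ ∑ x ∈ s, p x + mean p V / R := by
  classical
  have h : ∀ x, p x ≤ (if x ∈ s then p x else 0) + p x * (V x / R) := by
    intro x
    split_ifs with hx
    · exact le_self_add
    · have : R ≤ V x := le_of_lt (not_le.1 fun h' => hx (hs x h'))
      rw [zero_add]
      exact le_mul_of_one_le_right zero_le ((ENNReal.le_div_iff_mul_le (Or.inl hR0)
        (Or.inl hR)).2 (by rwa [one_mul]))
  calc (1 : ℝ≥0∞) = ∑' x, p x := p.tsum_coe.symm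
    _ ≤ ∑' x, ((if x ∈ s then p x else 0) + p x * (V x / R)) := ENNReal.tsum_le_tsum h
    _ = _ := by
        rw [ENNReal.tsum_add, tsum_eq_sum (s := s) fun x hx => if_neg hx]
        congr 1
        · exact Finset.sum_congr rfl fun x hx => if_pos hx
        · rw [mean]
          simp only [div_eq_mul_inv, ← ENNReal.tsum_mul_right, mul_assoc]

/-- Pointwise comparison of two probability mass functions is equality. -/
lemma pmf_eq_of_le {p q : PMF E} (h : ∀ x, p x ≤ q x) : p = q := by
  ext x
  by_contra hne
  have hlt : p x < q x := lt_of_le_of_ne (h x) hne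
  have := ENNReal.tsum_lt_tsum (by rw [p.tsum_coe]; exact ENNReal.one_ne_top) h hlt
  rw [p.tsum_coe, q.tsum_coe] at this
  exact lt_irrefl _ this

/-- **Harris' theorem** on a countable state space: a Lyapunov function `V` (infinite outside a
closed class) with finite sublevel sets, from each of which the state `o` is charged uniformly
after a fixed number of steps, forces convergence to an invariant law. -/
theorem exists_invariant_and_tendsto (K : E → PMF E) (V : E → ℝ≥0∞) (o : E) {γ C : ℝ}
    (hγ0 : 0 ≤ γ) (hγ : γ < 1) (hC : 0 ≤ C) (ho : V o ≠ ∞)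
    (hdrift : ∀ x, mean (K x) V ≤ ENNReal.ofReal γ * V x + ENNReal.ofReal C)
    (hfin : ∀ R : ℝ, {x | V x ≤ ENNReal.ofReal R}.Finite)
    (hmin : ∀ R : ℝ, ∃ m : ℕ, 0 < m ∧ ∃ η : ℝ, 0 < η ∧
      ∀ x, V x ≤ ENNReal.ofReal R → ENNReal.ofReal η ≤ iter K m x o) :
    ∃ pi : PMF E, (∀ x ∈ pi.support, V x ≠ ∞) ∧ pi.bind K = pi ∧
      ∀ x, V x ≠ ∞ → ∀ y, Tendsto (fun n => iter K n x y) atTop (𝓝 (pi y)) := by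
  classical
  obtain ⟨β, θ, hθ, hfor⟩ := exists_forgetting K V o hγ0 hγ hC hdrift hmin
  have hfor' : ∀ n x y z, iter K n x z ≤ iter K n y z + θ n * (1 + β * (V x + V y)) := by
    intro n x y z
    have := hfor n (Pi.single z 1) (fun w => by
      by_cases hw : w = z
      · simp [hw]
      · simp [hw]) x y
    rwa [mean_single, mean_single] at this
  set B : ℝ≥0∞ := V o + ENNReal.ofReal (C / (1 - γ)) with hB
  have hBtop : B ≠ ∞ := ENNReal.add_ne_top.2 ⟨ho, ENNReal.ofReal_ne_top⟩
  have hmV : ∀ n, mean (iter K n o) V ≤ B := by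
    intro n
    refine (mean_iter_le K V hγ0 hγ hC hdrift n o).trans ?_
    rw [hB]
    gcongr
    exact mul_le_of_le_one_left zero_le (pow_le_one₀ zero_le (by simpa using hγ.le))
  set M : ℝ≥0∞ := 1 + β * (B + V o) with hM
  have hMtop : M ≠ ∞ := by
    rw [hM]
    exact ENNReal.add_ne_top.2 ⟨ENNReal.one_ne_top,
      ENNReal.mul_ne_top ENNReal.coe_ne_top (ENNReal.add_ne_top.2 ⟨hBtop, ho⟩)⟩
  have hθM : Tendsto (fun n => θ n * M) atTop (𝓝 0) := by
    simpa using ENNReal.Tendsto.mul_const hθ (Or.inr hMtop)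
  have hmd : ∀ n l, (mean (iter K l o) fun x => θ n * (1 + β * (V x + V o))) ≤ θ n * M := by
    intro n l
    rw [mean_mul_left, mean_add, mean_const, mean_mul_left, mean_add, mean_const, hM]
    gcongr
    exact hmV l
  have hup : ∀ n l y, iter K (l + n) o y ≤ iter K n o y + θ n * M := by
    intro n l y
    rw [iter_add, PMF.bind_apply]
    calc (mean (iter K l o) fun x => iter K n x y)
        ≤ mean (iter K l o) fun x => iter K n o y + θ n * (1 + β * (V x + V o)) :=
          mean_mono _ fun x => hfor' n x o y
      _ ≤ _ := by
          rw [mean_add, mean_const]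
          gcongr
          exact hmd n l
  have hlo : ∀ n l y, iter K n o y ≤ iter K (l + n) o y + θ n * M := by
    intro n l y
    rw [iter_add, PMF.bind_apply]
    calc iter K n o y = mean (iter K l o) fun _ => iter K n o y := (mean_const _ _).symm
      _ ≤ mean (iter K l o) fun x => iter K n x y + θ n * (1 + β * (V x + V o)) :=
          mean_mono _ fun x => (hfor' n o x y).trans (by rw [add_comm (V o)])
      _ ≤ _ := by
          rw [mean_add]
          gcongr
          · exact le_refl _
          · exact hmd n l
  have hlim : ∀ y, ∃ L : ℝ≥0∞, Tendsto (fun n => iter K n o y) atTop (𝓝 L) := by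
    intro y
    have hne : ∀ n, iter K n o y ≠ ∞ := fun n => PMF.apply_ne_top _ _
    have hcau : CauchySeq fun n => (iter K n o y).toReal := by
      rw [Metric.cauchySeq_iff']
      intro ε hε
      obtain ⟨n, hn⟩ := (hθM.eventually_lt_const (ENNReal.ofReal_pos.2 hε)).exists
      refine ⟨n, fun k hk => ?_⟩
      obtain ⟨l, rfl⟩ := Nat.exists_eq_add_of_le' hk
      have hfinθ : θ n * M ≠ ∞ := (lt_of_lt_of_le hn le_top).ne
      have hlt : (θ n * M).toReal < ε := by
        rw [← ENNReal.toReal_ofReal hε.le]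
        exact (ENNReal.toReal_lt_toReal hfinθ ENNReal.ofReal_ne_top).2 hn
      have h1 := ENNReal.toReal_mono (ENNReal.add_ne_top.2 ⟨hne n, hfinθ⟩) (hup n l y)
      have h2 := ENNReal.toReal_mono (ENNReal.add_ne_top.2 ⟨hne _, hfinθ⟩) (hlo n l y)
      rw [ENNReal.toReal_add (hne _) hfinθ] at h1 h2
      rw [Real.dist_eq, abs_lt]
      constructor <;> linarith
    obtain ⟨L, hL⟩ := cauchySeq_tendsto_of_complete hcau
    refine ⟨ENNReal.ofReal L, ?_⟩
    have := ENNReal.tendsto_ofReal hL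
    simpa only [ENNReal.ofReal_toReal (hne _)] using this
  choose L hL using hlim
  have hsum1 : ∑' y, L y = 1 := by
    refine le_antisymm (tsum_le_of_tendsto hL (fun n => (PMF.tsum_coe _).le)
      tendsto_const_nhds) ?_
    have hR : ∀ k : ℕ, 1 ≤ ∑' y, L y + B / ((k + 1 : ℕ) : ℝ≥0∞) := by
      intro k
      have hf := hfin (k + 1 : ℕ)
      refine le_of_tendsto_of_tendsto' (tendsto_const_nhds (x := (1 : ℝ≥0∞)))
        (((tendsto_finsetSum hf.toFinset fun x _ => hL x)).add_const
          (B / ((k + 1 : ℕ) : ℝ≥0∞))) (fun n => ?_) |>.trans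
        (add_le_add (ENNReal.sum_le_tsum _) le_rfl)
      refine (one_le_sum_add_mean_div (iter K n o) V (R := ((k + 1 : ℕ) : ℝ≥0∞))
        (by simp) (ENNReal.natCast_ne_top _) hf.toFinset ?_).trans ?_
      · intro x hx
        rw [Set.Finite.mem_toFinset, Set.mem_ofPred_eq, ENNReal.ofReal_natCast]
        exact hx
      · gcongr
        exact hmV n
    have ht : Tendsto (fun k : ℕ => ∑' y, L y + B / ((k + 1 : ℕ) : ℝ≥0∞)) atTop
        (𝓝 (∑' y, L y + 0)) := by
      refine tendsto_const_nhds.add ?_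
      have : Tendsto (fun k : ℕ => B / (k : ℝ≥0∞)) atTop (𝓝 0) := by
        simpa using ENNReal.Tendsto.const_div ENNReal.tendsto_nat_nhds_top (Or.inr hBtop)
      exact this.comp (tendsto_add_atTop_nat 1)
    rw [add_zero] at ht
    exact ge_of_tendsto' ht hR
  set pi : PMF E := ⟨L, hsum1 ▸ ENNReal.summable.hasSum⟩ with hpi
  have hpiL : ∀ y, pi y = L y := fun y => rfl
  refine ⟨pi, fun x hx hVx => ?_, ?_, fun x hx y => ?_⟩
  · -- states with `V = ∞` are never charged, since `mean V` stays bounded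
    refine (PMF.mem_support_iff _ _).1 hx ?_
    have h0 : ∀ n, iter K n o x = 0 := by
      intro n
      by_contra hne
      have h1 := (le_mean (iter K n o) V x).trans (hmV n)
      rw [hVx, ENNReal.mul_top hne] at h1
      exact hBtop (top_le_iff.1 h1)
    have := hL x
    simp only [h0] at this
    exact tendsto_nhds_unique this tendsto_const_nhds
  · refine pmf_eq_of_le fun y => ?_
    rw [PMF.bind_apply]
    refine tsum_le_of_tendsto (f := fun n x => iter K n o x * K x y)
      (b := fun n => iter K (n + 1) o y) (fun x => ?_) (fun n => ?_)
      ((tendsto_add_atTop_iff_nat 1).2 (hL y))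
    · exact ENNReal.Tendsto.mul_const (hL x) (Or.inr (PMF.apply_ne_top _ _))
    · rw [iter_succ, PMF.bind_apply]
  · have hd : 1 + β * (V x + V o) ≠ ∞ := ENNReal.add_ne_top.2 ⟨ENNReal.one_ne_top,
      ENNReal.mul_ne_top ENNReal.coe_ne_top (ENNReal.add_ne_top.2 ⟨hx, ho⟩)⟩
    have hθd : Tendsto (fun n => θ n * (1 + β * (V x + V o))) atTop (𝓝 0) := by
      simpa using ENNReal.Tendsto.mul_const hθ (Or.inr hd)
    have hu := (hL y).add hθd
    have hl := ENNReal.Tendsto.sub (hL y) hθd (Or.inr ENNReal.zero_ne_top)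
    rw [add_zero] at hu
    rw [tsub_zero] at hl
    refine tendsto_of_tendsto_of_tendsto_of_le_of_le hl hu (fun n => ?_) fun n => hfor' n x o y
    refine tsub_le_iff_right.2 ((hfor' n o x y).trans (le_of_eq ?_))
    rw [add_comm (V o)]

end Ergodic

/-! ### From the event chain to continuous time -/

lemma tendsto_poissonWeight {Λ : ℝ≥0} (hΛ : 0 < Λ) (k : ℕ) :
    Tendsto (fun t : ℝ≥0 => poissonWeight (Λ * t) k) atTop (𝓝 0) := by
  have h1 : Tendsto (fun r : ℝ => Real.exp (-r) * r ^ k / k.factorial) atTop (𝓝 0) := by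
    have := (Real.tendsto_pow_mul_exp_neg_atTop_nhds_zero k).div_const (k.factorial : ℝ)
    simpa only [mul_comm, zero_div] using this
  have h2 : Tendsto (fun t : ℝ≥0 => ((Λ * t : ℝ≥0) : ℝ)) atTop atTop := by
    simp only [NNReal.coe_mul]
    exact (NNReal.tendsto_coe_atTop.2 tendsto_id).const_mul_atTop (NNReal.coe_pos.2 hΛ)
  have h3 := ENNReal.tendsto_ofReal (h1.comp h2)
  rw [ENNReal.ofReal_zero] at h3
  simp only [poissonWeight_eq]
  exact h3

/-- A large Poisson number of steps of a convergent chain: the Poisson averages of a bounded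
convergent sequence have the same limit. -/
lemma tendsto_tsum_poissonWeight_mul {Λ : ℝ≥0} (hΛ : 0 < Λ) {F : ℕ → ℝ≥0∞} {L : ℝ≥0∞}
    (hF1 : ∀ k, F k ≤ 1) (hF : Tendsto F atTop (𝓝 L)) :
    Tendsto (fun t : ℝ≥0 => ∑' k, poissonWeight (Λ * t) k * F k) atTop (𝓝 L) := by
  have hL1 : L ≤ 1 := le_of_tendsto' hF hF1
  have hLtop : L ≠ ∞ := ne_top_of_le_ne_top ENNReal.one_ne_top hL1
  rw [ENNReal.tendsto_nhds hLtop]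
  intro ε hε
  have hε2 : 0 < ε / 2 := ENNReal.half_pos hε.ne'
  obtain ⟨k₀, hk₀⟩ := eventually_atTop.1 ((ENNReal.tendsto_nhds hLtop).1 hF (ε / 2) hε2)
  have hhead : Tendsto (fun t : ℝ≥0 => ∑ k ∈ Finset.range k₀, poissonWeight (Λ * t) k) atTop
      (𝓝 0) := by
    have := tendsto_finsetSum (Finset.range k₀) fun k _ => tendsto_poissonWeight hΛ k
    simpa using this
  filter_upwards [hhead.eventually_le_const hε2] with t ht
  set w := poissonWeight (Λ * t) with hw
  have hw1 : ∑' k, w k = 1 := tsum_poissonWeight _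
  have hhead' : (∑' k, if k < k₀ then w k else 0) ≤ ε / 2 := by
    refine le_trans (le_of_eq ?_) ht
    rw [tsum_eq_sum (s := Finset.range k₀) fun k hk => if_neg (by simpa using hk)]
    exact Finset.sum_congr rfl fun k hk => if_pos (by simpa using hk)
  constructor
  · rw [tsub_le_iff_right]
    calc L = ∑' k, w k * L := by rw [ENNReal.tsum_mul_right, hw1, one_mul]
      _ ≤ ∑' k, (w k * F k + (w k * (ε / 2) + if k < k₀ then w k else 0)) := by
          refine ENNReal.tsum_le_tsum fun k => ?_
          split_ifs with hk
          · calc w k * L ≤ w k * 1 := by gcongr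
              _ ≤ _ := by rw [mul_one]; exact le_add_self.trans le_add_self
          · rw [add_zero, ← mul_add]
            gcongr
            exact tsub_le_iff_right.1 (hk₀ k (not_lt.1 hk)).1
      _ = ∑' k, w k * F k + (ε / 2 + ∑' k, if k < k₀ then w k else 0) := by
          rw [ENNReal.tsum_add, ENNReal.tsum_add, ENNReal.tsum_mul_right, hw1, one_mul]
      _ ≤ ∑' k, w k * F k + (ε / 2 + ε / 2) := by gcongr
      _ = _ := by rw [ENNReal.add_halves]
  · calc ∑' k, w k * F k ≤ ∑' k, (w k * (L + ε / 2) + if k < k₀ then w k else 0) := by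
          refine ENNReal.tsum_le_tsum fun k => ?_
          split_ifs with hk
          · calc w k * F k ≤ w k * 1 := by gcongr; exact hF1 k
              _ ≤ _ := by rw [mul_one]; exact le_add_self
          · rw [add_zero]
            gcongr
            exact (hk₀ k (not_lt.1 hk)).2
      _ = (L + ε / 2) + ∑' k, if k < k₀ then w k else 0 := by
          rw [ENNReal.tsum_add, ENNReal.tsum_mul_right, hw1, one_mul]
      _ ≤ (L + ε / 2) + ε / 2 := by gcongr
      _ = L + ε := by rw [add_assoc, ENNReal.add_halves]

lemma bind_transitionLaw_of_bind_eq {E : Type*} {K : E → PMF E} {pi : PMF E}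
    (h : pi.bind K = pi) (Λ t : ℝ≥0) : pi.bind (transitionLaw Λ K t) = pi := by
  have hk : ∀ k, pi.bind (iter K k) = pi := by
    intro k
    induction k with
    | zero => exact PMF.bind_pure pi
    | succ k ih =>
      have : iter K (k + 1) = fun x => (iter K k x).bind K := funext fun x => iter_succ K k x
      rw [this, ← PMF.bind_bind, ih, h]
  change (pi.bind fun x => ((poissonMeasure (Λ * t)).toPMF).bind fun k => iter K k x) = pi
  rw [PMF.bind_comm]
  simp only [hk, PMF.bind_const]

/-! ### The Lyapunov function of the polling system -/

/-- The weight of a queue: exponential in the number of customers, with an extra factor `u` if no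
server is present. -/
noncomputable def queueWeight (z u : ℝ) (w : ℕ × Bool) : ℝ := z ^ w.1 * if w.2 = true then 1 else u

/-- The Lyapunov function: the sum of the weights of the queues; it is infinite at configurations
that are not states of the system with `S` servers. -/
noncomputable def lyapunov (z u : ℝ) {N : ℕ} (S : ℕ) (x : Config N) : ℝ≥0∞ :=
  open Classical in
  if Admissible S x then ENNReal.ofReal (∑ n, queueWeight z u (x n)) else ∞

lemma queueWeight_pos {z u : ℝ} (hz : 1 < z) (hu : 1 ≤ u) (w : ℕ × Bool) :
    0 < queueWeight z u w := by
  rw [queueWeight]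
  split_ifs <;> positivity

lemma queueWeight_le {z u : ℝ} (hz : 1 < z) (hu : 1 ≤ u) {w : ℕ × Bool} {k : ℕ} (h : w.1 ≤ k) :
    queueWeight z u w ≤ u * z ^ k := by
  rw [queueWeight, mul_comm]
  gcongr
  · split_ifs <;> linarith
  · exact hz.le

lemma pow_le_queueWeight {z u : ℝ} (hz : 1 < z) (hu : 1 ≤ u) (w : ℕ × Bool) :
    z ^ w.1 ≤ queueWeight z u w := by
  rw [queueWeight]
  refine le_mul_of_one_le_right (by positivity) ?_
  split_ifs <;> linarith

lemma mean_pollingStep_le_ofReal (hmu : 0 < mu) {N : ℕ} (hN : 0 < N) (S : ℕ)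
    (x : Config N) (g : Config N → ℝ≥0∞) {A B : Fin N → ℝ} (hA0 : ∀ n, 0 ≤ A n)
    (hB0 : ∀ n, 0 ≤ B n) (hA : ∀ n, g (arrive S x n) ≤ ENNReal.ofReal (A n))
    (hB : ∀ n, mean (serviceEnd x n) g ≤ ENNReal.ofReal (B n)) :
    mean (pollingStep lam mu S x) g ≤
      ENNReal.ofReal ((lam * ∑ n, A n + mu * ∑ n, B n) / (N * (lam + mu))) := by
  have hN' : (0 : ℝ) < N := by exact_mod_cast hN
  have hmu' : (0 : ℝ) < mu := hmu
  have hl : (0 : ℝ) ≤ lam := lam.coe_nonneg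
  have e : (lam * ∑ n, A n + mu * ∑ n, B n) / (N * ((lam : ℝ) + mu)) =
      (arrivalProb lam mu : ℝ) * ((∑ n, A n) / N) + (serviceProb lam mu : ℝ) * ((∑ n, B n) / N) := by
    rw [arrivalProb, serviceProb]
    push_cast
    field_simp
  have hsA : 0 ≤ ∑ n, A n := Finset.sum_nonneg fun n _ => hA0 n
  have hsB : 0 ≤ ∑ n, B n := Finset.sum_nonneg fun n _ => hB0 n
  rw [mean_pollingStep hmu hN, e, ENNReal.ofReal_add (by positivity) (by positivity),
    ENNReal.ofReal_mul (by positivity), ENNReal.ofReal_mul (by positivity),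
    ENNReal.ofReal_div_of_pos hN', ENNReal.ofReal_div_of_pos hN',
    ENNReal.ofReal_sum_of_nonneg fun n _ => hA0 n, ENNReal.ofReal_sum_of_nonneg fun n _ => hB0 n,
    ENNReal.ofReal_natCast, ENNReal.ofReal_coe_nnreal, ENNReal.ofReal_coe_nnreal]
  gcongr
  · exact hA _
  · exact hB _

/-- After a release there are at most `N - S + 1` queues among which the server can choose. -/
lemma card_waiting_release_le {N S : ℕ} (hSN : S ≤ N) {x : Config N} (hx : Admissible S x)
    {n : Fin N} (hn : (x n).2 = true) : (waiting (release x n)).card ≤ N - S + 1 := by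
  have hrel : ∀ m, (release x n m).2 = true → 0 < (release x n m).1 := by
    intro m hm
    by_cases hmn : m = n
    · subst hmn
      simp [release] at hm
    · rw [release, Function.update_of_ne hmn] at hm ⊢
      exact hx.1 m hm
  have h1 := busy_update x n ((x n).1 - 1, false)
  have h2 := nonemptyQueues_update x n ((x n).1 - 1, false)
  have h4 := card_waiting_add_busy hrel
  have h5 : nonemptyQueues x ≤ N := by
    simpa [nonemptyQueues] using Finset.card_filter_le (Finset.univ : Finset (Fin N))
      (fun n => 0 < (x n).1)
  have h3 := hx.2
  rw [← release] at h1 h2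
  simp only [hn, hx.1 n hn, if_true, Bool.false_eq_true, if_false] at h1 h2
  split_ifs at h2 <;> omega

/-- A waiting queue is picked with probability at least `1 / k` if there are at most `k` waiting
queues, and being picked lowers its weight. -/
lemma mean_assign_le {z u : ℝ} (hz : 1 < z) (hu : 1 ≤ u) {N : ℕ} (y : Config N) {m : Fin N}
    (hm : m ∈ waiting y) {k : ℕ} (hk : (waiting y).card ≤ k) :
    (∑ l ∈ waiting y, ENNReal.ofReal (queueWeight z u (assign y l m))) /
        ((waiting y).card : ℝ≥0∞) ≤
      ENNReal.ofReal (z ^ (y m).1 * (1 / k + (1 - 1 / k) * u)) := by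
  have hc : 0 < (waiting y).card := Finset.card_pos.2 ⟨m, hm⟩
  have hc' : (0 : ℝ) < (waiting y).card := by exact_mod_cast hc
  have hck : ((waiting y).card : ℝ) ≤ k := by exact_mod_cast hk
  have hm2 : (y m).2 = false := by
    simp only [waiting, Finset.mem_filter] at hm
    exact hm.2.2
  rw [← ENNReal.ofReal_sum_of_nonneg fun l _ => (queueWeight_pos hz hu _).le,
    ← ENNReal.ofReal_natCast, ← ENNReal.ofReal_div_of_pos hc']
  refine ENNReal.ofReal_le_ofReal ?_
  have h1 : ∑ l ∈ waiting y, queueWeight z u (assign y l m) =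
      z ^ (y m).1 + ((waiting y).card - 1) * (z ^ (y m).1 * u) := by
    rw [← Finset.add_sum_erase _ _ hm]
    congr 1
    · simp [assign, queueWeight]
    · rw [Finset.sum_congr rfl (g := fun _ => z ^ (y m).1 * u), Finset.sum_const,
        Finset.card_erase_of_mem hm, nsmul_eq_mul, Nat.cast_pred hc]
      intro l hl
      rw [assign, Function.update_of_ne (Finset.ne_of_mem_erase hl).symm, queueWeight, hm2]
      simp
  have h2 : (z ^ (y m).1 + ((waiting y).card - 1) * (z ^ (y m).1 * u)) / (waiting y).card =
      z ^ (y m).1 * (u - 1 / (waiting y).card * (u - 1)) := by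
    field_simp
    ring
  have h3 : z ^ (y m).1 * (1 / k + (1 - 1 / k) * u) = z ^ (y m).1 * (u - 1 / k * (u - 1)) := by
    ring
  rw [h1, h2, h3]
  gcongr

/-- A queue that is neither waiting nor completing a service is not affected by the service clock
of queue `n`. -/
lemma serviceEnd_apply_of_not_waiting {N : ℕ} {x y : Config N} {n m : Fin N} (hmn : m ≠ n)
    (hm : ¬ (0 < (x m).1 ∧ (x m).2 = false)) (hy : y ∈ (serviceEnd x n).support) : y m = x m := by
  rcases mem_support_serviceEnd hy with rfl | ⟨-, ⟨l, hl, rfl⟩ | ⟨-, rfl⟩⟩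
  · rfl
  · have hlm : m ≠ l := by
      rintro rfl
      have hl' : 0 < (release x n m).1 ∧ (release x n m).2 = false := by
        simpa [waiting] using hl
      rw [release, Function.update_of_ne hmn] at hl'
      exact hm hl'
    rw [assign, Function.update_of_ne hlm, release, Function.update_of_ne hmn]
  · rw [release, Function.update_of_ne hmn]

/-- One event adds at most one customer to a given queue. -/
lemma fst_le_of_mem_support_pollingStep {N S : ℕ} {x y : Config N}
    (hy : y ∈ (pollingStep lam mu S x).support) (m : Fin N) : (y m).1 ≤ (x m).1 + 1 := by
  have hrel : ∀ n, (release x n m).1 ≤ (x m).1 := by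
    intro n
    by_cases h : m = n
    · subst h
      simp [release]
    · rw [release, Function.update_of_ne h]
  rcases mem_support_pollingStep hy with rfl | ⟨n, rfl⟩ | ⟨n, hy⟩
  · exact Nat.le_succ _
  · by_cases h : m = n
    · subst h
      simp [arrive]
    · rw [arrive, Function.update_of_ne h]
      exact Nat.le_succ _
  · rcases mem_support_serviceEnd hy with rfl | ⟨-, ⟨l, -, rfl⟩ | ⟨-, rfl⟩⟩
    · exact Nat.le_succ _
    · refine le_trans ?_ ((hrel n).trans (Nat.le_succ _))
      by_cases h : m = l
      · subst h
        simp [assign]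
      · rw [assign, Function.update_of_ne h]
    · exact (hrel n).trans (Nat.le_succ _)

lemma queueWeight_arrive_le {z u : ℝ} (hz : 1 < z) (hu : 1 ≤ u) {N S : ℕ} (x : Config N)
    (n m : Fin N) : queueWeight z u (arrive S x n m) ≤
      if n = m then z * queueWeight z u (x m) else queueWeight z u (x m) := by
  split_ifs with h
  · subst h
    have : queueWeight z u (arrive S x n n) ≤
        z ^ ((x n).1 + 1) * if (x n).2 = true then 1 else u := by
      simp only [arrive, Function.update_self, queueWeight]
      gcongr
      cases (x n).2 <;> by_cases hb : busy x < S <;> simp [hb, hu]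
    refine this.trans (le_of_eq ?_)
    rw [queueWeight, pow_succ]
    ring
  · rw [arrive, Function.update_of_ne (Ne.symm h)]

lemma sum_queueWeight_arrive {N : ℕ} (m : Fin N) (z v : ℝ) :
    ∑ n : Fin N, (if n = m then z * v else v) = v * (N + (z - 1)) := by
  have : ∀ n : Fin N, (if n = m then z * v else v) = v + if n = m then (z - 1) * v else 0 := by
    intro n
    split_ifs <;> ring
  simp only [this, Finset.sum_add_distrib, Finset.sum_const, Finset.card_univ, Fintype.card_fin,
    nsmul_eq_mul, Finset.sum_ite_eq', Finset.mem_univ, if_true]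
  ring

/-- The drift of the weight of a waiting queue: all `S` servers are busy, and each service end
gives the queue a chance of at least `1 / (N - S + 1)` of being picked. -/
lemma mean_queueWeight_waiting_le (hmu : 0 < mu) {N S : ℕ} (hN : 0 < N) (hSN : S ≤ N) {z u : ℝ}
    (hz : 1 < z) (hu : 1 ≤ u) {x : Config N} (hx : Admissible S x) {m : Fin N}
    (hq : 0 < (x m).1) (hm : (x m).2 = false) :
    mean (pollingStep lam mu S x) (fun y => ENNReal.ofReal (queueWeight z u (y m))) ≤
      ENNReal.ofReal ((1 + (lam * (z - 1) - mu * S / (N - S + 1 : ℕ) * ((u - 1) / u)) /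
        (N * (lam + mu))) * queueWeight z u (x m)) := by
  have hN' : (0 : ℝ) < N := by exact_mod_cast hN
  have hmu' : (0 : ℝ) < mu := hmu
  have hl : (0 : ℝ) ≤ lam := lam.coe_nonneg
  have hu0 : 0 < u := by linarith
  set k : ℕ := N - S + 1 with hk
  have hk0 : (0 : ℝ) < k := by
    rw [hk]
    positivity
  set v := queueWeight z u (x m) with hv
  have hv0 : 0 < v := queueWeight_pos hz hu _
  have hvz : v = z ^ (x m).1 * u := by
    rw [hv, queueWeight, hm]
    simp
  set s : ℝ := z ^ (x m).1 * (1 / k + (1 - 1 / k) * u) with hs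
  have hk1 : (1 : ℝ) / k ≤ 1 := by
    rw [div_le_one hk0, hk]
    push_cast
    linarith [(Nat.cast_nonneg (N - S) : (0 : ℝ) ≤ _)]
  have hs0 : 0 ≤ s := by
    have : 0 ≤ 1 - 1 / (k : ℝ) := by linarith
    positivity
  refine (mean_pollingStep_le_ofReal hmu hN S x _
    (A := fun n => if n = m then z * v else v) (B := fun n => if (x n).2 = true then s else v)
    ?_ ?_ ?_ ?_).trans (ENNReal.ofReal_le_ofReal (le_of_eq ?_))
  · intro n
    split_ifs <;> positivity
  · intro n
    split_ifs <;> positivity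
  · exact fun n => ENNReal.ofReal_le_ofReal (queueWeight_arrive_le hz hu x n m)
  · intro n
    split_ifs with hn
    · have hmn : m ≠ n := by
        rintro rfl
        rw [hm] at hn
        cases hn
      have hrm : release x n m = x m := by rw [release, Function.update_of_ne hmn]
      have hmw : m ∈ waiting (release x n) := by
        simp [waiting, hrm, hq, hm]
      rw [mean_serviceEnd, if_pos hn, if_pos ⟨m, hmw⟩]
      have := mean_assign_le hz hu _ hmw (card_waiting_release_le hSN hx hn)
      rwa [hrm] at this
    · rw [mean_serviceEnd, if_neg hn]
  · have hb : ∑ n : Fin N, (if (x n).2 = true then s else v) = S * s + (N - S) * v := by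
      rw [← hx.busy_eq_of_waiting hq hm]
      have : ∀ n : Fin N, (if (x n).2 = true then s else v) =
          v + if (x n).2 = true then s - v else 0 := by
        intro n
        split_ifs <;> ring
      simp only [this, Finset.sum_add_distrib, Finset.sum_const, Finset.card_univ,
        Fintype.card_fin, nsmul_eq_mul, ← Finset.sum_filter, busy]
      ring
    rw [hb, sum_queueWeight_arrive, hs]
    have : z ^ (x m).1 * (1 / k + (1 - 1 / k) * u) = v * (1 - (1 / k) * ((u - 1) / u)) := by
      rw [hvz]
      field_simp
      ring
    rw [this]
    field_simp
    ring

/-- The drift of the weight of a served queue with at least two customers: after a service end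
the queue is picked again with probability at least `1 / (N - S + 1)`. -/
lemma mean_queueWeight_served_le (hmu : 0 < mu) {N S : ℕ} (hN : 0 < N) (hSN : S ≤ N) {z u : ℝ}
    (hz : 1 < z) (hu : 1 ≤ u) {x : Config N} (hx : Admissible S x) {m : Fin N}
    (hq : 1 < (x m).1) (hm : (x m).2 = true) :
    mean (pollingStep lam mu S x) (fun y => ENNReal.ofReal (queueWeight z u (y m))) ≤
      ENNReal.ofReal ((1 + (lam * (z - 1) -
          mu * (1 - (1 / (N - S + 1 : ℕ) + (1 - 1 / (N - S + 1 : ℕ)) * u) / z)) /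
        (N * (lam + mu))) * queueWeight z u (x m)) := by
  have hN' : (0 : ℝ) < N := by exact_mod_cast hN
  have hmu' : (0 : ℝ) < mu := hmu
  have hl : (0 : ℝ) ≤ lam := lam.coe_nonneg
  have hz0 : 0 < z := by linarith
  set k : ℕ := N - S + 1 with hk
  have hk0 : (0 : ℝ) < k := by
    rw [hk]
    positivity
  set v := queueWeight z u (x m) with hv
  have hv0 : 0 < v := queueWeight_pos hz hu _
  have hvz : v = z ^ ((x m).1 - 1) * z := by
    rw [← pow_succ, Nat.sub_add_cancel hq.le, hv, queueWeight, hm]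
    simp
  set s : ℝ := z ^ ((x m).1 - 1) * (1 / k + (1 - 1 / k) * u) with hs
  have hk1 : (1 : ℝ) / k ≤ 1 := by
    rw [div_le_one hk0, hk]
    push_cast
    linarith [(Nat.cast_nonneg (N - S) : (0 : ℝ) ≤ _)]
  have hs0 : 0 ≤ s := by
    have : 0 ≤ 1 - 1 / (k : ℝ) := by linarith
    positivity
  refine (mean_pollingStep_le_ofReal hmu hN S x _
    (A := fun n => if n = m then z * v else v) (B := fun n => if n = m then s else v)
    ?_ ?_ ?_ ?_).trans (ENNReal.ofReal_le_ofReal (le_of_eq ?_))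
  · intro n
    split_ifs <;> positivity
  · intro n
    split_ifs <;> positivity
  · exact fun n => ENNReal.ofReal_le_ofReal (queueWeight_arrive_le hz hu x n m)
  · intro n
    split_ifs with hn
    · subst hn
      have hrm : release x n n = ((x n).1 - 1, false) := by rw [release, Function.update_self]
      have hmw : n ∈ waiting (release x n) := by
        simp [waiting, hrm, hq]
      rw [mean_serviceEnd, if_pos hm, if_pos ⟨n, hmw⟩]
      have := mean_assign_le hz hu _ hmw (card_waiting_release_le hSN hx hm)
      rwa [hrm] at this
    · refine (mean_mono_support (g := fun _ => ENNReal.ofReal v) _ fun y hy => ?_).trans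
        (mean_const _ _).le
      rw [serviceEnd_apply_of_not_waiting (Ne.symm hn) (by simp [hm]) hy]
  · have hs' : s = (s / v) * v := by field_simp
    have hb : ∑ n : Fin N, (if n = m then s else v) = v * (N + (s / v - 1)) := by
      rw [← sum_queueWeight_arrive m, ← hs']
    have : s / v = (1 / k + (1 - 1 / k) * u) / z := by
      rw [hs, hvz]
      field_simp
    rw [hb, sum_queueWeight_arrive, this]
    field_simp
    ring

/-- If `lam * N < mu * S`, there are parameters for which both drifts are negative. The slopes at
`z = u = 1` are negative if `u - 1 = c * (z - 1)` with `c` between `lam * k / (mu * S)` and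
`(mu - lam) * k / (mu * (k - 1))`, where `k = N - S + 1`. -/
lemma exists_parameters (hlam : 0 < lam) (hmu : 0 < mu) {N S : ℕ} (hS : 0 < S) (hSN : S ≤ N)
    (h : (lam : ℝ) * N < mu * S) :
    ∃ z u : ℝ, 1 < z ∧ 1 ≤ u ∧
      (lam : ℝ) * (z - 1) - mu * S / (N - S + 1 : ℕ) * ((u - 1) / u) < 0 ∧
      (lam : ℝ) * (z - 1) -
        mu * (1 - (1 / (N - S + 1 : ℕ) + (1 - 1 / (N - S + 1 : ℕ)) * u) / z) < 0 := by
  have hS' : (0 : ℝ) < S := by exact_mod_cast hS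
  have hN' : (0 : ℝ) < N := lt_of_lt_of_le hS' (by exact_mod_cast hSN)
  have hlam' : (0 : ℝ) < lam := hlam
  have hmu' : (0 : ℝ) < mu := hmu
  have hk : ((N - S + 1 : ℕ) : ℝ) = N - S + 1 := by
    push_cast [Nat.cast_sub hSN]
    ring
  have hk0 : (0 : ℝ) < N - S + 1 := by
    rw [← hk]
    positivity
  obtain ⟨l, hl1, hl2⟩ := exists_between (a₁ := (lam : ℝ)) (a₂ := mu * S / N)
    (by rw [lt_div_iff₀ hN']; exact h)
  rw [lt_div_iff₀ hN'] at hl2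
  have hl0 : 0 < l := hlam'.trans hl1
  set k : ℝ := (N : ℝ) - S + 1 with hkdef
  set c : ℝ := l * k / (mu * S) with hc
  have hc0 : 0 < c := by positivity
  have hce : mu * S * c = l * k := by
    rw [hc]
    field_simp
  set ε : ℝ := (l - lam) / (2 * lam * (1 + c)) with hε
  have hll : 0 < l - lam := by linarith
  have hε0 : 0 < ε := by positivity
  have hεe : lam * ε * (1 + c) = (l - lam) / 2 := by
    rw [hε]
    field_simp
  have hp1 : 0 < lam * ε := by positivity
  have hp2 : 0 < lam * ε * c := by positivity
  refine ⟨1 + ε, 1 + c * ε, by linarith, by nlinarith, ?_, ?_⟩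
  · rw [hk]
    have hu0 : 0 < 1 + c * ε := by positivity
    have e : (mu : ℝ) * S / k * ((1 + c * ε - 1) / (1 + c * ε)) = l * ε / (1 + c * ε) := by
      rw [div_mul_div_comm, show (mu : ℝ) * S * (1 + c * ε - 1) = (mu * S * c) * ε by ring, hce]
      field_simp
    rw [e, sub_neg, lt_div_iff₀ hu0]
    have : (lam : ℝ) * (1 + c * ε) < l := by nlinarith
    nlinarith
  · rw [hk]
    have hz0 : 0 < 1 + ε := by positivity
    have e : (1 : ℝ) - (1 / k + (1 - 1 / k) * (1 + c * ε)) / (1 + ε) =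
        ε * (1 - (k - 1) / k * c) / (1 + ε) := by
      field_simp
      ring
    rw [e, sub_neg, ← mul_div_assoc, lt_div_iff₀ hz0]
    have h1 : mu * ((k - 1) / k * c) = l * (k - 1) / S := by
      rw [hc]
      field_simp
    have h2 : l * (k - 1) / S + l < mu := by
      rw [← sub_pos]
      have : mu - (l * (k - 1) / S + l) = (mu * S - l * N) / S := by
        rw [hkdef]
        field_simp
        ring
      rw [this]
      exact div_pos (by linarith) hS'
    have h3 : (lam : ℝ) * (1 + ε) < l := by nlinarith
    have h4 : l < mu * (1 - (k - 1) / k * c) := by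
      rw [mul_sub, mul_one, h1]
      linarith
    nlinarith

/-- The geometric drift condition for the embedded event chain. -/
lemma exists_drift (hlam : 0 < lam) (hmu : 0 < mu) {N S : ℕ} (hS : 0 < S) (hSN : S ≤ N)
    (h : (lam : ℝ) * N < mu * S) :
    ∃ z u γ C : ℝ, 1 < z ∧ 1 ≤ u ∧ 0 ≤ γ ∧ γ < 1 ∧ 0 ≤ C ∧ ∀ x : Config N,
      mean (pollingStep lam mu S x) (lyapunov z u S) ≤
        ENNReal.ofReal γ * lyapunov z u S x + ENNReal.ofReal C := by
  have hN : 0 < N := lt_of_lt_of_le hS hSN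
  have hN' : (0 : ℝ) < N := by exact_mod_cast hN
  have hmu' : (0 : ℝ) < mu := hmu
  have hlam' : (0 : ℝ) < lam := hlam
  have hΛ : (0 : ℝ) < N * (lam + mu) := by positivity
  obtain ⟨z, u, hz, hu, h1, h2⟩ := exists_parameters hlam hmu hS hSN h
  set γ₁ : ℝ := 1 + (lam * (z - 1) - mu * S / (N - S + 1 : ℕ) * ((u - 1) / u)) /
    (N * (lam + mu)) with hγ₁
  set γ₂ : ℝ := 1 + (lam * (z - 1) -
    mu * (1 - (1 / (N - S + 1 : ℕ) + (1 - 1 / (N - S + 1 : ℕ)) * u) / z)) /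
    (N * (lam + mu)) with hγ₂
  have hγ₁1 : γ₁ < 1 := by
    have := div_neg_of_neg_of_pos h1 hΛ
    linarith
  have hγ₂1 : γ₂ < 1 := by
    have := div_neg_of_neg_of_pos h2 hΛ
    linarith
  set γ : ℝ := max (max γ₁ γ₂) (1 / 2) with hγ
  have hγ1 : γ < 1 := max_lt (max_lt hγ₁1 hγ₂1) (by norm_num)
  have hγ0 : 0 < γ := lt_of_lt_of_le (by norm_num) (le_max_right _ _)
  refine ⟨z, u, γ, N * (u * z ^ 2), hz, hu, hγ0.le, hγ1, by positivity, fun x => ?_⟩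
  by_cases hx : Admissible S x
  swap
  · have hVx : lyapunov z u S x = ∞ := if_neg hx
    rw [hVx, ENNReal.mul_top (by simpa using hγ0), top_add]
    exact le_top
  have hqueue : ∀ m, mean (pollingStep lam mu S x)
      (fun y => ENNReal.ofReal (queueWeight z u (y m))) ≤
        ENNReal.ofReal (γ * queueWeight z u (x m) + u * z ^ 2) := by
    intro m
    have hv0 := queueWeight_pos hz hu (x m)
    have huz : 0 ≤ u * z ^ 2 := by positivity
    rcases Nat.lt_or_ge 1 (x m).1 with hq | hq
    · cases hm : (x m).2
      · refine (mean_queueWeight_waiting_le hmu hN hSN hz hu hx (by omega) hm).trans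
          (ENNReal.ofReal_le_ofReal ?_)
        have : γ₁ * queueWeight z u (x m) ≤ γ * queueWeight z u (x m) :=
          mul_le_mul_of_nonneg_right ((le_max_left _ _).trans (le_max_left _ _)) hv0.le
        linarith
      · refine (mean_queueWeight_served_le hmu hN hSN hz hu hx hq hm).trans
          (ENNReal.ofReal_le_ofReal ?_)
        have : γ₂ * queueWeight z u (x m) ≤ γ * queueWeight z u (x m) :=
          mul_le_mul_of_nonneg_right ((le_max_right _ _).trans (le_max_left _ _)) hv0.le
        linarith
    · refine (mean_mono_support (g := fun _ => ENNReal.ofReal (u * z ^ 2)) _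
        fun y hy => ENNReal.ofReal_le_ofReal (queueWeight_le hz hu ?_)).trans
        ((mean_const _ _).le.trans (ENNReal.ofReal_le_ofReal ?_))
      · have := fst_le_of_mem_support_pollingStep hy m
        omega
      · have := mul_pos hγ0 hv0
        linarith
  calc mean (pollingStep lam mu S x) (lyapunov z u S)
      ≤ mean (pollingStep lam mu S x)
          (fun y => ∑ m, ENNReal.ofReal (queueWeight z u (y m))) := by
        refine mean_mono_support _ fun y hy => ?_
        rw [lyapunov, if_pos (hx.pollingStep y hy),
          ENNReal.ofReal_sum_of_nonneg fun n _ => (queueWeight_pos hz hu _).le]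
    _ = ∑ m, mean (pollingStep lam mu S x)
          (fun y => ENNReal.ofReal (queueWeight z u (y m))) := mean_sum _ _ _
    _ ≤ ∑ m, ENNReal.ofReal (γ * queueWeight z u (x m) + u * z ^ 2) :=
        Finset.sum_le_sum fun m _ => hqueue m
    _ = ENNReal.ofReal (γ * (∑ m, queueWeight z u (x m)) + N * (u * z ^ 2)) := by
        rw [← ENNReal.ofReal_sum_of_nonneg, Finset.sum_add_distrib, ← Finset.mul_sum,
          Finset.sum_const, Finset.card_univ, Fintype.card_fin, nsmul_eq_mul]
        intro m _
        have := queueWeight_pos hz hu (x m)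
        positivity
    _ = _ := by
        have hVx : lyapunov z u S x = ENNReal.ofReal (∑ n, queueWeight z u (x n)) := if_pos hx
        rw [hVx, ENNReal.ofReal_add, ENNReal.ofReal_mul hγ0.le]
        · exact mul_nonneg hγ0.le (Finset.sum_nonneg fun m _ => (queueWeight_pos hz hu _).le)
        · positivity

/-! ### Underloaded systems are stable -/

lemma mem_support_pollingStep_of_serviceEnd (hmu : 0 < mu) {N S : ℕ} {x y : Config N} {n : Fin N}
    (hy : y ∈ (serviceEnd x n).support) : y ∈ (pollingStep lam mu S x).support := by
  rw [pollingStep, PMF.mem_support_bind_iff]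
  refine ⟨false, ?_, ?_⟩
  · rw [PMF.mem_support_iff, isArrival_false hmu]
    have : 0 < serviceProb lam mu := by
      rw [serviceProb]
      positivity
    exact_mod_cast this.ne'
  · rw [if_neg (by simp), PMF.mem_support_bind_iff]
    exact ⟨serviceEnd x n, (mem_support_uniformPick _ _ _ _).2
      (Or.inl ⟨n, Finset.mem_univ n, rfl⟩), hy⟩

/-- The state in which all queues are empty. -/
def emptyConfig (N : ℕ) : Config N := fun _ => (0, false)

lemma admissible_emptyConfig (N S : ℕ) : Admissible S (emptyConfig N) := by
  constructor
  · intro n hn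
    simp [emptyConfig] at hn
  · simp [busy, nonemptyQueues, emptyConfig]

/-- The system can be emptied by `total x` successive service ends, and it may stay empty
afterwards. -/
lemma iter_pollingStep_emptyConfig_pos (hmu : 0 < mu) {N S : ℕ} (hN : 0 < N) (hS : 0 < S) (k : ℕ)
    (x : Config N) (hx : Admissible S x) (hk : total x ≤ k) :
    emptyConfig N ∈ (iter (pollingStep lam mu S) k x).support := by
  have hzero : ∀ x : Config N, Admissible S x → total x = 0 → x = emptyConfig N := by
    intro x hx h0
    rw [total, Finset.sum_eq_zero_iff] at h0
    funext n
    have h1 : (x n).1 = 0 := h0 n (Finset.mem_univ n)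
    refine Prod.ext h1 ?_
    cases hb : (x n).2
    · rfl
    · exact absurd (hx.1 n hb) (by omega)
  induction k generalizing x with
  | zero =>
    rw [iter_zero, PMF.mem_support_pure_iff]
    exact (hzero x hx (by omega)).symm
  | succ k ih =>
    rw [iter_succ', PMF.mem_support_bind_iff]
    rcases Nat.eq_zero_or_pos (total x) with h0 | h0
    · refine ⟨x, mem_support_pollingStep_of_serviceEnd hmu (n := ⟨0, hN⟩) ?_, ih x hx (by omega)⟩
      rw [hzero x hx h0, serviceEnd, if_neg (by simp [emptyConfig]), PMF.mem_support_pure_iff]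
    · have hne : 0 < nonemptyQueues x := by
        rw [nonemptyQueues, Finset.card_pos]
        by_contra hcon
        rw [Finset.not_nonempty_iff_eq_empty, Finset.filter_eq_empty_iff] at hcon
        refine h0.ne' (Finset.sum_eq_zero fun n hn => ?_)
        have := hcon hn
        omega
      have hb : 0 < busy x := by
        rw [hx.2]
        exact lt_min hne hS
      obtain ⟨n, hn⟩ := Finset.card_pos.1 hb
      have hn' : (x n).2 = true := (Finset.mem_filter.1 hn).2
      obtain ⟨y, hy⟩ := (serviceEnd x n).support_nonempty
      have hty := total_serviceEnd (hx.1 n hn') hn' hy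
      exact ⟨y, mem_support_pollingStep_of_serviceEnd hmu hy,
        ih y (hx.serviceEnd n hy) (by omega)⟩

lemma finite_lyapunov_le {z u : ℝ} (hz : 1 < z) (hu : 1 ≤ u) (N S : ℕ) (R : ℝ) :
    {x : Config N | lyapunov z u S x ≤ ENNReal.ofReal R}.Finite := by
  obtain ⟨k, hk⟩ := pow_unbounded_of_one_lt (max R 0) hz
  have hfin : {w : ℕ × Bool | w.1 ≤ k}.Finite :=
    ((Set.finite_Iic k).prod Set.finite_univ).subset fun w hw => ⟨hw, Set.mem_univ _⟩
  refine (Set.Finite.pi' fun _ : Fin N => hfin).subset fun x hx n => ?_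
  have hx' : lyapunov z u S x ≤ ENNReal.ofReal R := hx
  rw [lyapunov] at hx'
  split_ifs at hx' with hadm
  · by_contra hcon
    have hcon' : k ≤ (x n).1 := le_of_not_ge hcon
    have h1 : ∑ m, queueWeight z u (x m) ≤ max R 0 :=
      (ENNReal.ofReal_le_ofReal_iff (le_max_right _ _)).1
        (hx'.trans (ENNReal.ofReal_le_ofReal (le_max_left _ _)))
    have h2 : queueWeight z u (x n) ≤ ∑ m, queueWeight z u (x m) :=
      Finset.single_le_sum (f := fun m => queueWeight z u (x m))
        (fun m _ => (queueWeight_pos hz hu _).le) (Finset.mem_univ n)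
    have h3 := pow_le_queueWeight hz hu (x n)
    have h4 : z ^ k ≤ z ^ (x n).1 := pow_le_pow_right₀ hz.le hcon'
    linarith
  · exact absurd hx' (by simp)

/-- When the servers can work faster than customers arrive, the system is stable. -/
theorem isStable_of_lt (hlam : 0 < lam) (hmu : 0 < mu) {N S : ℕ} (hS : 0 < S) (hSN : S ≤ N)
    (h : (lam : ℝ) * N < mu * S) : IsStable lam mu N S := by
  have hN : 0 < N := lt_of_lt_of_le hS hSN
  obtain ⟨z, u, γ, C, hz, hu, hγ0, hγ1, hC, hdrift⟩ := exists_drift hlam hmu hS hSN h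
  have hV : ∀ x : Config N, lyapunov z u S x ≠ ∞ ↔ Admissible S x := by
    intro x
    rw [lyapunov]
    split_ifs with hx <;> simp [hx]
  have hmin : ∀ R : ℝ, ∃ m : ℕ, 0 < m ∧ ∃ η : ℝ, 0 < η ∧
      ∀ x : Config N, lyapunov z u S x ≤ ENNReal.ofReal R →
        ENNReal.ofReal η ≤ iter (pollingStep lam mu S) m x (emptyConfig N) := by
    intro R
    set s := (finite_lyapunov_le hz hu N S R).toFinset with hs
    have hmem : ∀ x, x ∈ s ↔ lyapunov z u S x ≤ ENNReal.ofReal R := by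
      intro x
      rw [hs, Set.Finite.mem_toFinset]
      rfl
    set m := s.sup total + 1 with hm
    set e : ℝ≥0∞ := s.inf fun x => iter (pollingStep lam mu S) m x (emptyConfig N) with he
    have he0 : 0 < min e 1 := by
      refine lt_min ((Finset.lt_inf_iff ENNReal.zero_lt_top).2 fun x hx => ?_) one_pos
      have hadm : Admissible S x := (hV x).1
        (ne_top_of_le_ne_top ENNReal.ofReal_ne_top ((hmem x).1 hx))
      refine pos_iff_ne_zero.2 ((PMF.mem_support_iff _ _).1
        (iter_pollingStep_emptyConfig_pos hmu hN hS m x hadm ?_))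
      have := Finset.le_sup (f := total) hx
      omega
    have het : min e 1 ≠ ∞ := ne_top_of_le_ne_top ENNReal.one_ne_top (min_le_right _ _)
    refine ⟨m, Nat.succ_pos _, (min e 1).toReal, ENNReal.toReal_pos he0.ne' het, fun x hx => ?_⟩
    rw [ENNReal.ofReal_toReal het]
    exact (min_le_left _ _).trans (Finset.inf_le ((hmem x).2 hx))
  obtain ⟨pi, hpi1, hpi2, hpi3⟩ := exists_invariant_and_tendsto (pollingStep lam mu S)
    (lyapunov z u S) (emptyConfig N) hγ0 hγ1 hC ((hV _).2 (admissible_emptyConfig N S)) hdrift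
    (finite_lyapunov_le hz hu N S) hmin
  refine ⟨pi, ⟨fun x hx => (hV x).1 (hpi1 x hx),
    fun t => bind_transitionLaw_of_bind_eq hpi2 _ t⟩, fun x hx y => ?_⟩
  have hΛ : 0 < pollingIntensity lam mu N := by
    rw [pollingIntensity]
    have : (0 : ℝ≥0) < N := by exact_mod_cast hN
    positivity
  simp only [transitionLaw_apply]
  exact tendsto_tsum_poissonWeight_mul hΛ (fun k => PMF.coe_le_one _ _)
    (hpi3 x ((hV x).2 hx) y)

/-! ### Exponentials of positive operators -/

section Exponential

variable {E : Type*}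

/-- Linear operators on `ℝ≥0∞`-valued functions. -/
abbrev Op (E : Type*) : Type _ := Module.End ℝ≥0∞ (E → ℝ≥0∞)

/-- The exponential series of an operator. In `ℝ≥0∞` no convergence is needed. -/
noncomputable def expOp (A : Op E) (f : E → ℝ≥0∞) (x : E) : ℝ≥0∞ :=
  ∑' k : ℕ, ((k.factorial : ℝ≥0∞))⁻¹ * (A ^ k) f x

/-- The operator commutes with arbitrary pointwise sums. The index types in `Type` suffice, since
only sums over `ℕ` and over states are needed. -/
def IsSigmaAdditive (A : Op E) : Prop :=
  ∀ (ι : Type) (f : ι → E → ℝ≥0∞), A (fun x => ∑' i, f i x) = fun x => ∑' i, A (f i) x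

lemma op_mono (A : Op E) {f g : E → ℝ≥0∞} (h : ∀ x, f x ≤ g x) (x : E) : A f x ≤ A g x := by
  have hg : g = f + fun x => g x - f x := by
    funext x
    exact (add_tsub_cancel_of_le (h x)).symm
  rw [hg, map_add]
  exact le_self_add

lemma IsSigmaAdditive.pow {A : Op E} (hA : IsSigmaAdditive A) (k : ℕ) :
    IsSigmaAdditive (A ^ k) := by
  induction k with
  | zero => intro ι f; rfl
  | succ k ih =>
    intro ι f
    rw [pow_succ', Module.End.mul_apply, ih ι f, hA]
    rfl

lemma inv_factorial_mul_choose {k i j : ℕ} (h : i + j = k) :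
    ((k.factorial : ℝ≥0∞))⁻¹ * (k.choose i : ℝ≥0∞) =
      ((i.factorial : ℝ≥0∞))⁻¹ * ((j.factorial : ℝ≥0∞))⁻¹ := by
  have hpos : ∀ n : ℕ, (n.factorial : ℝ≥0∞) ≠ 0 := fun n => by
    exact_mod_cast n.factorial_ne_zero
  have htop : ∀ n : ℕ, (n.factorial : ℝ≥0∞) ≠ ∞ := fun n => ENNReal.natCast_ne_top _
  have hc : (k.factorial : ℝ≥0∞) = k.choose i * (i.factorial * j.factorial) := by
    subst h
    rw [← mul_assoc]
    rw [Nat.choose_symm_add]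
    exact_mod_cast (Nat.add_choose_mul_factorial_mul_factorial i j).symm
  have hc0 : (k.choose i : ℝ≥0∞) ≠ 0 := by
    have : 0 < k.choose i := Nat.choose_pos (by omega)
    exact_mod_cast this.ne'
  have hij0 : ((i.factorial : ℝ≥0∞) * j.factorial) ≠ 0 := mul_ne_zero (hpos i) (hpos j)
  rw [hc, ENNReal.mul_inv (Or.inl hc0) (Or.inl (ENNReal.natCast_ne_top _)),
    ENNReal.mul_inv (Or.inl (hpos i)) (Or.inl (htop i)), mul_comm, ← mul_assoc,
    ENNReal.mul_inv_cancel hc0 (ENNReal.natCast_ne_top _), one_mul]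

/-- The exponential of a sum of commuting operators. -/
lemma expOp_add {A B : Op E} (hA : IsSigmaAdditive A) (h : Commute A B) (f : E → ℝ≥0∞) :
    expOp (A + B) f = expOp A (expOp B f) := by
  funext x
  have h1 : ∀ k : ℕ, ((k.factorial : ℝ≥0∞))⁻¹ * ((A + B) ^ k) f x =
      ∑ p ∈ Finset.HasAntidiagonal.antidiagonal k,
        ((p.1.factorial : ℝ≥0∞))⁻¹ * ((p.2.factorial : ℝ≥0∞))⁻¹ * (A ^ p.1) ((B ^ p.2) f) x := by
    intro k
    rw [h.add_pow', LinearMap.sum_apply, Finset.sum_apply, Finset.mul_sum]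
    refine Finset.sum_congr rfl fun p hp => ?_
    rw [← inv_factorial_mul_choose (Finset.HasAntidiagonal.mem_antidiagonal.1 hp),
      LinearMap.smul_apply, Pi.smul_apply, nsmul_eq_mul, Module.End.mul_apply, mul_assoc]
  have h2 : ∀ i : ℕ, (A ^ i) (expOp B f) x =
      ∑' j : ℕ, ((j.factorial : ℝ≥0∞))⁻¹ * (A ^ i) ((B ^ j) f) x := by
    intro i
    have e : expOp B f = fun x => ∑' j : ℕ, (((j.factorial : ℝ≥0∞))⁻¹ • (B ^ j) f) x := rfl
    rw [e, hA.pow i]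
    simp only [map_smul]
    rfl
  calc expOp (A + B) f x
      = ∑' k : ℕ, ∑' p : Finset.HasAntidiagonal.antidiagonal k, ((p.1.1.factorial : ℝ≥0∞))⁻¹ *
          ((p.1.2.factorial : ℝ≥0∞))⁻¹ * (A ^ p.1.1) ((B ^ p.1.2) f) x := by
        rw [expOp]
        refine tsum_congr fun k => ?_
        rw [h1, ← Finset.tsum_subtype]
    _ = ∑' p : ℕ × ℕ, ((p.1.factorial : ℝ≥0∞))⁻¹ * ((p.2.factorial : ℝ≥0∞))⁻¹ *
          (A ^ p.1) ((B ^ p.2) f) x := by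
        rw [← ENNReal.tsum_sigma' (f := fun p : Σ k : ℕ, Finset.HasAntidiagonal.antidiagonal k =>
          ((p.2.1.1.factorial : ℝ≥0∞))⁻¹ * ((p.2.1.2.factorial : ℝ≥0∞))⁻¹ *
          (A ^ p.2.1.1) ((B ^ p.2.1.2) f) x)]
        exact Finset.HasAntidiagonal.sigmaAntidiagonalEquivProd.tsum_eq (fun p : ℕ × ℕ =>
          ((p.1.factorial : ℝ≥0∞))⁻¹ * ((p.2.factorial : ℝ≥0∞))⁻¹ * (A ^ p.1) ((B ^ p.2) f) x)
    _ = _ := by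
        rw [ENNReal.tsum_prod', expOp]
        refine tsum_congr fun i => ?_
        rw [h2, ← ENNReal.tsum_mul_left]
        exact tsum_congr fun j => by rw [mul_assoc]

lemma tsum_poissonWeight_mul_pow (r : ℝ≥0) (A : Op E) (f : E → ℝ≥0∞) (x : E) :
    ∑' k, poissonWeight r k * (A ^ k) f x =
      ENNReal.ofReal (Real.exp (-r)) * expOp ((r : ℝ≥0∞) • A) f x := by
  rw [expOp, ← ENNReal.tsum_mul_left]
  refine tsum_congr fun k => ?_
  rw [poissonWeight_eq_mul, smul_pow, LinearMap.smul_apply, Pi.smul_apply, smul_eq_mul]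
  ring

lemma mean_iter_eq_pow {K : E → PMF E} {A : Op E} (h : ∀ f x, mean (K x) f = A f x) (k : ℕ)
    (f : E → ℝ≥0∞) (x : E) : mean (iter K k x) f = (A ^ k) f x := by
  induction k generalizing x with
  | zero => exact mean_pure x f
  | succ k ih =>
    rw [iter_succ', mean_bind, pow_succ', Module.End.mul_apply, h]
    simp only [ih]

end Exponential

/-! ### Independent M/M/1 queues as one jump process -/

/-- The operator of one event of an M/M/1 queue with weights `a` for arrivals and `b` for
services. -/
noncomputable def queueOp (a b : ℝ≥0∞) : Op ℕ where
  toFun f j := a * f (j + 1) + b * f (j - 1)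
  map_add' f g := by
    funext j
    simp only [Pi.add_apply]
    ring
  map_smul' c f := by
    funext j
    simp only [Pi.smul_apply, smul_eq_mul, RingHom.id_apply]
    ring

section Coordinates

variable {ι : Type*} [DecidableEq ι]

/-- The operator `queueOp` acting on the coordinate `n`. -/
noncomputable def coordOp (a b : ℝ≥0∞) (n : ι) : Op (ι → ℕ) where
  toFun f q := a * f (Function.update q n (q n + 1)) + b * f (Function.update q n (q n - 1))
  map_add' f g := by
    funext q
    simp only [Pi.add_apply]
    ring
  map_smul' c f := by
    funext q
    simp only [Pi.smul_apply, smul_eq_mul, RingHom.id_apply]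
    ring

lemma queueOp_apply (a b : ℝ≥0∞) (f : ℕ → ℝ≥0∞) (j : ℕ) :
    queueOp a b f j = a * f (j + 1) + b * f (j - 1) := rfl

lemma coordOp_apply (a b : ℝ≥0∞) (n : ι) (f : (ι → ℕ) → ℝ≥0∞) (q : ι → ℕ) :
    coordOp a b n f q =
      a * f (Function.update q n (q n + 1)) + b * f (Function.update q n (q n - 1)) := rfl

lemma isSigmaAdditive_coordOp (a b : ℝ≥0∞) (n : ι) : IsSigmaAdditive (coordOp a b n) := by
  intro κ f
  funext q
  simp only [coordOp_apply, ENNReal.tsum_add, ENNReal.tsum_mul_left]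

lemma isSigmaAdditive_sum {E κ : Type*} (s : Finset κ) (A : κ → Op E)
    (hA : ∀ i ∈ s, IsSigmaAdditive (A i)) : IsSigmaAdditive (∑ i ∈ s, A i) := by
  intro ι' f
  funext x
  simp only [LinearMap.sum_apply, Finset.sum_apply]
  rw [Summable.tsum_finsetSum fun _ _ => ENNReal.summable]
  exact Finset.sum_congr rfl fun i hi => by rw [hA i hi]

lemma IsSigmaAdditive.smul {E : Type*} {A : Op E} (hA : IsSigmaAdditive A) (c : ℝ≥0∞) :
    IsSigmaAdditive (c • A) := by
  intro ι' f
  funext x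
  simp only [LinearMap.smul_apply, Pi.smul_apply, smul_eq_mul, hA ι' f, ENNReal.tsum_mul_left]

lemma commute_coordOp (a b : ℝ≥0∞) {n m : ι} (h : n ≠ m) :
    Commute (coordOp a b n) (coordOp a b m) := by
  refine LinearMap.ext fun f => funext fun q => ?_
  simp only [Module.End.mul_apply, coordOp_apply, Function.update_of_ne h,
    Function.update_of_ne h.symm, Function.update_comm h]
  ring

lemma smul_coordOp (c a b : ℝ≥0∞) (n : ι) : c • coordOp a b n = coordOp (c * a) (c * b) n := by
  refine LinearMap.ext fun f => funext fun q => ?_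
  simp only [LinearMap.smul_apply, Pi.smul_apply, coordOp_apply, smul_eq_mul]
  ring

lemma smul_queueOp (c a b : ℝ≥0∞) : c • queueOp a b = queueOp (c * a) (c * b) := by
  refine LinearMap.ext fun f => funext fun j => ?_
  simp only [LinearMap.smul_apply, Pi.smul_apply, queueOp_apply, smul_eq_mul]
  ring

variable [Fintype ι]

/-- The product of functions of the coordinates. -/
noncomputable def prodFun (f : ι → ℕ → ℝ≥0∞) (q : ι → ℕ) : ℝ≥0∞ := ∏ i, f i (q i)

lemma prodFun_update (f : ι → ℕ → ℝ≥0∞) (n : ι) (g : ℕ → ℝ≥0∞) (q : ι → ℕ) :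
    prodFun (Function.update f n g) q = g (q n) * ∏ i ∈ Finset.univ.erase n, f i (q i) := by
  rw [prodFun, ← Finset.mul_prod_erase _ _ (Finset.mem_univ n), Function.update_self]
  congr 1
  exact Finset.prod_congr rfl fun i hi => by
    rw [Function.update_of_ne (Finset.ne_of_mem_erase hi)]

lemma prodFun_apply_update (f : ι → ℕ → ℝ≥0∞) (n : ι) (q : ι → ℕ) (j : ℕ) :
    prodFun f (Function.update q n j) = f n j * ∏ i ∈ Finset.univ.erase n, f i (q i) := by
  rw [prodFun, ← Finset.mul_prod_erase _ _ (Finset.mem_univ n), Function.update_self]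
  congr 1
  exact Finset.prod_congr rfl fun i hi => by
    rw [Function.update_of_ne (Finset.ne_of_mem_erase hi)]

lemma coordOp_prodFun (a b : ℝ≥0∞) (n : ι) (f : ι → ℕ → ℝ≥0∞) :
    coordOp a b n (prodFun f) = prodFun (Function.update f n (queueOp a b (f n))) := by
  funext q
  rw [coordOp_apply, prodFun_update, prodFun_apply_update, prodFun_apply_update, queueOp_apply]
  ring

lemma coordOp_pow_prodFun (a b : ℝ≥0∞) (n : ι) (f : ι → ℕ → ℝ≥0∞) (k : ℕ) :
    (coordOp a b n ^ k) (prodFun f) =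
      prodFun (Function.update f n ((queueOp a b ^ k) (f n))) := by
  induction k with
  | zero => simp
  | succ k ih =>
    rw [pow_succ', Module.End.mul_apply, ih, coordOp_prodFun, Function.update_idem,
      Function.update_self, pow_succ', Module.End.mul_apply]

lemma expOp_coordOp_prodFun (a b : ℝ≥0∞) (n : ι) (f : ι → ℕ → ℝ≥0∞) :
    expOp (coordOp a b n) (prodFun f) =
      prodFun (Function.update f n (expOp (queueOp a b) (f n))) := by
  funext q
  simp only [expOp, coordOp_pow_prodFun, prodFun_update]
  rw [← ENNReal.tsum_mul_right]
  exact tsum_congr fun k => by rw [mul_assoc]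

/-- The semigroup of the superposition of queues acts coordinatewise. -/
lemma expOp_sum_coordOp_prodFun (a b : ℝ≥0∞) (s : Finset ι) (f : ι → ℕ → ℝ≥0∞) :
    expOp (∑ n ∈ s, coordOp a b n) (prodFun f) =
      prodFun fun n => if n ∈ s then expOp (queueOp a b) (f n) else f n := by
  induction s using Finset.induction_on with
  | empty =>
    funext q
    rw [expOp, tsum_eq_single 0]
    · simp
    · intro k hk
      simp [zero_pow hk]
  | insert m s hm ih =>
    rw [Finset.sum_insert hm, expOp_add (isSigmaAdditive_coordOp a b m), ih,
      expOp_coordOp_prodFun, if_neg hm]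
    · congr 1
      funext i
      by_cases hi : i = m
      · subst hi
        simp
      · rw [Function.update_of_ne hi]
        simp [hi]
    · refine Commute.sum_right _ _ _ fun i hi => commute_coordOp a b ?_
      rintro rfl
      exact hm hi

end Coordinates

/-- The operator of one event of `N` independent M/M/1 queues. -/
noncomputable def queuesOp (lam mu : ℝ≥0) (N : ℕ) : Op (Fin N → ℕ) :=
  ((N : ℝ≥0∞))⁻¹ • ∑ n, coordOp (arrivalProb lam mu) (serviceProb lam mu) n

lemma mean_mm1Step (hmu : 0 < mu) (f : ℕ → ℝ≥0∞) (j : ℕ) :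
    mean (mm1Step lam mu j) f = queueOp (arrivalProb lam mu) (serviceProb lam mu) f j := by
  rw [mm1Step, mean_map, mean_isArrival hmu, queueOp_apply, if_pos rfl, if_neg (by simp)]

/-- `N` independent M/M/1 queues form a jump process in which events of `queuesOp` occur at the
total intensity of the `2 N` clocks. -/
theorem prod_transitionLaw (hmu : 0 < mu) {N : ℕ} (hN : 0 < N) (t : ℝ≥0) (q q' : Fin N → ℕ) :
    ∑' k, poissonWeight (pollingIntensity lam mu N * t) k *
        (queuesOp lam mu N ^ k) (Pi.single q' 1) q =
      ∏ n, transitionLaw (lam + mu) (mm1Step lam mu) t (q n) (q' n) := by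
  set r : ℝ≥0 := (lam + mu) * t with hr
  have h1 : ∀ n, transitionLaw (lam + mu) (mm1Step lam mu) t (q n) (q' n) =
      ENNReal.ofReal (Real.exp (-r)) *
        expOp (queueOp (r * arrivalProb lam mu) (r * serviceProb lam mu))
          (Pi.single (q' n) 1) (q n) := by
    intro n
    rw [transitionLaw_apply, ← smul_queueOp, ← tsum_poissonWeight_mul_pow]
    refine tsum_congr fun k => ?_
    rw [← mean_single (iter (mm1Step lam mu) k (q n)), mean_iter_eq_pow (mean_mm1Step hmu)]
  have h2 : (Pi.single q' 1 : (Fin N → ℕ) → ℝ≥0∞) = prodFun fun n => Pi.single (q' n) 1 := by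
    funext p
    by_cases hp : p = q'
    · subst hp
      simp [prodFun]
    · obtain ⟨n, hn⟩ := Function.ne_iff.1 hp
      rw [Pi.single_eq_of_ne hp, prodFun]
      exact (Finset.prod_eq_zero (Finset.mem_univ n) (Pi.single_eq_of_ne hn _)).symm
  have h3 : ((pollingIntensity lam mu N * t : ℝ≥0) : ℝ≥0∞) • queuesOp lam mu N =
      ∑ n, coordOp (r * arrivalProb lam mu) (r * serviceProb lam mu) n := by
    have e : ((pollingIntensity lam mu N * t : ℝ≥0) : ℝ≥0∞) * ((N : ℝ≥0∞))⁻¹ = r := by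
      rw [pollingIntensity, mul_assoc, ← hr, ENNReal.coe_mul, mul_comm, ← mul_assoc,
        ENNReal.coe_natCast, ENNReal.inv_mul_cancel (by exact_mod_cast hN.ne')
          (ENNReal.natCast_ne_top N), one_mul]
    rw [queuesOp, smul_smul, e, Finset.smul_sum]
    exact Finset.sum_congr rfl fun n _ => smul_coordOp _ _ _ n
  rw [tsum_poissonWeight_mul_pow, h3, h2, expOp_sum_coordOp_prodFun, prodFun]
  simp only [h1, Finset.mem_univ, if_true]
  rw [Finset.prod_mul_distrib, Finset.prod_const, Finset.card_univ, Fintype.card_fin,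
    ← ENNReal.ofReal_pow (Real.exp_pos _).le, ← Real.exp_nat_mul]
  congr 3
  rw [pollingIntensity, mul_assoc, ← hr]
  push_cast
  ring

/-! ### The process killed when all servers may be needed -/

/-- The configuration with queue lengths `q` in which every non-empty queue is served. -/
def served {N : ℕ} (q : Fin N → ℕ) : Config N := fun n => (q n, decide (0 < q n))

/-- The queue lengths `q` leave at least one of `S` servers idle. -/
def HasIdle {N : ℕ} (S : ℕ) (q : Fin N → ℕ) : Prop :=
  (Finset.univ.filter fun n => 0 < q n).card < S

lemma served_injective {N : ℕ} : Function.Injective (served (N := N)) := fun _ _ h =>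
  funext fun n => congrArg Prod.fst (congrFun h n)

lemma busy_served {N : ℕ} (q : Fin N → ℕ) :
    busy (served q) = (Finset.univ.filter fun n => 0 < q n).card := by
  simp [busy, served]

lemma served_update {N : ℕ} (q : Fin N → ℕ) (n : Fin N) (j : ℕ) :
    served (Function.update q n j) = Function.update (served q) n (j, decide (0 < j)) := by
  funext m
  by_cases h : m = n
  · subst h
    simp [served]
  · simp [served, h]

lemma arrive_served {N S : ℕ} {q : Fin N → ℕ} (h : HasIdle S q) (n : Fin N) :
    arrive S (served q) n = served (Function.update q n (q n + 1)) := by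
  have hb : busy (served q) < S := by
    rw [busy_served]
    exact h
  rw [served_update, arrive]
  simp [hb, served]

lemma serviceEnd_served {N : ℕ} (q : Fin N → ℕ) (n : Fin N) :
    serviceEnd (served q) n = PMF.pure (served (Function.update q n (q n - 1))) := by
  rw [serviceEnd]
  split_ifs with h
  · have hrel : release (served q) n = Function.update (served q) n (q n - 1, false) := rfl
    have hw : ∀ m, m ∈ waiting (release (served q) n) ↔ m = n ∧ 0 < q n - 1 := by
      intro m
      by_cases hm : m = n
      · subst hm
        simp [waiting, hrel]
      · simp [waiting, hrel, hm, served, Nat.pos_iff_ne_zero]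
    have hasg : 0 < q n - 1 → assign (release (served q) n) n =
        served (Function.update q n (q n - 1)) := by
      intro h1
      rw [served_update, assign, hrel]
      simp [h1]
    refine pmf_eq_of_le fun y => ?_
    by_cases hy : y ∈ (uniformPick (waiting (release (served q) n))
        (assign (release (served q) n)) (release (served q) n)).support
    · have : y = served (Function.update q n (q n - 1)) := by
        rcases (mem_support_uniformPick _ _ _ _).1 hy with ⟨m, hm, rfl⟩ | ⟨hne, rfl⟩
        · obtain ⟨rfl, h1⟩ := (hw m).1 hm
          exact hasg h1
        · have h0 : ¬ 0 < q n - 1 := fun h1 => hne ⟨n, (hw n).2 ⟨rfl, h1⟩⟩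
          rw [served_update, hrel]
          simp [h0]
      rw [this, PMF.pure_apply_self]
      exact PMF.coe_le_one _ _
    · rw [(PMF.apply_eq_zero_iff _ _).2 hy]
      exact zero_le
  · have h0 : q n = 0 := by simpa [served] using h
    have : Function.update q n (q n - 1) = q := by
      rw [h0, Nat.zero_sub, ← h0, Function.update_eq_self]
    rw [this]

/-- As long as some server is idle, the polling system and the independent queues have the same
transitions. -/
lemma mean_pollingStep_served (hmu : 0 < mu) {N : ℕ} (hN : 0 < N) {S : ℕ} {q : Fin N → ℕ}
    (h : HasIdle S q) (f : Config N → ℝ≥0∞) :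
    mean (pollingStep lam mu S (served q)) f = queuesOp lam mu N (f ∘ served) q := by
  rw [mean_pollingStep hmu hN, queuesOp, LinearMap.smul_apply, Pi.smul_apply,
    LinearMap.sum_apply, Finset.sum_apply, smul_eq_mul]
  simp only [arrive_served h, serviceEnd_served, mean_pure, coordOp_apply, Function.comp_apply,
    Finset.sum_add_distrib, ← Finset.mul_sum, ENNReal.div_eq_inv_mul]
  ring

/-- One event of the independent queues, killed in states in which no server would be idle. -/
noncomputable def killedOp (lam mu : ℝ≥0) (N S : ℕ) : Op (Fin N → ℕ) where
  toFun f q := open Classical in if HasIdle S q then queuesOp lam mu N f q else 0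
  map_add' f g := by
    funext q
    by_cases h : HasIdle S q <;> simp [h]
  map_smul' c f := by
    funext q
    by_cases h : HasIdle S q <;> simp [h]

section Killed

variable {N S : ℕ}

lemma killedOp_of_hasIdle {q : Fin N → ℕ} (h : HasIdle S q) (f : (Fin N → ℕ) → ℝ≥0∞) :
    killedOp lam mu N S f q = queuesOp lam mu N f q := if_pos h

lemma killedOp_of_not_hasIdle {q : Fin N → ℕ} (h : ¬ HasIdle S q) (f : (Fin N → ℕ) → ℝ≥0∞) :
    killedOp lam mu N S f q = 0 := if_neg h

lemma killedOp_le (f : (Fin N → ℕ) → ℝ≥0∞) (q : Fin N → ℕ) :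
    killedOp lam mu N S f q ≤ queuesOp lam mu N f q := by
  by_cases h : HasIdle S q
  · rw [killedOp_of_hasIdle h]
  · rw [killedOp_of_not_hasIdle h]
    exact zero_le

lemma killedOp_pow_le (k : ℕ) (f : (Fin N → ℕ) → ℝ≥0∞) (q : Fin N → ℕ) :
    (killedOp lam mu N S ^ k) f q ≤ (queuesOp lam mu N ^ k) f q := by
  induction k generalizing q with
  | zero => exact le_rfl
  | succ k ih =>
    rw [pow_succ', pow_succ', Module.End.mul_apply, Module.End.mul_apply]
    exact (killedOp_le _ q).trans (op_mono _ ih q)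

lemma killedOp_pow_le_mean_iter (hmu : 0 < mu) (hN : 0 < N) (k : ℕ) (f : Config N → ℝ≥0∞)
    (q : Fin N → ℕ) : (killedOp lam mu N S ^ k) (f ∘ served) q ≤
      mean (iter (pollingStep lam mu S) k (served q)) f := by
  induction k generalizing q with
  | zero => exact (mean_pure _ _).ge
  | succ k ih =>
    rw [pow_succ', Module.End.mul_apply, iter_succ', mean_bind]
    by_cases h : HasIdle S q
    · rw [killedOp_of_hasIdle h, mean_pollingStep_served hmu hN h]
      exact op_mono _ ih q
    · rw [killedOp_of_not_hasIdle h]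
      exact zero_le

lemma isSigmaAdditive_queuesOp : IsSigmaAdditive (queuesOp lam mu N) :=
  (isSigmaAdditive_sum _ _ fun n _ => isSigmaAdditive_coordOp _ _ n).smul _

lemma isSigmaAdditive_killedOp : IsSigmaAdditive (killedOp lam mu N S) := by
  intro ι f
  funext q
  by_cases h : HasIdle S q
  · simp only [killedOp_of_hasIdle h, isSigmaAdditive_queuesOp ι f]
  · simp only [killedOp_of_not_hasIdle h, tsum_zero]

/-- The transition densities of the killed process in continuous time. -/
noncomputable def killedLaw (lam mu : ℝ≥0) (N S : ℕ) (t : ℝ≥0) (q q' : Fin N → ℕ) : ℝ≥0∞ :=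
  ∑' k, poissonWeight (pollingIntensity lam mu N * t) k *
    (killedOp lam mu N S ^ k) (Pi.single q' 1) q

lemma killedLaw_le_transitionLaw (hmu : 0 < mu) (hN : 0 < N) (t : ℝ≥0) (q q' : Fin N → ℕ) :
    killedLaw lam mu N S t q q' ≤
      transitionLaw (pollingIntensity lam mu N) (pollingStep lam mu S) t (served q)
        (served q') := by
  rw [killedLaw, transitionLaw_apply]
  refine ENNReal.tsum_le_tsum fun k => ?_
  gcongr
  have h : (Pi.single q' 1 : (Fin N → ℕ) → ℝ≥0∞) =
      (Pi.single (served q') 1 : Config N → ℝ≥0∞) ∘ served := by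
    funext p
    by_cases hp : p = q'
    · simp [hp]
    · rw [Pi.single_eq_of_ne hp, Function.comp_apply,
        Pi.single_eq_of_ne fun h => hp (served_injective h)]
  rw [h, ← mean_single (iter (pollingStep lam mu S) k (served q))]
  exact killedOp_pow_le_mean_iter hmu hN k _ q

lemma killedLaw_le_prod (hmu : 0 < mu) (hN : 0 < N) (t : ℝ≥0) (q q' : Fin N → ℕ) :
    killedLaw lam mu N S t q q' ≤
      ∏ n, transitionLaw (lam + mu) (mm1Step lam mu) t (q n) (q' n) := by
  rw [← prod_transitionLaw hmu hN, killedLaw]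
  refine ENNReal.tsum_le_tsum fun k => ?_
  gcongr
  exact killedOp_pow_le k _ q

lemma tsum_killedLaw (t : ℝ≥0) (q : Fin N → ℕ) :
    ∑' q', killedLaw lam mu N S t q q' =
      ∑' k, poissonWeight (pollingIntensity lam mu N * t) k * (killedOp lam mu N S ^ k) 1 q := by
  simp only [killedLaw]
  rw [ENNReal.tsum_comm]
  refine tsum_congr fun k => ?_
  rw [ENNReal.tsum_mul_left]
  congr 1
  have h : (1 : (Fin N → ℕ) → ℝ≥0∞) =
      fun p => ∑' q' : Fin N → ℕ, (Pi.single q' 1 : (Fin N → ℕ) → ℝ≥0∞) p := by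
    funext p
    rw [tsum_eq_single p]
    · simp
    · intro b hb
      exact Pi.single_eq_of_ne hb.symm _
  rw [h, isSigmaAdditive_killedOp.pow k]

/-! ### Equilibrium of the independent queues -/

/-- Product geometric weights. -/
noncomputable def equilibrium (rho : ℝ) {N : ℕ} (q : Fin N → ℕ) : ℝ≥0∞ :=
  ∏ n, ENNReal.ofReal ((1 - rho) * rho ^ q n)

/-- Summation over the states with a customer in queue `n`. -/
lemma tsum_ite_pos_eq (n : Fin N) (F : (Fin N → ℕ) → ℝ≥0∞) :
    ∑' q : Fin N → ℕ, (if 0 < q n then F q else 0) =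
      ∑' q : Fin N → ℕ, F (Function.update q n (q n + 1)) := by
  have hinj : Function.Injective fun q : Fin N → ℕ => Function.update q n (q n + 1) := by
    intro p q h
    funext m
    have hm := congrFun h m
    by_cases hmn : m = n
    · subst hmn
      simpa using hm
    · simpa [hmn] using hm
  rw [← hinj.tsum_eq (f := fun q => if 0 < q n then F q else 0)]
  · exact tsum_congr fun q => by simp
  · intro q hq
    have hq0 : 0 < q n := by
      by_contra h
      exact hq (if_neg h)
    refine ⟨Function.update q n (q n - 1), ?_⟩
    funext m
    by_cases hmn : m = n
    · subst hmn
      simp only [Function.update_self]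
      omega
    · simp [hmn]

/-- Detailed balance of the geometric weights. -/
lemma arrivalProb_mul_equilibrium (hmu : 0 < mu) (hlt : lam < mu) (q : Fin N → ℕ) (n : Fin N) :
    (arrivalProb lam mu : ℝ≥0∞) * equilibrium ((lam : ℝ) / mu) q =
      serviceProb lam mu * equilibrium ((lam : ℝ) / mu) (Function.update q n (q n + 1)) := by
  have hmu' : (0 : ℝ) < mu := hmu
  have hlt' : (lam : ℝ) < mu := hlt
  have hl : (0 : ℝ) ≤ lam := lam.coe_nonneg
  rw [equilibrium, equilibrium, ← Finset.mul_prod_erase _ _ (Finset.mem_univ n),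
    ← Finset.mul_prod_erase (a := n) _ _ (Finset.mem_univ n), Function.update_self,
    ← mul_assoc, ← mul_assoc]
  congr 1
  · rw [← ENNReal.ofReal_coe_nnreal, ← ENNReal.ofReal_coe_nnreal,
      ← ENNReal.ofReal_mul (NNReal.coe_nonneg _), ← ENNReal.ofReal_mul (NNReal.coe_nonneg _),
      arrivalProb, serviceProb]
    congr 1
    push_cast
    rw [pow_succ]
    field_simp
  · exact Finset.prod_congr rfl fun m hm => by
      rw [Function.update_of_ne (Finset.ne_of_mem_erase hm)]

lemma tsum_equilibrium_mul_coordOp (hmu : 0 < mu) (hlt : lam < mu) (n : Fin N)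
    (f : (Fin N → ℕ) → ℝ≥0∞) :
    ∑' q, equilibrium ((lam : ℝ) / mu) q *
        coordOp (arrivalProb lam mu) (serviceProb lam mu) n f q =
      ∑' q, equilibrium ((lam : ℝ) / mu) q * f q := by
  set w : (Fin N → ℕ) → ℝ≥0∞ := equilibrium ((lam : ℝ) / mu) with hw
  set a : ℝ≥0∞ := ↑(arrivalProb lam mu) with ha
  set b : ℝ≥0∞ := ↑(serviceProb lam mu) with hb
  have hab : a + b = 1 := by
    rw [ha, hb]
    exact_mod_cast arrivalProb_add_serviceProb (lam := lam) hmu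
  have hbal : ∀ q, a * w q = b * w (Function.update q n (q n + 1)) := fun q =>
    arrivalProb_mul_equilibrium hmu hlt q n
  have harr : ∑' q, w q * (a * f (Function.update q n (q n + 1))) =
      ∑' q : Fin N → ℕ, if 0 < q n then b * (w q * f q) else 0 := by
    rw [tsum_ite_pos_eq n fun q => b * (w q * f q)]
    refine tsum_congr fun q => ?_
    rw [← mul_assoc, mul_comm (w q), hbal, mul_assoc]
  have hser : ∑' q, w q * (b * f (Function.update q n (q n - 1))) =
      ∑' q, a * (w q * f q) + ∑' q : Fin N → ℕ, if 0 < q n then 0 else b * (w q * f q) := by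
    have h1 : ∀ q : Fin N → ℕ, w q * (b * f (Function.update q n (q n - 1))) =
        (if 0 < q n then w q * (b * f (Function.update q n (q n - 1))) else 0) +
          if 0 < q n then 0 else b * (w q * f q) := by
      intro q
      split_ifs with h
      · rw [add_zero]
      · have h0 : q n - 1 = q n := by omega
        rw [h0, Function.update_eq_self, zero_add]
        ring
    rw [tsum_congr h1, ENNReal.tsum_add,
      tsum_ite_pos_eq n fun q => w q * (b * f (Function.update q n (q n - 1)))]
    congr 1
    refine tsum_congr fun q => ?_
    rw [← mul_assoc, ← mul_assoc, mul_comm (w _) b, ← hbal]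
    congr 2
    simp
  simp only [coordOp_apply, mul_add]
  rw [ENNReal.tsum_add, harr, hser, add_left_comm, ← ENNReal.tsum_add, ← ENNReal.tsum_add]
  refine tsum_congr fun q => ?_
  calc a * (w q * f q) + ((if 0 < q n then b * (w q * f q) else 0) +
        if 0 < q n then 0 else b * (w q * f q))
      = a * (w q * f q) + b * (w q * f q) := by split_ifs <;> simp
    _ = w q * f q := by rw [← add_mul, hab, one_mul]

lemma tsum_equilibrium_mul_queuesOp_pow (hmu : 0 < mu) (hlt : lam < mu) (hN : 0 < N) (k : ℕ)
    (f : (Fin N → ℕ) → ℝ≥0∞) :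
    ∑' q, equilibrium ((lam : ℝ) / mu) q * (queuesOp lam mu N ^ k) f q =
      ∑' q, equilibrium ((lam : ℝ) / mu) q * f q := by
  induction k with
  | zero => rfl
  | succ k ih =>
    rw [← ih, pow_succ', Module.End.mul_apply]
    simp only [queuesOp, LinearMap.smul_apply, Pi.smul_apply, LinearMap.sum_apply,
      Finset.sum_apply, smul_eq_mul, Finset.mul_sum]
    rw [Summable.tsum_finsetSum fun _ _ => ENNReal.summable]
    simp only [mul_left_comm _ ((N : ℝ≥0∞))⁻¹, ENNReal.tsum_mul_left,
      tsum_equilibrium_mul_coordOp hmu hlt]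
    rw [Finset.sum_const, Finset.card_univ, Fintype.card_fin, nsmul_eq_mul, ← mul_assoc,
      ENNReal.mul_inv_cancel (by exact_mod_cast hN.ne') (ENNReal.natCast_ne_top N), one_mul]

/-- The equilibrium probability that no server is idle. -/
noncomputable def overflow (lam mu : ℝ≥0) (N S : ℕ) : ℝ≥0∞ :=
  open Classical in
  ∑' q : Fin N → ℕ, equilibrium ((lam : ℝ) / mu) q * if HasIdle S q then 0 else 1

open Classical in
/-- Killing within `k` events requires one of the first `k` states to have no idle server. -/
lemma one_le_killedOp_pow_add (hmu : 0 < mu) (hN : 0 < N) (k : ℕ) (q : Fin N → ℕ) :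
    1 ≤ (killedOp lam mu N S ^ k) 1 q + ∑ j ∈ Finset.range k,
      (queuesOp lam mu N ^ j) (fun p => if HasIdle S p then 0 else 1) q := by
  set B := queuesOp lam mu N with hB
  set g : (Fin N → ℕ) → ℝ≥0∞ := fun p => if HasIdle S p then 0 else 1 with hg
  have hone : ∀ p, B 1 p = 1 := by
    intro p
    simp only [hB, queuesOp, LinearMap.smul_apply, Pi.smul_apply, LinearMap.sum_apply,
      Finset.sum_apply, smul_eq_mul, coordOp_apply, Pi.one_apply, mul_one]
    have : (arrivalProb lam mu : ℝ≥0∞) + serviceProb lam mu = 1 := by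
      exact_mod_cast arrivalProb_add_serviceProb (lam := lam) hmu
    rw [this, Finset.sum_const, Finset.card_univ, Fintype.card_fin, nsmul_eq_mul, mul_one,
      ENNReal.inv_mul_cancel (by exact_mod_cast hN.ne') (ENNReal.natCast_ne_top N)]
  induction k generalizing q with
  | zero => simp
  | succ k ih =>
    rw [Finset.sum_range_succ']
    by_cases h : HasIdle S q
    · rw [pow_succ', Module.End.mul_apply, killedOp_of_hasIdle h]
      calc (1 : ℝ≥0∞) = B 1 q := (hone q).symm
        _ ≤ B ((killedOp lam mu N S ^ k) 1 + ∑ j ∈ Finset.range k, (B ^ j) g) q := by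
            refine op_mono B (fun p => ?_) q
            rw [Pi.add_apply, Finset.sum_apply]
            exact ih p
        _ = B ((killedOp lam mu N S ^ k) 1) q + ∑ j ∈ Finset.range k, (B ^ (j + 1)) g q := by
            rw [map_add, Pi.add_apply, map_sum, Finset.sum_apply]
            simp only [pow_succ', Module.End.mul_apply]
        _ ≤ _ := by
            rw [← add_assoc]
            exact le_self_add
    · refine le_trans ?_ (le_add_self.trans le_add_self)
      simp [hg, h]

/-- A measure dominated by the equilibrium loses at most `overflow` per event of the killed
process, since the unkilled one stays in equilibrium. -/
lemma tsum_le_tsum_killedLaw_add (hmu : 0 < mu) (hlt : lam < mu) (hN : 0 < N)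
    {m : (Fin N → ℕ) → ℝ≥0∞} (hm : ∀ q, m q ≤ equilibrium ((lam : ℝ) / mu) q) (t : ℝ≥0) :
    ∑' q, m q ≤ ∑' q', ∑' q, m q * killedLaw lam mu N S t q q' +
      pollingIntensity lam mu N * t * overflow lam mu N S := by
  classical
  set w := poissonWeight (pollingIntensity lam mu N * t) with hw
  have hk : ∀ k : ℕ, ∑' q, m q ≤
      ∑' q, m q * (killedOp lam mu N S ^ k) 1 q + k * overflow lam mu N S := by
    intro k
    calc ∑' q, m q = ∑' q, m q * 1 := by simp
      _ ≤ ∑' q, m q * ((killedOp lam mu N S ^ k) 1 q + ∑ j ∈ Finset.range k,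
            (queuesOp lam mu N ^ j) (fun p => if HasIdle S p then 0 else 1) q) :=
          ENNReal.tsum_le_tsum fun q => by
            gcongr
            exact one_le_killedOp_pow_add hmu hN k q
      _ = ∑' q, m q * (killedOp lam mu N S ^ k) 1 q + ∑ j ∈ Finset.range k, ∑' q, m q *
            (queuesOp lam mu N ^ j) (fun p => if HasIdle S p then 0 else 1) q := by
          simp only [mul_add, Finset.mul_sum]
          rw [ENNReal.tsum_add, Summable.tsum_finsetSum fun _ _ => ENNReal.summable]
      _ ≤ ∑' q, m q * (killedOp lam mu N S ^ k) 1 q + ∑ j ∈ Finset.range k,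
            overflow lam mu N S := by
          gcongr with j hj
          rw [overflow, ← tsum_equilibrium_mul_queuesOp_pow hmu hlt hN j]
          exact ENNReal.tsum_le_tsum fun q => by
            gcongr
            exact hm q
      _ = _ := by
          rw [Finset.sum_const, Finset.card_range, nsmul_eq_mul]
  calc ∑' q, m q = ∑' k, w k * ∑' q, m q := by
        rw [ENNReal.tsum_mul_right, hw, tsum_poissonWeight, one_mul]
    _ ≤ ∑' k, w k * (∑' q, m q * (killedOp lam mu N S ^ k) 1 q + k * overflow lam mu N S) :=
        ENNReal.tsum_le_tsum fun k => by
          gcongr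
          exact hk k
    _ = _ := by
        simp only [mul_add]
        rw [ENNReal.tsum_add]
        congr 1
        · rw [ENNReal.tsum_comm (f := fun q' q => m q * killedLaw lam mu N S t q q')]
          simp only [ENNReal.tsum_mul_left, tsum_killedLaw, ← hw]
          simp only [← ENNReal.tsum_mul_left]
          rw [ENNReal.tsum_comm]
          exact tsum_congr fun q => tsum_congr fun k => mul_left_comm _ _ _
        · simp only [← mul_assoc, ENNReal.tsum_mul_right]
          rw [hw, tsum_poissonWeight_mul_nat, ENNReal.coe_mul]

lemma tsum_mul_killedLaw_le (hmu : 0 < mu) (hlt : lam < mu) (hN : 0 < N)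
    {m : (Fin N → ℕ) → ℝ≥0∞} (hm : ∀ q, m q ≤ equilibrium ((lam : ℝ) / mu) q) (t : ℝ≥0)
    (q' : Fin N → ℕ) :
    ∑' q, m q * killedLaw lam mu N S t q q' ≤ equilibrium ((lam : ℝ) / mu) q' := by
  calc ∑' q, m q * killedLaw lam mu N S t q q'
      ≤ ∑' q, ∑' k, poissonWeight (pollingIntensity lam mu N * t) k *
          (equilibrium ((lam : ℝ) / mu) q * (queuesOp lam mu N ^ k) (Pi.single q' 1) q) := by
        refine ENNReal.tsum_le_tsum fun q => ?_
        rw [killedLaw, ← ENNReal.tsum_mul_left]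
        refine ENNReal.tsum_le_tsum fun k => ?_
        rw [mul_left_comm]
        gcongr
        · exact hm q
        · exact killedOp_pow_le k _ q
    _ = equilibrium ((lam : ℝ) / mu) q' := by
        rw [ENNReal.tsum_comm]
        simp only [ENNReal.tsum_mul_left, tsum_equilibrium_mul_queuesOp_pow hmu hlt hN]
        rw [ENNReal.tsum_mul_right, tsum_poissonWeight, one_mul, tsum_eq_single q']
        · simp
        · intro b hb
          simp [hb]

/-- The weight of a sequence of states of the killed process observed at successive times. -/
noncomputable def killedPath (lam mu : ℝ≥0) (S : ℕ) (m : (Fin N → ℕ) → ℝ≥0∞) {k : ℕ}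
    (τ : Fin k → ℝ≥0) (p : Fin (k + 1) → Fin N → ℕ) : ℝ≥0∞ :=
  m (p 0) * ∏ i : Fin k, killedLaw lam mu N S (τ i) (p i.castSucc) (p i.succ)

/-- Total weight of the observations of the killed process: the loss per unit time is at most the
intensity of the clocks times `overflow`. -/
lemma tsum_le_tsum_killedPath_add (hmu : 0 < mu) (hlt : lam < mu) (hN : 0 < N) (k : ℕ)
    (τ : Fin k → ℝ≥0) {m : (Fin N → ℕ) → ℝ≥0∞}
    (hm : ∀ q, m q ≤ equilibrium ((lam : ℝ) / mu) q) :
    ∑' q, m q ≤ ∑' p, killedPath lam mu S m τ p +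
      pollingIntensity lam mu N * (∑ i, τ i : ℝ≥0) * overflow lam mu N S := by
  induction k generalizing m with
  | zero =>
    refine le_trans (le_of_eq ?_) le_self_add
    rw [← (Equiv.funUnique (Fin 1) (Fin N → ℕ)).tsum_eq]
    refine tsum_congr fun p => ?_
    simp [killedPath, Equiv.funUnique]
  | succ k ih =>
    set m' : (Fin N → ℕ) → ℝ≥0∞ := fun q' => ∑' q, m q * killedLaw lam mu N S (τ 0) q q' with hm'
    have h1 := tsum_le_tsum_killedLaw_add (S := S) hmu hlt hN hm (τ 0)
    have h2 := ih (fun i => τ i.succ) (m := m') (tsum_mul_killedLaw_le hmu hlt hN hm (τ 0))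
    have h3 : ∑' p, killedPath lam mu S m' (fun i => τ i.succ) p =
        ∑' p, killedPath lam mu S m τ p := by
      rw [← (Fin.consEquiv fun _ : Fin (k + 2) => Fin N → ℕ).tsum_eq, ENNReal.tsum_prod',
        ENNReal.tsum_comm]
      refine tsum_congr fun p => ?_
      simp only [killedPath, hm', Fin.prod_univ_succ, Fin.consEquiv_apply, Fin.cons_zero,
        Fin.castSucc_zero, Fin.cons_succ, Fin.castSucc_succ]
      rw [← ENNReal.tsum_mul_right]
      exact tsum_congr fun q => mul_assoc _ _ _
    refine h1.trans ((add_le_add h2 le_rfl).trans (le_of_eq ?_))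
    rw [h3, add_assoc, Fin.sum_univ_succ]
    congr 1
    push_cast
    ring

end Killed

/-! ### Total variation distance of path laws -/

/-- Point masses `κ` below a measure, summed over the points of a set. -/
lemma tsum_ite_mem_le_measure {F I : Type*} [MeasurableSpace F] [MeasurableSingletonClass F]
    [Countable I] (ν : Measure F) {φ : I → F} (hφ : Function.Injective φ) {κ : I → ℝ≥0∞}
    (hκ : ∀ i, κ i ≤ ν {φ i}) (B : Set F) [DecidablePred (· ∈ B)] :
    ∑' i, (if φ i ∈ B then κ i else 0) ≤ ν B := by
  calc ∑' i, (if φ i ∈ B then κ i else 0) ≤ ∑' i, ν.restrict B {φ i} := by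
        refine ENNReal.tsum_le_tsum fun i => ?_
        split_ifs with h
        · rw [Measure.restrict_apply (measurableSet_singleton _),
            Set.inter_eq_left.2 (Set.singleton_subset_iff.2 h)]
          exact hκ i
        · exact zero_le
    _ = ν.restrict B (⋃ i, {φ i}) := by
        rw [measure_iUnion]
        · intro i j hij
          exact Set.disjoint_singleton.2 fun h => hij (hφ h)
        · exact fun i => measurableSet_singleton _
    _ ≤ ν.restrict B Set.univ := measure_mono (Set.subset_univ _)
    _ = ν B := by rw [Measure.restrict_apply MeasurableSet.univ, Set.univ_inter]

/-- Two probability measures with a common part of mass at least `1 - δ` differ by at most `δ` on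
every event. -/
lemma abs_measureReal_sub_le_of_common {F I : Type*} [MeasurableSpace F]
    [MeasurableSingletonClass F] [Countable I] (ν ν' : Measure F) [IsProbabilityMeasure ν]
    [IsProbabilityMeasure ν'] {φ : I → F} (hφ : Function.Injective φ) {κ : I → ℝ≥0∞}
    (hκ : ∀ i, κ i ≤ ν {φ i}) (hκ' : ∀ i, κ i ≤ ν' {φ i}) {δ : ℝ≥0∞} (hδ : δ ≠ ∞)
    (hsum : 1 ≤ ∑' i, κ i + δ) {B : Set F} (hB : MeasurableSet B) :
    |ν.real B - ν'.real B| ≤ δ.toReal := by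
  classical
  have key : ∀ (ρ ρ' : Measure F) [IsProbabilityMeasure ρ] [IsProbabilityMeasure ρ'],
      (∀ i, κ i ≤ ρ {φ i}) → (∀ i, κ i ≤ ρ' {φ i}) → ρ B ≤ ρ' B + δ := by
    intro ρ ρ' _ _ h h'
    set a := ∑' i, (if φ i ∈ B then κ i else 0) with ha
    set b := ∑' i, (if φ i ∈ Bᶜ then κ i else 0) with hb
    have h1 : a ≤ ρ' B := tsum_ite_mem_le_measure ρ' hφ h' B
    have h2 : b ≤ ρ Bᶜ := tsum_ite_mem_le_measure ρ hφ h Bᶜ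
    have hab : ∑' i, κ i = a + b := by
      rw [ha, hb, ← ENNReal.tsum_add]
      refine tsum_congr fun i => ?_
      by_cases hi : φ i ∈ B <;> simp [hi]
    have hbtop : b ≠ ∞ := ne_top_of_le_ne_top (measure_ne_top ρ _) h2
    refine (ENNReal.add_le_add_iff_right hbtop).1 ?_
    calc ρ B + b ≤ ρ B + ρ Bᶜ := by gcongr
      _ = 1 := prob_add_prob_compl hB
      _ ≤ a + b + δ := by rw [← hab]; exact hsum
      _ ≤ ρ' B + b + δ := by gcongr
      _ = ρ' B + δ + b := by ring
  have toReal_le : ∀ (ρ ρ' : Measure F) [IsProbabilityMeasure ρ] [IsProbabilityMeasure ρ'],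
      ρ B ≤ ρ' B + δ → ρ.real B ≤ ρ'.real B + δ.toReal := by
    intro ρ ρ' _ _ h
    rw [Measure.real, Measure.real, ← ENNReal.toReal_add (measure_ne_top _ _) hδ]
    exact ENNReal.toReal_mono (ENNReal.add_ne_top.2 ⟨measure_ne_top _ _, hδ⟩) h
  have h1 := toReal_le ν ν' (key ν ν' hκ hκ')
  have h2 := toReal_le ν' ν (key ν' ν hκ' hκ)
  rw [abs_le]
  constructor <;> linarith

lemma tvDist_nonneg {α : Type*} [MeasurableSpace α] (ν ν' : Measure α) : 0 ≤ tvDist ν ν' :=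
  Real.iSup_nonneg fun _ => abs_nonneg _

/-- The total variation distance of measures on a product space can be computed on cylinders. -/
lemma tvDist_le_of_cylinders {ι : Type*} {α : ι → Type*} [∀ i, MeasurableSpace (α i)]
    (ν ν' : Measure (∀ i, α i)) [IsProbabilityMeasure ν] [IsProbabilityMeasure ν'] {d : ℝ}
    (h : ∀ (J : Finset ι) (B : Set (∀ i : J, α i)), MeasurableSet B →
      |ν.real (cylinder J B) - ν'.real (cylinder J B)| ≤ d) : tvDist ν ν' ≤ d := by
  have : Nonempty {A : Set (∀ i, α i) // MeasurableSet A} := ⟨⟨∅, MeasurableSet.empty⟩⟩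
  refine ciSup_le fun A => le_of_forall_pos_le_add fun ε hε => ?_
  obtain ⟨C, hC, hCA⟩ := exists_measure_symmDiff_lt_of_generateFrom_isSetRing (μ := ν + ν')
    isSetRing_measurableCylinders
    ⟨{Set.univ}, Set.countable_singleton _,
      Set.singleton_subset_iff.2 (univ_mem_measurableCylinders α), by simp⟩
    generateFrom_measurableCylinders.symm A.2 (ε := ENNReal.ofReal ε) (ENNReal.ofReal_pos.2 hε)
  have hCm : MeasurableSet C := MeasurableSet.of_mem_measurableCylinders hC
  have hadd : ν.real (symmDiff C A.1) + ν'.real (symmDiff C A.1) ≤ ε := by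
    rw [Measure.add_apply] at hCA
    rw [Measure.real, Measure.real, ← ENNReal.toReal_add (measure_ne_top _ _) (measure_ne_top _ _)]
    exact ENNReal.toReal_le_of_le_ofReal hε.le hCA.le
  have h1 := abs_measureReal_sub_le_measureReal_symmDiff (μ := ν) hCm.nullMeasurableSet
    A.2.nullMeasurableSet
  have h2 := abs_measureReal_sub_le_measureReal_symmDiff (μ := ν') hCm.nullMeasurableSet
    A.2.nullMeasurableSet
  obtain ⟨J, B, hB, rfl⟩ := (mem_measurableCylinders C).1 hC
  have h3 := h J B hB
  rw [abs_le] at h1 h2 h3 ⊢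
  constructor <;> linarith

/-- A finite set of times can be enumerated by a monotone sequence that starts at `0`. -/
lemma exists_monotone_grid (J : Finset ℝ≥0) :
    ∃ (k : ℕ) (t : ℕ → ℝ≥0), Monotone t ∧ t 0 = 0 ∧ (∀ i, t i ∈ insert 0 J) ∧
      ∀ a ∈ J, ∃ i ≤ k, t i = a := by
  induction J using Finset.induction_on_max with
  | empty => exact ⟨0, fun _ => 0, monotone_const, rfl, by simp, by simp⟩
  | insert a J ha ih =>
    obtain ⟨k, t, hmono, h0, hmem, hsurj⟩ := ih
    have hta : ∀ i, t i ≤ a := by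
      intro i
      rcases Finset.mem_insert.1 (hmem i) with h | h
      · rw [h]
        exact zero_le
      · exact (ha _ h).le
    refine ⟨k + 1, fun i => if i ≤ k then t i else a, fun i j hij => ?_, by simp [h0],
      fun i => ?_, fun b hb => ?_⟩
    · dsimp only
      split_ifs with hi hj hj
      · exact hmono hij
      · exact hta i
      · omega
      · exact le_rfl
    · dsimp only
      split_ifs
      · have := hmem i
        simp only [Finset.mem_insert] at this ⊢
        tauto
      · simp
    · rcases Finset.mem_insert.1 hb with rfl | hb
      · exact ⟨k + 1, le_rfl, by simp⟩
      · obtain ⟨i, hi, hti⟩ := hsurj b hb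
        exact ⟨i, by omega, by simp [hi, hti]⟩

/-- The total variation distance of path laws is bounded if, along every finite sequence of
times, the laws of the observations have a common part of mass at least `1 - δ`. -/
lemma tvDist_pathLaw_le {E Ω Ω' : Type*} [MeasurableSpace E] [MeasurableSingletonClass E]
    [Countable E] [MeasurableSpace Ω] [MeasurableSpace Ω'] {P : Measure Ω} {P' : Measure Ω'}
    [IsProbabilityMeasure P] [IsProbabilityMeasure P'] {X : ℝ≥0 → Ω → E} {Y : ℝ≥0 → Ω' → E}
    (hX : ∀ t, Measurable (X t)) (hY : ∀ t, Measurable (Y t)) {T : ℝ≥0} {δ : ℝ≥0∞} (hδ : δ ≠ ∞)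
    {Z : Type*} [Countable Z] {φ : Z → E} (hφ : Function.Injective φ)
    (h : ∀ (k : ℕ) (t : ℕ → ℝ≥0), Monotone t → t 0 = 0 → (∀ i, t i ≤ T) →
      ∃ κ : (Fin (k + 1) → Z) → ℝ≥0∞, 1 ≤ ∑' p, κ p + δ ∧
        ∀ p, κ p ≤ P {ω | ∀ i : Fin (k + 1), X (t i) ω = φ (p i)} ∧
          κ p ≤ P' {ω | ∀ i : Fin (k + 1), Y (t i) ω = φ (p i)}) :
    tvDist (pathLaw P T X) (pathLaw P' T Y) ≤ δ.toReal := by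
  have hXm : Measurable fun ω (t : Set.Iic T) => X t ω := measurable_pi_lambda _ fun t => hX t
  have hYm : Measurable fun ω (t : Set.Iic T) => Y t ω := measurable_pi_lambda _ fun t => hY t
  have hP : IsProbabilityMeasure (pathLaw P T X) :=
    Measure.isProbabilityMeasure_map hXm.aemeasurable
  have hP' : IsProbabilityMeasure (pathLaw P' T Y) :=
    Measure.isProbabilityMeasure_map hYm.aemeasurable
  refine tvDist_le_of_cylinders _ _ fun J B hB => ?_
  obtain ⟨k, t, hmono, h0, hmem, hsurj⟩ := exists_monotone_grid (J.image Subtype.val)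
  have htT : ∀ i, t i ≤ T := by
    intro i
    rcases Finset.mem_insert.1 (hmem i) with h | h
    · rw [h]
      exact zero_le
    · obtain ⟨j, -, hj⟩ := Finset.mem_image.1 h
      rw [← hj]
      exact j.2
  obtain ⟨κ, hκ1, hκ2⟩ := h k t hmono h0 htT
  choose! c hck hct using hsurj
  have hJ : ∀ j : J, (j : Set.Iic T).1 ∈ J.image Subtype.val := fun j =>
    Finset.mem_image_of_mem _ j.2
  -- the cylinder depends only on the observations at the times `t 0, …, t k`
  let r : (Fin (k + 1) → E) → (J → E) := fun f j => f ⟨c j, Nat.lt_succ_of_le (hck _ (hJ j))⟩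
  have hr : Measurable r := measurable_pi_lambda _ fun j => measurable_pi_apply _
  have hgX : Measurable fun ω (i : Fin (k + 1)) => X (t i) ω :=
    measurable_pi_lambda _ fun i => hX _
  have hgY : Measurable fun ω (i : Fin (k + 1)) => Y (t i) ω :=
    measurable_pi_lambda _ fun i => hY _
  have eX : (pathLaw P T X).real (cylinder J B) =
      (P.map fun ω (i : Fin (k + 1)) => X (t i) ω).real (r ⁻¹' B) := by
    rw [Measure.real, Measure.real, pathLaw, Measure.map_apply hXm hB.cylinder,
      Measure.map_apply hgX (hr hB)]
    congr 2
    ext ω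
    simp only [Set.mem_preimage, mem_cylinder]
    have : (J.restrict fun t : Set.Iic T => X t ω) = r fun i => X (t i) ω := by
      funext j
      simp only [r, Finset.restrict, hct _ (hJ j)]
    rw [this]
  have eY : (pathLaw P' T Y).real (cylinder J B) =
      (P'.map fun ω (i : Fin (k + 1)) => Y (t i) ω).real (r ⁻¹' B) := by
    rw [Measure.real, Measure.real, pathLaw, Measure.map_apply hYm hB.cylinder,
      Measure.map_apply hgY (hr hB)]
    congr 2
    ext ω
    simp only [Set.mem_preimage, mem_cylinder]
    have : (J.restrict fun t : Set.Iic T => Y t ω) = r fun i => Y (t i) ω := by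
      funext j
      simp only [r, Finset.restrict, hct _ (hJ j)]
    rw [this]
  rw [eX, eY]
  have hQ : IsProbabilityMeasure (P.map fun ω (i : Fin (k + 1)) => X (t i) ω) :=
    Measure.isProbabilityMeasure_map hgX.aemeasurable
  have hQ' : IsProbabilityMeasure (P'.map fun ω (i : Fin (k + 1)) => Y (t i) ω) :=
    Measure.isProbabilityMeasure_map hgY.aemeasurable
  have hinj : Function.Injective fun (p : Fin (k + 1) → Z) i => φ (p i) := fun p p' hpp =>
    funext fun i => hφ (congrFun hpp i)
  refine abs_measureReal_sub_le_of_common _ _ hinj (κ := κ) (fun p => ?_) (fun p => ?_) hδ hκ1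
    (hr hB)
  · rw [Measure.map_apply hgX (measurableSet_singleton _)]
    refine (hκ2 p).1.trans (le_of_eq ?_)
    congr 1
    ext ω
    simp [funext_iff]
  · rw [Measure.map_apply hgY (measurableSet_singleton _)]
    refine (hκ2 p).2.trans (le_of_eq ?_)
    congr 1
    ext ω
    simp [funext_iff]

/-! ### Comparison of the polling process with independent queues -/

section Comparison

variable {Ω Ω' : Type*} [MeasurableSpace Ω] [MeasurableSpace Ω'] {P : Measure Ω} {P' : Measure Ω'}

/-- Finite-dimensional distributions, with times and states indexed by `Fin (k + 1)`. -/
lemma IsMarkovJumpProcess.measure_fin {E : Type*} [MeasurableSpace E] {Λ : ℝ≥0} {K : E → PMF E}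
    {X : ℝ≥0 → Ω → E} (hX : IsMarkovJumpProcess Λ K P X) (k : ℕ) {t : ℕ → ℝ≥0} (ht : Monotone t)
    (e : Fin (k + 1) → E) :
    P {ω | ∀ i : Fin (k + 1), X (t i) ω = e i} =
      P {ω | X (t 0) ω = e 0} * ∏ i : Fin k,
        transitionLaw Λ K (t (i + 1) - t i) (e i.castSucc) (e i.succ) := by
  have h := hX.markov k t (fun i => e (Fin.ofNat (k + 1) i)) ht
  have e1 : {ω | ∀ i : Fin (k + 1), X (t i) ω = e i} =
      {ω | ∀ i ≤ k, X (t i) ω = e (Fin.ofNat (k + 1) i)} := by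
    ext ω
    constructor
    · intro hω i hi
      have := hω (Fin.ofNat (k + 1) i)
      rwa [Fin.val_ofNat, Nat.mod_eq_of_lt (Nat.lt_succ_of_le hi)] at this
    · intro hω i
      have := hω i (Nat.le_of_lt_succ i.2)
      rwa [Fin.ofNat_val_eq_self] at this
  rw [e1, h, Finset.prod_range]
  congr 1
  refine Finset.prod_congr rfl fun i _ => ?_
  have h1 : Fin.ofNat (k + 1) (i : ℕ) = i.castSucc :=
    Fin.ext (Nat.mod_eq_of_lt (Nat.lt_succ_of_lt i.2))
  have h2 : Fin.ofNat (k + 1) (i + 1 : ℕ) = i.succ :=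
    Fin.ext (Nat.mod_eq_of_lt (Nat.succ_lt_succ i.2))
  rw [h1, h2]

lemma IsIIDGeometric.measure_forall {N : ℕ} {rho : ℝ} {Q : Fin N → Ω → ℕ}
    (h : IsIIDGeometric rho P Q) (q : Fin N → ℕ) :
    P {ω | ∀ n, Q n ω = q n} = equilibrium rho q := by
  have e : {ω | ∀ n, Q n ω = q n} = ⋂ n, Q n ⁻¹' {q n} := by
    ext ω
    simp
  rw [e, h.1.meas_iInter fun n => ⟨{q n}, measurableSet_singleton _, rfl⟩, equilibrium]
  exact Finset.prod_congr rfl fun n _ => h.2 n (q n)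

/-- If some server is idle, the queue lengths determine the state: all non-empty queues are
served. -/
lemma Admissible.eq_served {N S : ℕ} {x : Config N} (hx : Admissible S x) {q : Fin N → ℕ}
    (hq : HasIdle S q) (h : ∀ n, (x n).1 = q n) : x = served q := by
  have hne : nonemptyQueues x < S := by
    rw [nonemptyQueues]
    simp only [h]
    exact hq
  funext n
  refine Prod.ext (h n) ?_
  cases hb : (x n).2
  · by_cases h0 : 0 < (x n).1
    · have h1 := hx.busy_eq_of_waiting h0 hb
      have h2 := hx.2
      omega
    · rw [h n] at h0
      simp [served, h0]
  · have h0 := hx.1 n hb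
    rw [h n] at h0
    simp [served, h0]

/-- Both processes, observed at finitely many times, dominate the killed process; hence the
bound on the total variation distance of the paths. -/
lemma tvDist_le_overflow [IsProbabilityMeasure P] [IsProbabilityMeasure P'] (hmu : 0 < mu)
    (hlt : lam < mu) {N S : ℕ} (hN : 0 < N) {X : ℝ≥0 → Ω → Config N} {L : Fin N → ℝ≥0 → Ω' → ℕ}
    (hX : IsPollingProcess lam mu N S P X)
    (hX0 : IsIIDGeometric ((lam : ℝ) / mu) P fun n ω => (X 0 ω n).1)
    (hL : IsIndepMM1 lam mu P' L) (T : ℝ≥0) (hover : overflow lam mu N S ≠ ∞)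
    (hone : 1 ≤ ∑' q : Fin N → ℕ, equilibrium ((lam : ℝ) / mu) q) :
    tvDist (pathLaw P T X) (pathLaw P' T (mm1Config L)) ≤
      ((1 + pollingIntensity lam mu N * T) * overflow lam mu N S).toReal := by
  classical
  set m : (Fin N → ℕ) → ℝ≥0∞ :=
    fun q => if HasIdle S q then equilibrium ((lam : ℝ) / mu) q else 0 with hm
  have hmle : ∀ q, m q ≤ equilibrium ((lam : ℝ) / mu) q := by
    intro q
    rw [hm]
    dsimp only
    split_ifs
    · exact le_rfl
    · exact zero_le
  have hmsum : 1 ≤ ∑' q, m q + overflow lam mu N S := by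
    refine hone.trans ?_
    rw [overflow, ← ENNReal.tsum_add]
    refine ENNReal.tsum_le_tsum fun q => ?_
    rw [hm]
    dsimp only
    split_ifs <;> simp
  have hLm : ∀ t, Measurable (mm1Config L t) := fun t =>
    measurable_pi_lambda _ fun n =>
      (measurable_of_countable fun j : ℕ => (j, decide (0 < j))).comp ((hL.jump n).measurable t)
  refine tvDist_pathLaw_le hX.jump.measurable hLm (ENNReal.mul_ne_top (by finiteness) hover)
    served_injective fun k t ht h0 hT => ?_
  set τ : Fin k → ℝ≥0 := fun i => t (i + 1) - t i with hτ
  have hτT : ∑ i, τ i ≤ T := by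
    rw [hτ, ← Finset.sum_range fun i => t (i + 1) - t i, Finset.sum_range_tsub ht]
    exact tsub_le_self.trans (hT k)
  refine ⟨killedPath lam mu S m τ, ?_, fun p => ⟨?_, ?_⟩⟩
  · calc (1 : ℝ≥0∞) ≤ ∑' q, m q + overflow lam mu N S := hmsum
      _ ≤ (∑' p, killedPath lam mu S m τ p +
            pollingIntensity lam mu N * (∑ i, τ i : ℝ≥0) * overflow lam mu N S) +
            overflow lam mu N S := by
          gcongr
          exact tsum_le_tsum_killedPath_add hmu hlt hN k τ hmle
      _ ≤ (∑' p, killedPath lam mu S m τ p +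
            pollingIntensity lam mu N * T * overflow lam mu N S) + overflow lam mu N S := by
          gcongr
      _ = _ := by ring
  · rw [hX.jump.measure_fin k ht fun i => served (p i), killedPath, h0]
    refine mul_le_mul' ?_ (Finset.prod_le_prod' fun i _ => ?_)
    · rw [hm]
      dsimp only
      split_ifs with hidle
      · rw [← hX0.measure_forall (p 0)]
        refine measure_mono_ae ?_
        filter_upwards [hX.initial] with ω hω hq
        exact hω.eq_served hidle hq
      · exact zero_le
    · exact killedLaw_le_transitionLaw hmu hN _ _ _
  · have e : {ω | ∀ i : Fin (k + 1), mm1Config L (t i) ω = served (p i)} =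
        ⋂ n, {ω | ∀ i : Fin (k + 1), L n (t i) ω = p i n} := by
      ext ω
      simp only [Set.mem_iInter, Set.mem_ofPred_eq]
      constructor
      · intro h n i
        exact congrFun (served_injective (h i)) n
      · intro h i
        have : (fun n => L n (t i) ω) = p i := funext fun n => h n i
        rw [← this]
        rfl
    have hind := hL.indep.meas_iInter (s := fun n => {ω | ∀ i : Fin (k + 1), L n (t i) ω = p i n})
      fun n => by
        refine ⟨⋂ i : Fin (k + 1), {f : ℝ≥0 → ℕ | f (t i) = p i n}, ?_, ?_⟩
        · exact MeasurableSet.iInter fun i =>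
            measurableSet_eq_fun (measurable_pi_apply _) measurable_const
        · ext ω
          simp
    rw [e, hind]
    have hfac : ∀ n, P' {ω | ∀ i : Fin (k + 1), L n (t i) ω = p i n} =
        ENNReal.ofReal ((1 - (lam : ℝ) / mu) * ((lam : ℝ) / mu) ^ p 0 n) * ∏ i : Fin k,
          transitionLaw (lam + mu) (mm1Step lam mu) (τ i) (p i.castSucc n) (p i.succ n) := by
      intro n
      rw [(hL.jump n).measure_fin k ht fun i => p i n, h0, hL.initial.2 n]
    simp only [hfac]
    rw [Finset.prod_mul_distrib, Finset.prod_comm, killedPath]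
    exact mul_le_mul' (hmle _) (Finset.prod_le_prod' fun i _ => killedLaw_le_prod hmu hN _ _ _)

end Comparison

/-! ### Rarity of the states without idle server -/

section Overflow

variable {Ω : Type*} [MeasurableSpace Ω] {P : Measure Ω} {N : ℕ}

open Classical in
lemma IsIIDGeometric.tsum_equilibrium_ite {rho : ℝ} {Q : Fin N → Ω → ℕ}
    (h : IsIIDGeometric rho P Q) (hQ : ∀ n, Measurable (Q n)) (p : (Fin N → ℕ) → Prop) :
    ∑' q, equilibrium rho q * (if p q then 1 else 0) = P {ω | p fun n => Q n ω} := by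
  have hm : Measurable fun ω n => Q n ω := measurable_pi_lambda _ hQ
  have hp : MeasurableSet {q : Fin N → ℕ | p q} := Set.to_countable _ |>.measurableSet
  have e : P {ω | p fun n => Q n ω} = P.map (fun ω n => Q n ω) {q | p q} := by
    rw [Measure.map_apply hm hp]
    rfl
  rw [e, ← Measure.tsum_indicator_apply_singleton _ _ hp]
  refine tsum_congr fun q => ?_
  have hq : P.map (fun ω n => Q n ω) {q} = equilibrium rho q := by
    rw [Measure.map_apply hm (measurableSet_singleton q), ← h.measure_forall q]
    congr 1
    ext ω
    simp [funext_iff]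
  by_cases hpq : p q <;> simp [Set.indicator, hpq, hq]

/-- Hoeffding's inequality for the number of non-empty queues, whose mean is `rho * N`. -/
lemma IsIIDGeometric.measureReal_not_hasIdle_le [IsProbabilityMeasure P] {rho : ℝ}
    {Q : Fin N → Ω → ℕ} (h : IsIIDGeometric rho P Q) (hQ : ∀ n, Measurable (Q n))
    (hrho1 : rho ≤ 1) {S : ℕ} {ε : ℝ} (hε : 0 ≤ ε)
    (hS : (rho + ε) * N ≤ S) :
    P.real {ω | ¬ HasIdle S fun n => Q n ω} ≤ Real.exp (-(2 * ε ^ 2 * N)) := by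
  set f : ℕ → ℝ := fun j => if 0 < j then 1 else 0 with hf
  have hfm : Measurable f := measurable_of_countable f
  have hmean : ∀ n, ∫ ω, f (Q n ω) ∂P = rho := by
    intro n
    have h0 : P {ω | Q n ω = 0} = ENNReal.ofReal (1 - rho) := by
      rw [h.2 n 0, pow_zero, mul_one]
    have h0m : MeasurableSet {ω | Q n ω = 0} := hQ n (measurableSet_singleton 0)
    have e : (fun ω => f (Q n ω)) = {ω | Q n ω = 0}ᶜ.indicator fun _ => (1 : ℝ) := by
      funext ω
      by_cases hω : Q n ω = 0
      · simp [hf, hω]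
      · simp [hf, hω, Nat.pos_of_ne_zero hω]
    rw [e, integral_indicator_const _ h0m.compl, measureReal_compl h0m, Measure.real, Measure.real,
      h0, ENNReal.toReal_ofReal (by linarith)]
    simp
  have hind : iIndepFun (fun n ω => f (Q n ω) - rho) P :=
    h.1.comp (fun _ j => f j - rho) fun n => hfm.sub_const rho
  have hsub : ∀ n ∈ (Finset.univ : Finset (Fin N)),
      HasSubgaussianMGF (fun ω => f (Q n ω) - rho) ((‖(1 : ℝ) - 0‖₊ / 2) ^ 2) P := by
    intro n _
    have := hasSubgaussianMGF_of_mem_Icc (μ := P) (X := fun ω => f (Q n ω)) (a := 0) (b := 1)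
      (hfm.comp (hQ n)).aemeasurable (ae_of_all _ fun ω => by
        simp only [hf]
        split_ifs <;> simp)
    rwa [hmean n] at this
  have key := HasSubgaussianMGF.measure_sum_ge_le_of_iIndepFun hind hsub
    (ε := ε * N) (by positivity)
  calc P.real {ω | ¬ HasIdle S fun n => Q n ω}
      ≤ P.real {ω | ε * N ≤ ∑ n, (f (Q n ω) - rho)} := by
        refine measureReal_mono fun ω hω => ?_
        have h1 : S ≤ (Finset.univ.filter fun n => 0 < Q n ω).card := not_lt.1 hω
        have h2 : (S : ℝ) ≤ (Finset.univ.filter fun n => 0 < Q n ω).card := by exact_mod_cast h1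
        have h3 : ∑ n, (f (Q n ω) - rho) =
            (Finset.univ.filter fun n => 0 < Q n ω).card - N * rho := by
          rw [Finset.sum_sub_distrib, Finset.sum_const, Finset.card_univ, Fintype.card_fin,
            nsmul_eq_mul, Finset.card_filter]
          simp [hf]
        change ε * N ≤ ∑ n, (f (Q n ω) - rho)
        rw [h3]
        linarith
    _ ≤ _ := key
    _ = Real.exp (-(2 * ε ^ 2 * N)) := by
        congr 1
        rcases Nat.eq_zero_or_pos N with rfl | hN
        · simp
        · have hN' : (N : ℝ) ≠ 0 := by exact_mod_cast hN.ne'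
          simp only [sub_zero, nnnorm_one, Finset.sum_const, Finset.card_univ, Fintype.card_fin,
            nsmul_eq_mul]
          push_cast
          field_simp

end Overflow

/-- The quantitative form of the comparison theorem. -/
theorem tvDist_pathLaw_le_exp {Ω Ω' : Type*} [MeasurableSpace Ω] [MeasurableSpace Ω']
    {P : Measure Ω} {P' : Measure Ω'} [IsProbabilityMeasure P] [IsProbabilityMeasure P']
    (hmu : 0 < mu) (hlt : lam < mu) {N S : ℕ} (hN : 0 < N) {X : ℝ≥0 → Ω → Config N}
    {L : Fin N → ℝ≥0 → Ω' → ℕ} (hX : IsPollingProcess lam mu N S P X)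
    (hX0 : IsIIDGeometric ((lam : ℝ) / mu) P fun n ω => (X 0 ω n).1)
    (hL : IsIndepMM1 lam mu P' L) (T : ℝ≥0) {ε : ℝ} (hε : 0 ≤ ε)
    (hS : ((lam : ℝ) / mu + ε) * N ≤ S) :
    tvDist (pathLaw P T X) (pathLaw P' T (mm1Config L)) ≤
      (1 + N * (lam + mu) * T) * Real.exp (-(2 * ε ^ 2 * N)) := by
  classical
  have hQ : ∀ n, Measurable fun ω => (X 0 ω n).1 := fun n =>
    (measurable_pi_apply n |>.comp (hX.jump.measurable 0)).fst
  have hover : overflow lam mu N S = P {ω | ¬ HasIdle S fun n => (X 0 ω n).1} := by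
    rw [← hX0.tsum_equilibrium_ite hQ fun q => ¬ HasIdle S q, overflow]
    refine tsum_congr fun q => ?_
    split_ifs <;> simp_all
  have hone : 1 ≤ ∑' q : Fin N → ℕ, equilibrium ((lam : ℝ) / mu) q := by
    have := hX0.tsum_equilibrium_ite hQ fun _ => True
    simp only [if_true, mul_one, Set.ofPred_true, measure_univ] at this
    exact this.ge
  have hmu' : (0 : ℝ) < mu := hmu
  have hrho1 : (lam : ℝ) / mu ≤ 1 := by
    rw [div_le_one hmu']
    exact_mod_cast hlt.le
  have htv := tvDist_le_overflow hmu hlt hN hX hX0 hL T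
    (by rw [hover]; exact measure_ne_top _ _) hone
  rw [ENNReal.toReal_mul, hover] at htv
  refine htv.trans ?_
  have h1 : ((1 + pollingIntensity lam mu N * T : ℝ≥0∞)).toReal = 1 + N * (lam + mu) * T := by
    rw [show (1 + pollingIntensity lam mu N * T : ℝ≥0∞) =
      ((1 + pollingIntensity lam mu N * T : ℝ≥0) : ℝ≥0∞) by push_cast; rfl, ENNReal.coe_toReal,
      pollingIntensity]
    push_cast
    rfl
  rw [h1]
  exact mul_le_mul_of_nonneg_left (hX0.measureReal_not_hasIdle_le hQ hrho1 hε hS)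
    (by positivity)

lemma tendsto_linear_mul_exp_neg {c : ℝ} (hc : 0 < c) (a : ℝ) :
    Tendsto (fun N : ℕ => (1 + N * a) * Real.exp (-(c * N))) atTop (𝓝 0) := by
  have h0 : Tendsto (fun N : ℕ => c * (N : ℝ)) atTop atTop :=
    tendsto_natCast_atTop_atTop.const_mul_atTop hc
  have h1 := (Real.tendsto_pow_mul_exp_neg_atTop_nhds_zero 0).comp h0
  have h2 := ((Real.tendsto_pow_mul_exp_neg_atTop_nhds_zero 1).comp h0).const_mul (a / c)
  have h3 := h1.add h2
  rw [mul_zero, add_zero] at h3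
  refine h3.congr fun N => ?_
  simp only [Function.comp_apply, pow_zero, one_mul, pow_one]
  field_simp

/-- A sequence of numbers of servers with the prescribed density that stays strictly below it. -/
lemma tendsto_ceil_sub_one_div (s : ℝ) (hs : 0 ≤ s) :
    Tendsto (fun N : ℕ => ((⌈s * N⌉₊ - 1 : ℕ) : ℝ) / N) atTop (𝓝 s) := by
  have h1 : Tendsto (fun N : ℕ => s - 1 / (N : ℝ)) atTop (𝓝 s) := by
    have := (tendsto_const_nhds (x := s)).sub (tendsto_const_div_atTop_nhds_zero_nat (1 : ℝ))
    rwa [sub_zero] at this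
  refine tendsto_of_tendsto_of_tendsto_of_le_of_le' h1 tendsto_const_nhds ?_ ?_
  · filter_upwards [eventually_gt_atTop 0] with N hN
    have hN' : (0 : ℝ) < N := by exact_mod_cast hN
    rw [le_div_iff₀ hN', sub_mul, one_div, inv_mul_cancel₀ hN'.ne']
    have h2 : s * N ≤ (⌈s * N⌉₊ : ℝ) := Nat.le_ceil _
    have h3 : (⌈s * N⌉₊ : ℝ) ≤ ((⌈s * N⌉₊ - 1 : ℕ) : ℝ) + 1 := by
      exact_mod_cast (by omega : ⌈s * N⌉₊ ≤ ⌈s * N⌉₊ - 1 + 1)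
    linarith
  · filter_upwards [eventually_gt_atTop 0] with N hN
    have hN' : (0 : ℝ) < N := by exact_mod_cast hN
    rw [div_le_iff₀ hN']
    rcases Nat.eq_zero_or_pos ⌈s * N⌉₊ with h0 | h0
    · rw [h0]
      simp only [Nat.zero_sub, Nat.cast_zero]
      positivity
    · exact (Nat.lt_ceil.1 (Nat.sub_lt h0 one_pos)).le

end Polling

theorem mainTheorem2 (lam mu : ℝ≥0) (hlam : 0 < lam) (hmu : 0 < mu)
    (s : ℝ) (hs0 : 0 < s) (hs1 : s < 1) :
    -- if `ρ < s`, on `[0, T]` the polling process is asymptotically `N` independent M/M/1 queues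
    ((lam : ℝ) / mu < s →
      ∀ S : ℕ → ℕ, Tendsto (fun N => (S N : ℝ) / N) atTop (𝓝 s) →
      ∀ (Ω Ω' : ℕ → Type*) [∀ N, MeasurableSpace (Ω N)] [∀ N, MeasurableSpace (Ω' N)]
        (P : ∀ N, Measure (Ω N)) (P' : ∀ N, Measure (Ω' N))
        [∀ N, IsProbabilityMeasure (P N)] [∀ N, IsProbabilityMeasure (P' N)]
        (X : ∀ N, ℝ≥0 → Ω N → Polling.Config N) (L : ∀ N, Fin N → ℝ≥0 → Ω' N → ℕ),
        (∀ N, Polling.IsPollingProcess lam mu N (S N) (P N) (X N)) →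
        (∀ N, Polling.IsIIDGeometric ((lam : ℝ) / mu) (P N) fun n ω => (X N 0 ω n).1) →
        (∀ N, Polling.IsIndepMM1 lam mu (P' N) (L N)) →
        ∀ T : ℝ≥0, Tendsto
          (fun N => Polling.tvDist (Polling.pathLaw (P N) T (X N))
            (Polling.pathLaw (P' N) T (Polling.mm1Config (L N))))
          atTop (𝓝 0)) ∧
    -- `ρ < s` is the stability condition in the limit
    ((lam : ℝ) / mu < s ↔
      ∀ S : ℕ → ℕ, Tendsto (fun N => (S N : ℝ) / N) atTop (𝓝 s) →
        ∀ᶠ N in atTop, Polling.IsStable lam mu N (S N)) ∧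
    (s < (lam : ℝ) / mu →
      ∀ S : ℕ → ℕ, Tendsto (fun N => (S N : ℝ) / N) atTop (𝓝 s) →
        ∀ᶠ N in atTop, ¬ ∃ pi : PMF (Polling.Config N), Polling.IsStationary lam mu (S N) pi) := by
  have hmu' : (0 : ℝ) < mu := hmu
  refine ⟨fun hrho S hS Ω Ω' _ _ P P' _ _ X L hX hX0 hL T => ?_, ⟨fun hrho S hS => ?_, fun h => ?_⟩,
    fun hrho S hS => ?_⟩
  · have hlt : lam < mu := by
      rw [div_lt_iff₀ hmu'] at hrho
      exact NNReal.coe_lt_coe.1 (by nlinarith)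
    set ε : ℝ := (s - lam / mu) / 2 with hε
    have hε0 : 0 < ε := by
      rw [hε]
      linarith
    refine tendsto_of_tendsto_of_tendsto_of_le_of_le' tendsto_const_nhds
      (Polling.tendsto_linear_mul_exp_neg (c := 2 * ε ^ 2) (by positivity) ((lam + mu) * T))
      (Eventually.of_forall fun N => Polling.tvDist_nonneg _ _) ?_
    filter_upwards [hS.eventually_const_lt (show (lam : ℝ) / mu + ε < s by rw [hε]; linarith),
      eventually_gt_atTop 0] with N hN hN0
    have hN' : (0 : ℝ) < N := by exact_mod_cast hN0
    rw [lt_div_iff₀ hN'] at hN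
    have := Polling.tvDist_pathLaw_le_exp hmu hlt hN0 (hX N) (hX0 N) (hL N) T hε0.le hN.le
    rwa [mul_assoc (N : ℝ)] at this
  · filter_upwards [hS.eventually_const_lt hrho, hS.eventually_lt_const hs1,
      eventually_gt_atTop 0] with N h1 h2 hN0
    have hN' : (0 : ℝ) < N := by exact_mod_cast hN0
    rw [lt_div_iff₀ hN', div_mul_eq_mul_div, div_lt_iff₀ hmu'] at h1
    rw [div_lt_one hN'] at h2
    have hlamN : (0 : ℝ) ≤ lam * N := by positivity
    refine Polling.isStable_of_lt hlam hmu ?_ (by exact_mod_cast h2.le) (by linarith)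
    by_contra h0
    rw [Nat.eq_zero_of_not_pos h0, Nat.cast_zero, zero_mul] at h1
    linarith
  · -- with slightly fewer than `s * N` servers the system is overloaded if `s ≤ ρ`
    by_contra hrho
    have hev := h (fun N => ⌈s * N⌉₊ - 1) (Polling.tendsto_ceil_sub_one_div s hs0.le)
    obtain ⟨N, ⟨pi, hpi, -⟩, hN0⟩ := (hev.and (eventually_gt_atTop 0)).exists
    have hN' : (0 : ℝ) < N := by exact_mod_cast hN0
    have hlt : ((⌈s * N⌉₊ - 1 : ℕ) : ℝ) < s * N :=
      Nat.lt_ceil.1 (Nat.sub_lt (Nat.ceil_pos.2 (by positivity)) one_pos)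
    have hs : mu * s ≤ lam := by
      rw [not_lt, le_div_iff₀ hmu'] at hrho
      linarith
    refine Polling.not_exists_isStationary hlam hmu hN0 ?_ ⟨pi, hpi⟩
    calc (mu : ℝ) * ((⌈s * N⌉₊ - 1 : ℕ) : ℝ) < mu * (s * N) := by gcongr
      _ = mu * s * N := by ring
      _ ≤ lam * N := by gcongr
  · filter_upwards [hS.eventually_lt_const hrho, eventually_gt_atTop 0] with N h1 hN0
    have hN' : (0 : ℝ) < N := by exact_mod_cast hN0
    rw [div_lt_div_iff₀ hN' hmu'] at h1
    exact Polling.not_exists_isStationary hlam hmu hN0 (by linarith)
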